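/- Let $\mathbf{k}$ be an algebraically closed field (of any characteristic), let $X_1, X_2$ be projective varieties over $\mathbf{k}$, and let $f_i\colon X_i\to X_i$ ($i=1,2$) be polarized endomorphisms over $\mathbf{k}$; that is, there are an ample line bundle $L_i$ on $X_i$ and an integer $\lambda_1(f_i)\ge 2$ such that $f_i^*L_i\cong L_i^{\otimes \lambda_1(f_i)}$. If $\lambda_1(f_1)\neq\lambda_1(f_2)$, then $f_1$ and $f_2$ are independent, i.e. every closed irreducible $(f_1\times f_2)$-periodic subvariety $Z\subseteq X_1\times X_2$ is of the form $Z=Z_1\times Z_2$, where $Z_1\subseteq X_1$ and $Z_2\subseteq X_2$ are closed irreducible subvarieties that are periodic for $f_1$ and $f_2$ respectively. (Here a closed subvariety $V$ is periodic for an endomorphism $g$ if $g^n(V)\subseteq V$ for some $n\ge 1$.) -/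

import Mathlib

universe u

noncomputable section

open AlgebraicGeometry CategoryTheory CategoryTheory.Limits

namespace PolarizedDynamics

section LineBundles

/-- Restriction of functions `Γ(X, V) → Γ(X, U)` for opens `U ≤ V`. -/
def res {X : Scheme.{u}} {U V : X.Opens} (h : U ≤ V) : Γ(X, V) →+* Γ(X, U) :=
  (X.presheaf.map (homOfLE h).op).hom

/-- Restriction of invertible functions. -/
def resUnits {X : Scheme.{u}} {U V : X.Opens} (h : U ≤ V) : Γ(X, V)ˣ →* Γ(X, U)ˣ :=
  Units.map (res h).toMonoidHom

/-- A line bundle on a scheme `X`, given by an open cover that trivializes it and its transition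
functions `g i j`, invertible functions on `U i ⊓ U j` that satisfy the cocycle condition.
The convention is that a section has components `s i` with `s i = g i j * s j` on overlaps. -/
structure LineBundle (X : Scheme.{u}) where
  /-- the index set of the trivializing cover -/
  ι : Type u
  /-- the trivializing cover -/
  U : ι → X.Opens
  cover : ⨆ i, U i = ⊤
  /-- the transition functions -/
  g : ∀ i j, Γ(X, U i ⊓ U j)ˣ
  cocycle : ∀ i j l,
    resUnits (inf_le_left : U i ⊓ U j ⊓ U l ≤ U i ⊓ U j) (g i j) *
      resUnits (le_inf (inf_le_left.trans inf_le_right) inf_le_right :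
        U i ⊓ U j ⊓ U l ≤ U j ⊓ U l) (g j l) =
      resUnits (le_inf (inf_le_left.trans inf_le_left) inf_le_right :
        U i ⊓ U j ⊓ U l ≤ U i ⊓ U l) (g i l)

namespace LineBundle

variable {X Y : Scheme.{u}}

/-- The tensor power `L^{⊗ n}`. -/
def pow (L : LineBundle X) (n : ℕ) : LineBundle X where
  ι := L.ι
  U := L.U
  cover := L.cover
  g i j := L.g i j ^ n
  cocycle i j l := by
    rw [map_pow, map_pow, map_pow, ← mul_pow, L.cocycle]

/-- Pullback of functions commutes with restriction. -/
lemma app_res (f : X ⟶ Y) {U V : Y.Opens} (h : U ≤ V) (h' : f ⁻¹ᵁ U ≤ f ⁻¹ᵁ V) (a : Γ(Y, V)) :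
    res h' ((f.app V).hom a) = (f.app U).hom (res h a) :=
  (congrArg (fun φ => φ.hom a) (f.naturality (homOfLE h).op)).symm

/-- Pullback of invertible functions commutes with restriction. -/
lemma app_resUnits (f : X ⟶ Y) {U V : Y.Opens} (h : U ≤ V) (h' : f ⁻¹ᵁ U ≤ f ⁻¹ᵁ V)
    (a : Γ(Y, V)ˣ) :
    resUnits h' (Units.map (f.app V).hom.toMonoidHom a) =
      Units.map (f.app U).hom.toMonoidHom (resUnits h a) :=
  Units.ext (app_res f h h' a)

/-- The pullback `f^* L` along a morphism of schemes. -/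
def pullback (f : X ⟶ Y) (L : LineBundle Y) : LineBundle X where
  ι := L.ι
  U i := f ⁻¹ᵁ L.U i
  cover := by
    rw [← Scheme.Hom.preimage_iSup, L.cover]
    rfl
  g i j := Units.map (f.app (L.U i ⊓ L.U j)).hom.toMonoidHom (L.g i j)
  cocycle i j l := by
    have key := congrArg (Units.map (f.app (L.U i ⊓ L.U j ⊓ L.U l)).hom.toMonoidHom)
      (L.cocycle i j l)
    rw [map_mul, ← app_resUnits f _ (f.preimage_mono inf_le_left),
      ← app_resUnits f _ (f.preimage_mono
        (le_inf (inf_le_left.trans inf_le_right) inf_le_right)),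
      ← app_resUnits f _ (f.preimage_mono
        (le_inf (inf_le_left.trans inf_le_left) inf_le_right))] at key
    exact key

/-- An isomorphism of line bundles `L → M`: invertible functions `h a i` on `M.U a ⊓ L.U i` (the map
in the local trivializations) that are compatible with the transition functions. -/
structure Iso (L M : LineBundle X) where
  /-- the isomorphism in the local trivializations -/
  h : ∀ (a : M.ι) (i : L.ι), Γ(X, M.U a ⊓ L.U i)ˣ
  comm : ∀ a b i j,
    resUnits (le_inf (inf_le_left.trans inf_le_left) (inf_le_right.trans inf_le_left) :
        (M.U a ⊓ M.U b) ⊓ (L.U i ⊓ L.U j) ≤ M.U a ⊓ L.U i) (h a i) *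
      resUnits inf_le_right (L.g i j) =
    resUnits inf_le_left (M.g a b) *
      resUnits (le_inf (inf_le_left.trans inf_le_right) (inf_le_right.trans inf_le_right) :
        (M.U a ⊓ M.U b) ⊓ (L.U i ⊓ L.U j) ≤ M.U b ⊓ L.U j) (h b j)

/-- A global section of a line bundle. -/
structure GlobalSection (L : LineBundle X) where
  /-- the components of the section in the local trivializations -/
  s : ∀ i, Γ(X, L.U i)
  compat : ∀ i j, res inf_le_left (s i) = (L.g i j : Γ(X, L.U i ⊓ L.U j)) * res inf_le_right (s j)

/-- The open set `X_s` on which a global section `s` does not vanish. -/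
def GlobalSection.nonvanishing {L : LineBundle X} (t : L.GlobalSection) : X.Opens :=
  ⨆ i, X.basicOpen (t.s i)

/-- A line bundle `L` on `X` is ample if `X` is quasi-compact and every point of `X` lies in an
affine open set of the form `X_s`, where `s` is a global section of `L^{⊗ n}` for some `n ≥ 1`. -/
def IsAmple (L : LineBundle X) : Prop :=
  CompactSpace X ∧ ∀ x : X, ∃ n : ℕ, 1 ≤ n ∧ ∃ t : (L.pow n).GlobalSection,
    x ∈ t.nonvanishing ∧ IsAffineOpen t.nonvanishing

end LineBundle

end LineBundles

section Varieties

variable {k : Type u} [Field k]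

attribute [local instance] MvPolynomial.gradedAlgebra

/-- The projective space `ℙ^N = Proj k[x_0, …, x_N]` over `k`. -/
def projectiveSpace (k : Type u) [Field k] (N : ℕ) : Over (Spec (.of k)) :=
  Over.mk (Proj.toSpecZero (MvPolynomial.homogeneousSubmodule (Fin (N + 1)) k) ≫
    Spec.map (CommRingCat.ofHom
      (algebraMap k (MvPolynomial.homogeneousSubmodule (Fin (N + 1)) k 0))))

/-- A projective variety over `k` (which is algebraically closed in the applications): an integral
`k`-scheme that admits a closed immersion over `k` into some projective space. -/
structure IsProjectiveVariety (X : Over (Spec (.of k))) : Prop where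
  isIntegral : IsIntegral X.left
  projective : ∃ (N : ℕ) (i : X ⟶ projectiveSpace k N), IsClosedImmersion i.left

/-- The endomorphism `f` of `X` over `k` is polarized, with `λ₁(f) = q`: `q ≥ 2` and there is an
ample line bundle `L` with `f^* L ≅ L^{⊗ q}`. -/
def IsPolarized {X : Over (Spec (.of k))} (f : X ⟶ X) (q : ℕ) : Prop :=
  2 ≤ q ∧ ∃ L : LineBundle X.left, L.IsAmple ∧ Nonempty ((L.pullback f.left).Iso (L.pow q))

/-- A closed irreducible subvariety `Z` of `X`, as a closed irreducible subset, that is periodic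
under `φ`: some positive iterate of `φ` maps `Z` into itself. -/
structure IsPeriodicSubvariety {X : Scheme.{u}} (φ : X ⟶ X) (Z : Set X) : Prop where
  isClosed : IsClosed Z
  isIrreducible : IsIrreducible Z
  periodic : ∃ n : ℕ, 1 ≤ n ∧ Set.MapsTo (φ : X → X)^[n] Z Z

/-- The product `X ×ₖ Y`. -/
abbrev prod (X Y : Over (Spec (.of k))) : Scheme.{u} := Limits.pullback X.hom Y.hom

/-- The product endomorphism `f × g` of `X ×ₖ Y`. -/
def prodMap {X Y : Over (Spec (.of k))} (f : X ⟶ X) (g : Y ⟶ Y) : prod X Y ⟶ prod X Y :=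
  pullback.map X.hom Y.hom X.hom Y.hom f.left g.left (𝟙 _) (by simp) (by simp)

/-- `f` and `g` are independent: every irreducible closed `(f × g)`-periodic subvariety of `X ×ₖ Y`
is a product `Z₁ ×ₖ Z₂` of periodic closed subvarieties of `X` and `Y`. -/
def Independent {X Y : Over (Spec (.of k))} (f : X ⟶ X) (g : Y ⟶ Y) : Prop :=
  ∀ Z : Set (prod X Y), IsPeriodicSubvariety (prodMap f g) Z →
    ∃ (Z₁ : Set X.left) (Z₂ : Set Y.left),
      IsPeriodicSubvariety f.left Z₁ ∧ IsPeriodicSubvariety g.left Z₂ ∧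
      Z = (pullback.fst X.hom Y.hom : prod X Y → X.left) ⁻¹' Z₁ ∩
        (pullback.snd X.hom Y.hom : prod X Y → Y.left) ⁻¹' Z₂

end Varieties

end PolarizedDynamics

end

/-! Let `ζ` be the generic point of `Z`, let `F` be the iterate of `f₁ × f₂` that maps `Z` into
itself, and let `K` be the residue field of `ζ`. Ampleness prevents `F` from contracting anything:
`K` is algebraic over the image of the residue field of `F ζ`, so `ζ` cannot move to a proper
specialization and `F ζ = ζ` (`apply_eq_of_specializes`). The iterates of `F` therefore act on `K`
by embeddings `φ` over `k`. It remains to see that `ζ` is generic in the product of the closures of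
its two projections. Over an algebraically closed field this holds once the coordinates of the two
projections are algebraically independent of each other (`specializes_of_algebraicIndependent`).

Sections of a power of `Lᵢ`, evaluated at `ζ` and divided by one of them, span a finite-dimensional
subspace `Wᵢ` of `K` containing 1. By properness `ζ` extends to every valuation ring of `K` over
`k`, and there the isomorphism `fᵢ^* Lᵢ ≅ Lᵢ^qᵢ` says that `φ(Wᵢ)` generates, up to one common
scalar, the `qᵢ`-th power of the fractional ideal generated by `Wᵢ`. The valuative criterion of
integral dependence (`dominated_span_singleton_of_forall_valuationSubring`) turns this into mutual
domination of `u φ(Wᵢ)` and `Wᵢ^qᵢ` (`AffineSections.isScaling`).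

Dimension counts for `W₁^m W₂^n` now play the role of intersection numbers. Let `d` and `rᵢ` be the
transcendence degrees of `K` and `k(Wᵢ)`, and let `q₁ < q₂`. For `n ≤ m` the dimension is `O(m^r₁
n^(d-r₁))`, which gives `[K : φ(K)] ≤ C q₁^r₁ q₂^(d-r₁)` (`exists_finrank_fieldRange_le`). Monomials
in a transcendence basis that contains one of `W₂` give `q₁^(d-r₂) q₂^r₂ ≤ C' [K : φ(K)]`
(`exists_le_finrank_fieldRange`). The constants do not depend on `φ`, so iteration removes them.
Since `r₁ + r₂ ≥ d` and `q₁ < q₂`, it follows that `r₁ + r₂ = d`, which is the required independence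
(`exists_algebraicIndependent_sumElim`). -/

noncomputable section

open AlgebraicGeometry CategoryTheory CategoryTheory.Limits

namespace PolarizedDynamics

/-! ### Integral dependence of subspaces of a field, and its valuative criterion. -/

section Domination

variable {k K : Type*} [Field k] [Field K] [Algebra k K]

lemma fg_one_submodule : (1 : Submodule k K).FG := by
  rw [Submodule.one_eq_span]; exact Submodule.fg_span_singleton _

/-- A subspace `Y` of `K` is dominated by a subspace `W` if `Y * M ≤ W * M` for some nonzero
finite-dimensional subspace `M`. -/
def Dominated (Y W : Submodule k K) : Prop :=
  ∃ M : Submodule k K, M.FG ∧ M ≠ ⊥ ∧ Y * M ≤ W * M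

namespace Dominated

lemma bot (W : Submodule k K) : Dominated ⊥ W :=
  ⟨1, fg_one_submodule, one_ne_zero, by simp⟩

lemma sup {Y Y' W : Submodule k K} (h : Dominated Y W) (h' : Dominated Y' W) :
    Dominated (Y ⊔ Y') W := by
  obtain ⟨M, hM, hM0, hle⟩ := h
  obtain ⟨M', hM', hM0', hle'⟩ := h'
  refine ⟨M * M', hM.mul hM', mul_ne_zero hM0 hM0', ?_⟩
  rw [Submodule.sup_mul]
  refine sup_le ?_ ?_
  · rw [← mul_assoc, ← mul_assoc]
    exact mul_le_mul' hle le_rfl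
  · rw [mul_left_comm, mul_left_comm W]
    exact mul_le_mul' le_rfl hle'

lemma mul {Y Y' W W' : Submodule k K} (h : Dominated Y W) (h' : Dominated Y' W') :
    Dominated (Y * Y') (W * W') := by
  obtain ⟨M, hM, hM0, hle⟩ := h
  obtain ⟨M', hM', hM0', hle'⟩ := h'
  refine ⟨M * M', hM.mul hM', mul_ne_zero hM0 hM0', ?_⟩
  rw [mul_mul_mul_comm, mul_mul_mul_comm W]
  exact mul_le_mul' hle hle'

lemma span {W : Submodule k K} {s : Set K} (hs : s.Finite)
    (h : ∀ y ∈ s, Dominated (Submodule.span k {y}) W) : Dominated (Submodule.span k s) W := by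
  induction s, hs using Set.Finite.induction_on with
  | empty => simpa using bot W
  | insert _ _ ih =>
    rw [Submodule.span_insert]
    exact (h _ (by simp)).sup (ih fun y hy => h y (by simp [hy]))

lemma of_forall_mem {Y W : Submodule k K} (hY : Y.FG)
    (h : ∀ y ∈ Y, Dominated (Submodule.span k {y}) W) : Dominated Y W := by
  obtain ⟨s, rfl⟩ := hY
  exact span s.finite_toSet fun y hy => h y (Submodule.subset_span hy)

end Dominated

/-- The same `M` serves for every exponent, so in asymptotic counts it costs only a constant factor.
-/
lemma pow_mul_le_pow_mul {Y W M : Submodule k K} (h : Y * M ≤ W * M) (n : ℕ) :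
    Y ^ n * M ≤ W ^ n * M := by
  induction n with
  | zero => simp
  | succ n ih =>
    calc Y ^ (n + 1) * M = Y ^ n * (Y * M) := by rw [pow_succ, mul_assoc]
      _ ≤ Y ^ n * (W * M) := mul_le_mul' le_rfl h
      _ = W * (Y ^ n * M) := mul_left_comm _ _ _
      _ ≤ W * (W ^ n * M) := mul_le_mul' le_rfl ih
      _ = W ^ (n + 1) * M := by rw [pow_succ', mul_assoc]

/-- The hypothesis is a homogeneous equation of integral dependence of `y` on `W`. It makes `M = (Y
+ W)^n` a witness: in `Y M` the only term outside `W M` is `Y^(n+1)`, and the equation puts that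
into `W M`. -/
lemma dominated_span_singleton_of_pow_mem {W : Submodule k K} (hW : W.FG) {y : K} {n : ℕ}
    (hy0 : y ≠ 0) (h : y ^ (n + 1) ∈ W * (Submodule.span k {y} ⊔ W) ^ n) :
    Dominated (Submodule.span k {y}) W := by
  set Y := Submodule.span k {y} with hYdef
  have hYpow : ∀ m, Y ^ m = Submodule.span k {y ^ m} := fun m => by
    rw [hYdef, Submodule.span_pow, Set.singleton_pow]
  have hYW : Y ^ (n + 1) ≤ W * (Y ⊔ W) ^ n := by
    rw [hYpow, Submodule.span_singleton_le_iff_mem]; exact h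
  have key : ∀ m, Y * (Y ⊔ W) ^ m ≤ W * (Y ⊔ W) ^ m ⊔ Y ^ (m + 1) := by
    intro m
    induction m with
    | zero => simp
    | succ m ih =>
      calc Y * (Y ⊔ W) ^ (m + 1) = Y * (Y * (Y ⊔ W) ^ m) ⊔ Y * (W * (Y ⊔ W) ^ m) := by
            rw [pow_succ', Submodule.sup_mul, Submodule.mul_sup]
        _ ≤ Y * (W * (Y ⊔ W) ^ m ⊔ Y ^ (m + 1)) ⊔ Y * (W * (Y ⊔ W) ^ m) :=
            sup_le_sup (mul_le_mul' le_rfl ih) le_rfl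
        _ ≤ W * (Y ⊔ W) ^ (m + 1) ⊔ Y ^ (m + 1 + 1) := by
            have h1 : Y * (W * (Y ⊔ W) ^ m) ≤ W * (Y ⊔ W) ^ (m + 1) := by
              rw [mul_left_comm, pow_succ']
              exact mul_le_mul' le_rfl (mul_le_mul' le_sup_left le_rfl)
            rw [Submodule.mul_sup, ← pow_succ']
            exact sup_le (sup_le (h1.trans le_sup_left) le_sup_right) (h1.trans le_sup_left)
  refine ⟨(Y ⊔ W) ^ n, ((Submodule.fg_span_singleton y).sup hW).pow n, ?_,
    (key n).trans (sup_le le_rfl hYW)⟩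
  refine pow_ne_zero _ fun h0 => hy0 ?_
  have : y ∈ Y ⊔ W := Submodule.mem_sup_left (Submodule.mem_span_singleton_self y)
  rw [h0] at this
  simpa using this

lemma exists_mem_one_sup_pow_of_mem_adjoin (T : Submodule k K) {a : K}
    (ha : a ∈ Algebra.adjoin k (T : Set K)) : ∃ n : ℕ, a ∈ (1 ⊔ T) ^ n := by
  have hmono : ∀ {m n : ℕ}, m ≤ n → (1 ⊔ T) ^ m ≤ (1 ⊔ T) ^ n :=
    fun h => pow_le_pow_right₀ le_sup_left h
  induction ha using Algebra.adjoin_induction with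
  | mem x hx => exact ⟨1, by rw [pow_one]; exact Submodule.mem_sup_right hx⟩
  | algebraMap r => exact ⟨0, by simp⟩
  | add x y _ _ hx hy =>
    obtain ⟨m, hm⟩ := hx
    obtain ⟨n, hn⟩ := hy
    exact ⟨max m n, add_mem (hmono (le_max_left _ _) hm) (hmono (le_max_right _ _) hn)⟩
  | mul x y _ _ hx hy =>
    obtain ⟨m, hm⟩ := hx
    obtain ⟨n, hn⟩ := hy
    exact ⟨m + n, by rw [pow_add]; exact Submodule.mul_mem_mul hm hn⟩

/-- If every valuation subring of `K` over `k` gives `y` at least the value of some nonzero element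
of `W`, then `y` is dominated by `W`. -/
lemma dominated_span_singleton_of_forall_valuationSubring {W : Submodule k K} (hW : W.FG) {y : K}
    (h : ∀ V : ValuationSubring K, (∀ c : k, algebraMap k K c ∈ V) →
      ∃ w ∈ W, w ≠ 0 ∧ y / w ∈ V) :
    Dominated (Submodule.span k {y}) W := by
  by_cases hy0 : y = 0
  · rw [hy0]; simpa using Dominated.bot W
  set T : Submodule k K := W * Submodule.span k {y⁻¹} with hT
  have hwT : ∀ w ∈ W, w * y⁻¹ ∈ T := fun w hw =>
    Submodule.mul_mem_mul hw (Submodule.mem_span_singleton_self _)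
  set A : Subalgebra k K := Algebra.adjoin k (T : Set K) with hA
  have hTA : (T : Set K) ⊆ A := Algebra.subset_adjoin
  set I : Ideal A.toSubring := Ideal.span {a | (a : K) ∈ T} with hI
  -- If `I` were proper, some valuation ring containing `A` would have all `w / y` with `w ∈ W`
  -- among its nonunits, whereas `h` provides a nonzero `w` with `y / w` in that ring.
  have hItop : I = ⊤ := by
    by_contra hne
    obtain ⟨V, hAV, hIV⟩ := Ideal.image_subset_nonunits_valuationSubring I hne
    obtain ⟨w, hw, hw0, hyw⟩ := h V fun c => hAV (A.algebraMap_mem c)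
    have hmem : w * y⁻¹ ∈ V.nonunits :=
      hIV ⟨⟨w * y⁻¹, hTA (hwT w hw)⟩, Ideal.subset_span (hwT w hw), rfl⟩
    rw [ValuationSubring.mem_nonunits_iff] at hmem
    rw [← V.valuation_le_one_iff, show y / w = (w * y⁻¹)⁻¹ by field_simp, map_inv₀] at hyw
    have hne0 : V.valuation (w * y⁻¹) ≠ 0 := by
      rw [Ne, map_eq_zero]; exact mul_ne_zero hw0 (inv_ne_zero hy0)
    exact absurd hyw (not_le.2 ((one_lt_inv₀ (zero_lt_iff.2 hne0)).2 hmem))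
  have hmono : ∀ {m n : ℕ}, m ≤ n → T * (1 ⊔ T) ^ m ≤ T * (1 ⊔ T) ^ n :=
    fun h => mul_le_mul' le_rfl (pow_le_pow_right₀ le_sup_left h)
  have hImem : ∀ a ∈ I, ∃ n : ℕ, (a : K) ∈ T * (1 ⊔ T) ^ n := by
    intro a ha
    induction ha using Submodule.span_induction with
    | mem x hx => exact ⟨0, by simpa using hx⟩
    | zero => exact ⟨0, by simp⟩
    | add x y _ _ hx hy =>
      obtain ⟨m, hm⟩ := hx
      obtain ⟨n, hn⟩ := hy
      exact ⟨max m n, add_mem (hmono (le_max_left _ _) hm) (hmono (le_max_right _ _) hn)⟩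
    | smul a x _ hx =>
      obtain ⟨m, hm⟩ := exists_mem_one_sup_pow_of_mem_adjoin T a.2
      obtain ⟨n, hn⟩ := hx
      refine ⟨m + n, ?_⟩
      rw [pow_add, mul_left_comm]
      exact Submodule.mul_mem_mul hm hn
  obtain ⟨n, hn⟩ := hImem 1 (by rw [hItop]; trivial)
  refine dominated_span_singleton_of_pow_mem hW hy0 (n := n) ?_
  set Y := Submodule.span k {y} with hYdef
  have hYT : Y * T = W := by
    rw [hT, hYdef, mul_left_comm, Submodule.span_mul_span, Set.singleton_mul_singleton,
      mul_inv_cancel₀ hy0, ← Submodule.one_eq_span, mul_one]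
  have hyn : y ^ (n + 1) ∈ Y ^ (n + 1) := Submodule.pow_mem_pow _
    (Submodule.mem_span_singleton_self y) _
  -- Multiplying `1 ∈ T (1 + T)^n` by `y^(n+1)` turns `T` into `W` and `1 + T` into `Y + W`: this is
  -- the equation of integral dependence.
  have := Submodule.mul_mem_mul hyn hn
  rw [OneMemClass.coe_one, mul_one, pow_succ', mul_mul_mul_comm, hYT, ← mul_pow,
    Submodule.mul_sup, mul_one, hYT] at this
  exact this

end Domination

/-! ### Upper and lower bounds for the dimension of `W₁^m W₂^n`. -/

section Growth

open Module

variable {k K : Type*} [Field k] [Field K] [Algebra k K]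

lemma finrank_le_finrank_of_le {M N : Submodule k K} (hN : N.FG) (h : M ≤ N) :
    finrank k M ≤ finrank k N := by
  have : Module.Finite k N := Module.Finite.iff_fg.2 hN
  exact Submodule.finrank_mono h

lemma finrank_mul_le {M N : Submodule k K} (hM : M.FG) (hN : N.FG) :
    finrank k ↥(M * N) ≤ finrank k M * finrank k N := by
  have : Module.Finite k M := Module.Finite.iff_fg.2 hM
  have : Module.Finite k N := Module.Finite.iff_fg.2 hN
  rw [← Submodule.mulMap_range, ← Module.finrank_tensorProduct]
  exact LinearMap.finrank_range_le _

/-- Multiplication by a nonzero element of `M` embeds `Y` into `P`. Inclusions such as those in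
`Dominated` become dimension bounds in this way. -/
lemma finrank_le_of_mul_le {Y M P : Submodule k K} (hP : P.FG) (hM : M ≠ ⊥) (h : Y * M ≤ P) :
    finrank k Y ≤ finrank k P := by
  obtain ⟨a, ha, ha0⟩ := M.ne_bot_iff.1 hM
  have hY : Y ≤ Submodule.span k {a⁻¹} * P := fun y hy => by
    rw [show y = a⁻¹ * (y * a) by field_simp]
    exact Submodule.mul_mem_mul (Submodule.mem_span_singleton_self _)
      (h (Submodule.mul_mem_mul hy ha))
  calc finrank k Y ≤ finrank k ↥(Submodule.span k {a⁻¹} * P) :=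
        finrank_le_finrank_of_le ((Submodule.fg_span_singleton _).mul hP) hY
    _ ≤ finrank k (Submodule.span k {a⁻¹}) * finrank k P :=
        finrank_mul_le (Submodule.fg_span_singleton _) hP
    _ = finrank k P := by rw [finrank_span_singleton (inv_ne_zero ha0), one_mul]

lemma finrank_one_sup_span_singleton_pow_le (t : K) (n : ℕ) :
    finrank k ↥((1 ⊔ Submodule.span k {t}) ^ n : Submodule k K) ≤ n + 1 := by
  have h : (1 ⊔ Submodule.span k {t} : Submodule k K) ^ n ≤
      Submodule.span k (Set.range fun i : Fin (n + 1) => t ^ (i : ℕ)) := by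
    induction n with
    | zero =>
      rw [pow_zero, Submodule.one_le]
      exact Submodule.subset_span ⟨0, by simp⟩
    | succ n ih =>
      rw [pow_succ]
      refine (mul_le_mul' ih le_rfl).trans ?_
      rw [Submodule.mul_sup, mul_one, Submodule.span_mul_span, sup_le_iff, Submodule.span_le,
        Submodule.span_le]
      constructor
      · rintro _ ⟨i, rfl⟩
        exact Submodule.subset_span ⟨i.castSucc, rfl⟩
      · rintro _ ⟨_, ⟨i, rfl⟩, _, rfl, rfl⟩
        exact Submodule.subset_span ⟨i.succ, by simp [pow_succ]⟩
  refine (finrank_le_finrank_of_le (Submodule.fg_span (Set.finite_range _)) h).trans ?_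
  exact (finrank_range_le_card _).trans (by simp)

lemma fg_finset_prod {ι : Type*} (s : Finset ι) (M : ι → Submodule k K) (h : ∀ i, (M i).FG) :
    (∏ i ∈ s, M i).FG := by
  classical
  induction s using Finset.induction_on with
  | empty => exact fg_one_submodule
  | insert i s hi ih => rw [Finset.prod_insert hi]; exact (h i).mul ih

lemma finrank_finset_prod_le {ι : Type*} (s : Finset ι) (M : ι → Submodule k K)
    (h : ∀ i, (M i).FG) : finrank k ↥(∏ i ∈ s, M i) ≤ ∏ i ∈ s, finrank k (M i) := by
  classical
  induction s using Finset.induction_on with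
  | empty =>
    rw [Finset.prod_empty, Finset.prod_empty, Submodule.one_eq_span]
    exact (finrank_span_singleton (one_ne_zero (α := K))).le
  | insert i s hi ih =>
    rw [Finset.prod_insert hi, Finset.prod_insert hi]
    exact (finrank_mul_le (h i) (fg_finset_prod s M h)).trans (Nat.mul_le_mul_left _ ih)

lemma fg_one_sup {M : Submodule k K} (h : M.FG) : (1 ⊔ M).FG := fg_one_submodule.sup h

lemma finrank_one_sup_span_range_pow_le {ι : Type*} [Fintype ι] (x : ι → K) (n : ℕ) :
    finrank k ↥((1 ⊔ Submodule.span k (Set.range x)) ^ n : Submodule k K) ≤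
      (n + 1) ^ Fintype.card ι := by
  have hfg : ∀ i, (1 ⊔ Submodule.span k {x i} : Submodule k K).FG := fun i =>
    fg_one_sup (Submodule.fg_span_singleton _)
  have h : (1 ⊔ Submodule.span k (Set.range x) : Submodule k K) ≤
      ∏ i, (1 ⊔ Submodule.span k {x i}) := by
    have h1 : ∀ s : Finset ι, (1 : Submodule k K) ≤ ∏ i ∈ s, (1 ⊔ Submodule.span k {x i}) :=
      fun s => Finset.one_le_prod' fun _ _ => le_sup_left
    refine sup_le (h1 _) (Submodule.span_le.2 ?_)
    rintro _ ⟨i, rfl⟩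
    classical
    rw [← Finset.mul_prod_erase _ _ (Finset.mem_univ i)]
    have hxi : x i ∈ 1 ⊔ Submodule.span k {x i} :=
      Submodule.mem_sup_right (Submodule.mem_span_singleton_self (x i))
    have := Submodule.mul_mem_mul hxi
      (Submodule.one_le.1 (h1 (Finset.univ.erase i)))
    rwa [mul_one] at this
  calc finrank k ↥((1 ⊔ Submodule.span k (Set.range x)) ^ n : Submodule k K)
      ≤ finrank k ↥(∏ i, (1 ⊔ Submodule.span k {x i}) ^ n : Submodule k K) := by
        refine finrank_le_finrank_of_le (fg_finset_prod _ _ fun i => (hfg i).pow n) ?_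
        rw [Finset.prod_pow]
        exact pow_le_pow_left' h n
    _ ≤ ∏ i, finrank k ↥((1 ⊔ Submodule.span k {x i}) ^ n : Submodule k K) :=
        finrank_finset_prod_le _ _ fun i => (hfg i).pow n
    _ ≤ ∏ _i : ι, (n + 1) :=
        Finset.prod_le_prod' fun i _ => finrank_one_sup_span_singleton_pow_le (x i) n
    _ = (n + 1) ^ Fintype.card ι := by simp

lemma one_sup_pow_mono (T : Submodule k K) {m n : ℕ} (h : m ≤ n) :
    (1 ⊔ T) ^ m ≤ (1 ⊔ T) ^ n :=
  pow_le_pow_right₀ le_sup_left h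

lemma Dominated.mono_right {Y W W' : Submodule k K} (h : Dominated Y W) (hW : W ≤ W') :
    Dominated Y W' := by
  obtain ⟨M, hM, hM0, hle⟩ := h
  exact ⟨M, hM, hM0, hle.trans (mul_le_mul' hW le_rfl)⟩

lemma Dominated.of_le {Y W : Submodule k K} (h : Y ≤ W) : Dominated Y W :=
  ⟨1, fg_one_submodule, one_ne_zero, mul_le_mul' h le_rfl⟩

/-- In an algebraic equation for `w` over `k[T]` of degree `d`, the leading coefficient serves as
`D` and the span of `1, w, …, w^(d-1)` as `M`: the equation rewrites `D w^d` in lower powers of `w`.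
The bound on `D` itself is kept because denominators of several elements have to be multiplied
together later. -/
lemma exists_dominated_of_isAlgebraic_singleton (T : Submodule k K) {w : K}
    (hw : IsAlgebraic (Algebra.adjoin k (T : Set K)) w) :
    ∃ D : K, D ≠ 0 ∧ ∃ n : ℕ, D ∈ (1 ⊔ T) ^ n ∧
      Dominated (Submodule.span k {D} * Submodule.span k {w}) ((1 ⊔ T) ^ n) := by
  obtain ⟨p, hp0, hp⟩ := hw
  have hcoef : ∀ i, ∃ n : ℕ, (p.coeff i : K) ∈ (1 ⊔ T) ^ n := fun i =>
    exists_mem_one_sup_pow_of_mem_adjoin T (p.coeff i).2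
  choose e he using hcoef
  set d := p.natDegree with hd
  set n := ∑ i ∈ Finset.range (d + 1), e i with hn
  have he' : ∀ i ≤ d, (p.coeff i : K) ∈ (1 ⊔ T) ^ n := fun i hi =>
    one_sup_pow_mono T (Finset.single_le_sum (fun _ _ => Nat.zero_le _)
      (Finset.mem_range.2 (by omega))) (he i)
  have hlead : (p.coeff d : K) ≠ 0 := by
    rw [Ne, ZeroMemClass.coe_eq_zero]; exact Polynomial.leadingCoeff_ne_zero.2 hp0
  rw [Polynomial.aeval_eq_sum_range, ← hd, Finset.sum_range_succ] at hp
  simp only [Algebra.smul_def] at hp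
  change ∑ i ∈ Finset.range d, (p.coeff i : K) * w ^ i + (p.coeff d : K) * w ^ d = 0 at hp
  have hd0 : d ≠ 0 := by
    intro h0
    rw [h0] at hp hlead
    simp at hp
    exact hlead (by simpa using hp)
  refine ⟨p.coeff d, hlead, n, he' d le_rfl,
    Submodule.span k (Set.range fun i : Fin d => w ^ (i : ℕ)),
    Submodule.fg_span (Set.finite_range _), ?_, ?_⟩
  · intro h0
    have : w ^ ((⟨0, Nat.pos_of_ne_zero hd0⟩ : Fin d) : ℕ) ∈
        Submodule.span k (Set.range fun i : Fin d => w ^ (i : ℕ)) := Submodule.subset_span ⟨_, rfl⟩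
    rw [h0] at this
    simp at this
  · rw [Submodule.span_mul_span, Set.singleton_mul_singleton, Submodule.span_mul_span,
      Submodule.span_le]
    rintro _ ⟨_, rfl, _, ⟨i, rfl⟩, rfl⟩
    have hmem : ∀ j < d, w ^ j ∈ Submodule.span k (Set.range fun i : Fin d => w ^ (i : ℕ)) :=
      fun j hj => Submodule.subset_span ⟨⟨j, hj⟩, rfl⟩
    simp only [mul_assoc, ← pow_succ', SetLike.mem_coe]
    rcases Nat.lt_or_ge ((i : ℕ) + 1) d with h | h
    · exact Submodule.mul_mem_mul (he' d le_rfl) (hmem _ h)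
    · rw [show (i : ℕ) + 1 = d by omega, eq_neg_of_add_eq_zero_right hp]
      exact neg_mem (sum_mem fun j hj => Submodule.mul_mem_mul
        (he' j (Finset.mem_range.1 hj).le) (hmem j (Finset.mem_range.1 hj)))

/-- If the elements of `W` are algebraic over `k[T]`, then a multiple of `W` is dominated by the
elements of bounded degree of `k[T]`. -/
lemma exists_dominated_of_isAlgebraic (T : Submodule k K) {W : Submodule k K} (hW : W.FG)
    (h : ∀ w ∈ W, IsAlgebraic (Algebra.adjoin k (T : Set K)) w) :
    ∃ D : K, D ≠ 0 ∧ ∃ n : ℕ, Dominated (Submodule.span k {D} * W) ((1 ⊔ T) ^ n) := by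
  obtain ⟨s, rfl⟩ := hW
  suffices ∃ D : K, D ≠ 0 ∧ ∃ n : ℕ, D ∈ (1 ⊔ T) ^ n ∧
      Dominated (Submodule.span k {D} * Submodule.span k (s : Set K)) ((1 ⊔ T) ^ n) by
    obtain ⟨D, hD, n, -, hn⟩ := this
    exact ⟨D, hD, n, hn⟩
  classical
  induction s using Finset.induction_on with
  | empty => exact ⟨1, one_ne_zero, 0, by simp, by simpa using Dominated.bot _⟩
  | insert w s hw ih =>
    obtain ⟨D, hD, n, hDn, hn⟩ := ih fun v hv => h v (Submodule.span_mono (by simp) hv)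
    obtain ⟨D', hD', n', hDn', hn'⟩ := exists_dominated_of_isAlgebraic_singleton T
      (h w (Submodule.subset_span (by simp)))
    refine ⟨D * D', mul_ne_zero hD hD', n + n', ?_, ?_⟩
    · rw [pow_add]; exact Submodule.mul_mem_mul hDn hDn'
    have hDD : Submodule.span k {D * D'} = Submodule.span k {D} * Submodule.span k {D'} := by
      rw [Submodule.span_mul_span, Set.singleton_mul_singleton]
    rw [Finset.coe_insert, Submodule.span_insert, Submodule.mul_sup, hDD, pow_add]
    refine Dominated.sup ?_ ?_
    · rw [mul_assoc]
      exact (Dominated.of_le (by rwa [Submodule.span_singleton_le_iff_mem])).mul hn'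
    · rw [mul_right_comm]
      exact hn.mul (Dominated.of_le (by rwa [Submodule.span_singleton_le_iff_mem]))

lemma isAlgebraic_adjoin_span_iff (s : Set K) (w : K) :
    IsAlgebraic (Algebra.adjoin k (Submodule.span k s : Set K)) w ↔
      IsAlgebraic (Algebra.adjoin k s) w := by
  rw [Algebra.adjoin_span]

/-- If `W₁` is algebraic over `k[x]` and `W₂` over `k[x, y]`, then `W₁ ^ m * W₂ ^ n` has dimension
`O(m ^ #x * n ^ #y)` in the range `n ≤ m`. -/
theorem exists_finrank_pow_mul_pow_le {ι κ : Type*} [Fintype ι] [Fintype κ]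
    {W₁ W₂ : Submodule k K} (hW₁ : W₁.FG) (hW₂ : W₂.FG) (x : ι → K) (y : κ → K)
    (h₁ : ∀ w ∈ W₁, IsAlgebraic (Algebra.adjoin k (Set.range x)) w)
    (h₂ : ∀ w ∈ W₂, IsAlgebraic (Algebra.adjoin k (Set.range x ∪ Set.range y)) w) :
    ∃ C : ℕ, ∀ m n : ℕ, 1 ≤ n → n ≤ m →
      finrank k ↥(W₁ ^ m * W₂ ^ n) ≤ C * (m ^ Fintype.card ι * n ^ Fintype.card κ) := by
  set P : Submodule k K := 1 ⊔ Submodule.span k (Set.range x) with hP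
  set Q : Submodule k K := 1 ⊔ Submodule.span k (Set.range y) with hQ
  have hPfg : P.FG := fg_one_sup (Submodule.fg_span (Set.finite_range _))
  have hQfg : Q.FG := fg_one_sup (Submodule.fg_span (Set.finite_range _))
  have hPQ : 1 ⊔ Submodule.span k (Set.range x ∪ Set.range y) ≤ P * Q := by
    rw [Submodule.span_union, hP, hQ, Submodule.sup_mul, Submodule.mul_sup, Submodule.mul_sup]
    simp only [mul_one, one_mul]
    exact sup_le (le_sup_left.trans le_sup_left)
      (sup_le (le_sup_left.trans le_sup_right) (le_sup_right.trans le_sup_left))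
  obtain ⟨D₁, hD₁, a, M₁, hM₁, hM₁0, hle₁⟩ :=
    exists_dominated_of_isAlgebraic (Submodule.span k (Set.range x)) hW₁
      fun w hw => (isAlgebraic_adjoin_span_iff _ w).2 (h₁ w hw)
  obtain ⟨D₂, hD₂, b, hdom⟩ :=
    exists_dominated_of_isAlgebraic (Submodule.span k (Set.range x ∪ Set.range y)) hW₂
      fun w hw => (isAlgebraic_adjoin_span_iff _ w).2 (h₂ w hw)
  obtain ⟨M₂, hM₂, hM₂0, hle₂⟩ := hdom.mono_right (pow_le_pow_left' hPQ b)
  rw [← hP] at hle₁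
  refine ⟨finrank k M₁ * finrank k M₂ * ((a + b + 1) ^ Fintype.card ι * (b + 1) ^ Fintype.card κ),
    fun m n hn hnm => ?_⟩
  -- The elements of `W₂` involve the `x` variables too, so `P` receives the exponent `a m + b n`.
  -- The restriction `n ≤ m` keeps this of order `m`.
  have key : (W₁ ^ m * W₂ ^ n) *
      (Submodule.span k {D₁} ^ m * Submodule.span k {D₂} ^ n * (M₁ * M₂)) ≤
      (P ^ (a * m + b * n) * Q ^ (b * n)) * (M₁ * M₂) := by
    have e₁ := pow_mul_le_pow_mul hle₁ m
    have e₂ := pow_mul_le_pow_mul hle₂ n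
    rw [mul_pow, ← pow_mul] at e₁ e₂
    rw [mul_pow P Q] at e₂
    calc _ = (Submodule.span k {D₁} ^ m * W₁ ^ m * M₁) *
          (Submodule.span k {D₂} ^ n * W₂ ^ n * M₂) := by ring
      _ ≤ (P ^ (a * m) * M₁) * (P ^ (b * n) * Q ^ (b * n) * M₂) := mul_le_mul' e₁ e₂
      _ = _ := by ring
  have hspan : ∀ {D : K}, D ≠ 0 → Submodule.span k {D} ≠ ⊥ := fun hD => by
    rwa [Ne, Submodule.span_singleton_eq_bot]
  have hfin := finrank_le_of_mul_le
    (((hPfg.pow (a * m + b * n)).mul (hQfg.pow (b * n))).mul (hM₁.mul hM₂))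
    (mul_ne_zero (mul_ne_zero (pow_ne_zero _ (hspan hD₁)) (pow_ne_zero _ (hspan hD₂)))
      (mul_ne_zero hM₁0 hM₂0)) key
  refine hfin.trans ?_
  calc _ ≤ (finrank k ↥(P ^ (a * m + b * n)) * finrank k ↥(Q ^ (b * n))) *
        (finrank k M₁ * finrank k M₂) :=
        (finrank_mul_le ((hPfg.pow _).mul (hQfg.pow _)) (hM₁.mul hM₂)).trans
          (Nat.mul_le_mul (finrank_mul_le (hPfg.pow _) (hQfg.pow _)) (finrank_mul_le hM₁ hM₂))
    _ ≤ ((a * m + b * n + 1) ^ Fintype.card ι * (b * n + 1) ^ Fintype.card κ) *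
        (finrank k M₁ * finrank k M₂) :=
        Nat.mul_le_mul_right _ (Nat.mul_le_mul (finrank_one_sup_span_range_pow_le x _)
          (finrank_one_sup_span_range_pow_le y _))
    _ ≤ (((a + b + 1) * m) ^ Fintype.card ι * ((b + 1) * n) ^ Fintype.card κ) *
        (finrank k M₁ * finrank k M₂) := by
        refine Nat.mul_le_mul_right _ (Nat.mul_le_mul (Nat.pow_le_pow_left ?_ _)
          (Nat.pow_le_pow_left ?_ _))
        · have := Nat.mul_le_mul_left b hnm
          linarith
        · linarith
    _ = _ := by rw [mul_pow, mul_pow]; ring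

lemma prod_pow_mem_pow {α : Type*} [Fintype α] {W : Submodule k K} {z : α → K} {n : ℕ}
    (h1 : 1 ≤ W) (hz : ∀ i, z i ∈ W) (e : α → Fin (n + 1)) :
    ∏ i, z i ^ (e i : ℕ) ∈ W ^ (Fintype.card α * n) := by
  classical
  have h : ∀ s : Finset α, ∏ i ∈ s, z i ^ (e i : ℕ) ∈ W ^ (s.card * n) := by
    intro s
    induction s using Finset.induction_on with
    | empty => simp
    | insert i s hi ih =>
      rw [Finset.prod_insert hi, Finset.card_insert_of_notMem hi, add_mul, one_mul, add_comm,
        pow_add]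
      exact Submodule.mul_mem_mul (pow_le_pow_right₀ h1 (Nat.lt_succ_iff.1 (e i).2)
        (Submodule.pow_mem_pow _ (hz i) _)) ih
  exact h Finset.univ

/-- Counting monomials in algebraically independent elements of `W₁` and `W₂`. -/
theorem le_finrank_pow_mul_pow {ι κ : Type*} [Fintype ι] [Fintype κ]
    {W₁ W₂ : Submodule k K} (hW₁ : W₁.FG) (hW₂ : W₂.FG) (h1W₁ : 1 ≤ W₁) (h1W₂ : 1 ≤ W₂)
    {x : ι → K} {y : κ → K} (hx : ∀ i, x i ∈ W₁) (hy : ∀ j, y j ∈ W₂)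
    (hxy : AlgebraicIndependent k (Sum.elim x y)) (m n : ℕ) :
    (m + 1) ^ Fintype.card ι * (n + 1) ^ Fintype.card κ ≤
      finrank k ↥(W₁ ^ (Fintype.card ι * m) * W₂ ^ (Fintype.card κ * n)) := by
  classical
  -- Each exponent is bounded separately, by `m` on the `x` side and by `n` on the `y` side. The
  -- total degrees are then at most `#ι * m` and `#κ * n`, whence the exponents of `W₁` and `W₂`.
  let E : (ι → Fin (m + 1)) × (κ → Fin (n + 1)) → (ι ⊕ κ →₀ ℕ) := fun e =>
    Finsupp.equivFunOnFinite.symm (Sum.elim (fun i => (e.1 i : ℕ)) (fun j => (e.2 j : ℕ)))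
  have hE : Function.Injective E := by
    intro e f h
    have h' := Finsupp.equivFunOnFinite.symm.injective h
    ext i
    · exact congrFun h' (Sum.inl i)
    · exact congrFun h' (Sum.inr i)
  have hli : LinearIndependent k fun e : (ι → Fin (m + 1)) × (κ → Fin (n + 1)) =>
      MvPolynomial.aeval (Sum.elim x y) (MvPolynomial.monomial (E e) (1 : k)) := by
    have h := (MvPolynomial.basisMonomials (ι ⊕ κ) k).linearIndependent.comp E hE
    have h2 := h.map' (MvPolynomial.aeval (Sum.elim x y)).toLinearMap
      (LinearMap.ker_eq_bot.2 hxy)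
    simpa [Function.comp_def] using h2
  have hval : ∀ e : (ι → Fin (m + 1)) × (κ → Fin (n + 1)), MvPolynomial.aeval (Sum.elim x y) (MvPolynomial.monomial (E e) (1 : k)) =
      (∏ i, x i ^ (e.1 i : ℕ)) * ∏ j, y j ^ (e.2 j : ℕ) := by
    intro e
    rw [MvPolynomial.aeval_monomial, map_one, one_mul, Finsupp.prod_fintype _ _ (by simp),
      Fintype.prod_sum_type]
    simp [E]
  simp only [hval] at hli
  have hsub : (Set.range fun e : (ι → Fin (m + 1)) × (κ → Fin (n + 1)) =>
      (∏ i, x i ^ (e.1 i : ℕ)) * ∏ j, y j ^ (e.2 j : ℕ)) ⊆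
      ↑(W₁ ^ (Fintype.card ι * m) * W₂ ^ (Fintype.card κ * n)) :=
    Set.range_subset_iff.2 fun e =>
      Submodule.mul_mem_mul (prod_pow_mem_pow h1W₁ hx e.1) (prod_pow_mem_pow h1W₂ hy e.2)
  have hle := finrank_le_finrank_of_le (k := k)
    ((hW₁.pow (Fintype.card ι * m)).mul (hW₂.pow (Fintype.card κ * n)))
    (Submodule.span_le.2 hsub)
  rw [finrank_span_eq_card hli] at hle
  simpa using hle

end Growth

/-! ### Effect of an endomorphism of the field on the dimensions of `W₁^m W₂^n`. -/

section Scaling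

open Module

variable {k K : Type*} [Field k] [Field K] [Algebra k K]

/-- Up to a common denominator, `N` lies in `U ^ g * M`. -/
def Absorbed (U M N : Submodule k K) : Prop :=
  ∃ D : K, D ≠ 0 ∧ ∃ g : ℕ, D ∈ U ^ g ∧ Submodule.span k {D} * N ≤ U ^ g * M

namespace Absorbed

variable {U M N N' : Submodule k K}

lemma mono (h : Absorbed U M N) (hN : N' ≤ N) : Absorbed U M N' := by
  obtain ⟨D, hD, g, hDg, hle⟩ := h
  exact ⟨D, hD, g, hDg, (mul_le_mul' le_rfl hN).trans hle⟩

lemma sup (h : Absorbed U M N) (h' : Absorbed U M N') : Absorbed U M (N ⊔ N') := by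
  obtain ⟨D, hD, g, hDg, hle⟩ := h
  obtain ⟨D', hD', g', hDg', hle'⟩ := h'
  have hDD : Submodule.span k {D * D'} = Submodule.span k {D} * Submodule.span k {D'} := by
    rw [Submodule.span_mul_span, Set.singleton_mul_singleton]
  rw [← Submodule.span_singleton_le_iff_mem] at hDg hDg'
  refine ⟨D * D', mul_ne_zero hD hD', g + g', ?_, ?_⟩
  · rw [← Submodule.span_singleton_le_iff_mem, hDD, pow_add]
    exact mul_le_mul' hDg hDg'
  · rw [Submodule.mul_sup, hDD, pow_add]
    refine sup_le ?_ ?_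
    · rw [mul_right_comm, mul_right_comm (U ^ g)]
      exact mul_le_mul' hle hDg'
    · rw [mul_assoc, mul_assoc]
      exact mul_le_mul' hDg hle'

lemma bot : Absorbed U M ⊥ := ⟨1, one_ne_zero, 0, by simp, by simp⟩

lemma finset_sup {ι : Type*} (s : Finset ι) (N : ι → Submodule k K)
    (h : ∀ i ∈ s, Absorbed U M (N i)) : Absorbed U M (s.sup N) := by
  classical
  induction s using Finset.induction_on with
  | empty => simpa using bot
  | insert i s hi ih =>
    rw [Finset.sup_insert]
    exact (h i (by simp)).sup (ih fun j hj => h j (by simp [hj]))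

lemma of_forall_mem (hN : N.FG) (h : ∀ v ∈ N, Absorbed U M (Submodule.span k {v})) :
    Absorbed U M N := by
  obtain ⟨s, rfl⟩ := hN
  refine (finset_sup s (fun v => Submodule.span k {v}) fun v hv =>
    h v (Submodule.subset_span hv)).mono ?_
  rw [Submodule.span_le]
  intro v hv
  exact Finset.le_sup (f := fun v => Submodule.span k {v}) hv (Submodule.mem_span_singleton_self v)

end Absorbed

/-- A finitely generated field `K` that is algebraic over `k(U)` is, up to denominators, exhausted
by the powers of `U`, multiplied by a fixed finite-dimensional subspace. -/
lemma exists_forall_absorbed [Algebra.EssFiniteType k K] {U : Submodule k K} (hU : 1 ≤ U)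
    (halg : Algebra.IsAlgebraic (Algebra.adjoin k (U : Set K)) K) :
    ∃ M : Submodule k K, M.FG ∧ ∀ N : Submodule k K, N.FG → Absorbed U M N := by
  -- `K` is finite over `k(U)`, and a basis spans the fixed subspace `M`. Coordinates are fractions
  -- of elements of `k[U]`, which is the union of the powers of `U` because `1 ∈ U`.
  set L := IntermediateField.adjoin k (U : Set K) with hL
  have hAL : Algebra.adjoin k (U : Set K) ≤ L.toSubalgebra :=
    IntermediateField.algebra_adjoin_le_adjoin k _
  have : Algebra.IsAlgebraic L K := by
    refine ⟨fun a => ?_⟩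
    obtain ⟨p, hp0, hp⟩ := halg.isAlgebraic a
    let i : Algebra.adjoin k (U : Set K) →+* L := (Subalgebra.inclusion hAL).toRingHom
    refine ⟨p.map i, ?_, ?_⟩
    · rwa [Ne, Polynomial.map_eq_zero_iff (Subalgebra.inclusion_injective hAL)]
    · rw [Polynomial.aeval_def, Polynomial.eval₂_map]; exact hp
  have : Algebra.EssFiniteType L K := .of_comp k L K
  have : Module.Finite L K := Algebra.finite_of_essFiniteType_of_isAlgebraic
  let b := Module.finBasis L K
  have hadj : ∀ a ∈ Algebra.adjoin k (U : Set K), ∃ n : ℕ, a ∈ U ^ n := fun a ha => by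
    have := exists_mem_one_sup_pow_of_mem_adjoin U ha
    rwa [sup_eq_right.2 hU] at this
  refine ⟨Submodule.span k (Set.range b), Submodule.fg_span (Set.finite_range _), fun N hN =>
    Absorbed.of_forall_mem hN fun v _ => ?_⟩
  refine (Absorbed.finset_sup Finset.univ
    (fun i => Submodule.span k {(b.repr v i : K) * b i}) fun i _ => ?_).mono ?_
  · obtain ⟨p, hp, D, hD, hpD⟩ := IntermediateField.mem_adjoin_iff_div.1 (b.repr v i).2
    by_cases hD0 : D = 0
    · rw [hpD, hD0]; simpa using Absorbed.bot
    obtain ⟨m, hm⟩ := hadj p hp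
    obtain ⟨n, hn⟩ := hadj D hD
    refine ⟨D, hD0, m + n, pow_le_pow_right₀ hU (by omega) hn, ?_⟩
    rw [Submodule.span_mul_span, Set.singleton_mul_singleton,
      Submodule.span_singleton_le_iff_mem, hpD, ← mul_assoc, mul_div_cancel₀ _ hD0]
    exact Submodule.mul_mem_mul (pow_le_pow_right₀ hU (by omega) hm)
      (Submodule.subset_span ⟨i, rfl⟩)
  · rw [Submodule.span_singleton_le_iff_mem]
    have hmem : ∑ i, b.repr v i • b i ∈
        Finset.univ.sup fun i => Submodule.span k {(b.repr v i : K) * b i} :=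
      Submodule.sum_mem _ fun i _ =>
        Finset.le_sup (f := fun i => Submodule.span k {(b.repr v i : K) * b i})
          (Finset.mem_univ i) (Submodule.mem_span_singleton_self _)
    rwa [b.sum_repr] at hmem

/-- A basis of `K` over `φ(K)` spans a subspace `E` whose products with the subspaces `φ(H)` have
the expected dimension and exhaust `K`. -/
lemma exists_fg_mul_map (φ : K →ₐ[k] K) [Module.Finite φ.fieldRange K] :
    ∃ E : Submodule k K, E.FG ∧ finrank k E ≤ finrank φ.fieldRange K ∧
      (∀ H : Submodule k K, H.FG →
        finrank φ.fieldRange K * finrank k H ≤ finrank k ↥(E * H.map φ.toLinearMap)) ∧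
      ∀ N : Submodule k K, N.FG → ∃ H : Submodule k K, H.FG ∧ N ≤ E * H.map φ.toLinearMap := by
  let e := Module.finBasis φ.fieldRange K
  have hE : (Submodule.span k (Set.range e)).FG := Submodule.fg_span (Set.finite_range _)
  refine ⟨Submodule.span k (Set.range e), hE, ?_, fun H hH => ?_, fun N hN => ?_⟩
  · exact (finrank_range_le_card _).trans (by simp)
  · have : Module.Finite k H := Module.Finite.iff_fg.2 hH
    let b := Module.finBasis k H
    have hb : LinearIndependent k fun i => (⟨φ (b i : K), ⟨_, rfl⟩⟩ : φ.fieldRange) := by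
      have h1 : LinearIndependent k fun i => φ (b i : K) :=
        (b.linearIndependent.map' H.subtype H.ker_subtype).map' φ.toLinearMap
          (LinearMap.ker_eq_bot.2 φ.toRingHom.injective)
      exact LinearIndependent.of_comp φ.fieldRange.val.toLinearMap h1
    have hli := linearIndependent_smul hb e.linearIndependent
    have hsub : Set.range (fun p : Fin (finrank k H) × Fin (finrank φ.fieldRange K) =>
        (⟨φ (b p.1 : K), ⟨_, rfl⟩⟩ : φ.fieldRange) • e p.2) ⊆
        ↑(Submodule.span k (Set.range e) * H.map φ.toLinearMap) := by
      rintro _ ⟨p, rfl⟩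
      rw [SetLike.mem_coe, mul_comm]
      exact Submodule.mul_mem_mul ⟨_, (b p.1).2, rfl⟩ (Submodule.subset_span ⟨p.2, rfl⟩)
    have hle := finrank_le_finrank_of_le (k := k) (hE.mul (hH.map _)) (Submodule.span_le.2 hsub)
    rw [finrank_span_eq_card hli] at hle
    simpa [mul_comm] using hle
  · obtain ⟨s, rfl⟩ := hN
    classical
    induction s using Finset.induction_on with
    | empty => exact ⟨⊥, Submodule.fg_bot, by simp⟩
    | insert v s hv ih =>
      obtain ⟨H, hH, hle⟩ := ih
      have hc : ∀ i, ∃ c : K, φ c = e.repr v i := fun i => (e.repr v i).2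
      choose c hc using hc
      refine ⟨Submodule.span k (Set.range c) ⊔ H,
        (Submodule.fg_span (Set.finite_range _)).sup hH, ?_⟩
      rw [Finset.coe_insert, Submodule.span_insert, Submodule.map_sup, Submodule.mul_sup]
      refine sup_le_sup ?_ hle
      rw [Submodule.span_singleton_le_iff_mem, ← e.sum_repr v]
      refine Submodule.sum_mem _ fun i _ => ?_
      have hmem : e i * (e.repr v i : K) ∈ Submodule.span k (Set.range e) *
          (Submodule.span k (Set.range c)).map φ.toLinearMap :=
        Submodule.mul_mem_mul (Submodule.subset_span ⟨i, rfl⟩)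
          ⟨c i, Submodule.subset_span ⟨i, rfl⟩, hc i⟩
      rw [mul_comm (e i)] at hmem
      exact hmem

/-- The endomorphism `φ` of the field `K` multiplies the degree of the sections in `W` by `q`, up to
domination. -/
def IsScaling (φ : K →ₐ[k] K) (W : Submodule k K) (q : ℕ) : Prop :=
  ∃ u : K, u ≠ 0 ∧ Dominated (Submodule.span k {u} * W.map φ.toLinearMap) (W ^ q) ∧
    Dominated (W ^ q) (Submodule.span k {u} * W.map φ.toLinearMap)

variable {W₁ W₂ : Submodule k K}

lemma span_singleton_ne_bot {a : K} (ha : a ≠ 0) : Submodule.span k {a} ≠ ⊥ := by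
  rwa [Ne, Submodule.span_singleton_eq_bot]

/-- The dimension of the space of sections of bidegree `(m, n)` grows at least by the factor
`[K : φ(K)]` when the bidegree is scaled by `(q₁, q₂)`. -/
lemma exists_finrank_mul_le (hW₁ : W₁.FG) (hW₂ : W₂.FG) {M₀ : Submodule k K} (hM₀ : M₀.FG)
    (habs : ∀ N : Submodule k K, N.FG → Absorbed (W₁ * W₂) M₀ N)
    (φ : K →ₐ[k] K) [Module.Finite φ.fieldRange K] {q₁ q₂ : ℕ}
    (h₁ : IsScaling φ W₁ q₁) (h₂ : IsScaling φ W₂ q₂) :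
    ∃ g : ℕ, ∀ m n : ℕ, finrank φ.fieldRange K * finrank k ↥(W₁ ^ m * W₂ ^ n) ≤
      finrank k M₀ * finrank k ↥(W₁ ^ (q₁ * m + g) * W₂ ^ (q₂ * n + g)) := by
  obtain ⟨u₁, hu₁, ⟨M₁, hM₁, hM₁0, hle₁⟩, -⟩ := h₁
  obtain ⟨u₂, hu₂, ⟨M₂, hM₂, hM₂0, hle₂⟩, -⟩ := h₂
  obtain ⟨E, hE, -, hlow, -⟩ := exists_fg_mul_map φ
  -- The auxiliary spaces do not depend on `m` and `n`, so one shift `g` absorbs them in all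
  -- bidegrees.
  obtain ⟨D, hD, g, -, hDle⟩ := habs (E * (M₁ * M₂)) (hE.mul (hM₁.mul hM₂))
  refine ⟨g, fun m n => (hlow _ ((hW₁.pow m).mul (hW₂.pow n))).trans ?_⟩
  have e₁ := pow_mul_le_pow_mul hle₁ m
  have e₂ := pow_mul_le_pow_mul hle₂ n
  rw [mul_pow, ← pow_mul] at e₁ e₂
  have key : (E * (W₁ ^ m * W₂ ^ n).map φ.toLinearMap) * (Submodule.span k {u₁} ^ m *
      Submodule.span k {u₂} ^ n * Submodule.span k {D} * (M₁ * M₂)) ≤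
      W₁ ^ (q₁ * m + g) * W₂ ^ (q₂ * n + g) * M₀ := by
    rw [Submodule.map_mul, Submodule.map_pow, Submodule.map_pow]
    calc _ = Submodule.span k {D} * E *
          ((Submodule.span k {u₁} ^ m * W₁.map φ.toLinearMap ^ m * M₁) *
          (Submodule.span k {u₂} ^ n * W₂.map φ.toLinearMap ^ n * M₂)) := by ring
      _ ≤ Submodule.span k {D} * E * ((W₁ ^ (q₁ * m) * M₁) * (W₂ ^ (q₂ * n) * M₂)) :=
        mul_le_mul' le_rfl (mul_le_mul' e₁ e₂)
      _ = (Submodule.span k {D} * (E * (M₁ * M₂))) * (W₁ ^ (q₁ * m) * W₂ ^ (q₂ * n)) := by ring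
      _ ≤ ((W₁ * W₂) ^ g * M₀) * (W₁ ^ (q₁ * m) * W₂ ^ (q₂ * n)) := mul_le_mul' hDle le_rfl
      _ = _ := by ring
  have hfg := (hW₁.pow (q₁ * m + g)).mul (hW₂.pow (q₂ * n + g))
  refine (finrank_le_of_mul_le (hfg.mul hM₀) ?_ key).trans ?_
  · exact mul_ne_zero (mul_ne_zero (mul_ne_zero (pow_ne_zero _ (span_singleton_ne_bot hu₁))
      (pow_ne_zero _ (span_singleton_ne_bot hu₂))) (span_singleton_ne_bot hD))
      (mul_ne_zero hM₁0 hM₂0)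
  · rw [mul_comm (finrank k M₀)]
    exact finrank_mul_le hfg hM₀

/-- The dimension of the space of sections of bidegree `(m, n)` grows at most by the factor
`[K : φ(K)]` when the bidegree is scaled by `(q₁, q₂)`. -/
lemma exists_finrank_le_mul (hW₁ : W₁.FG) (hW₂ : W₂.FG) {M₀ : Submodule k K} (hM₀ : M₀.FG)
    (habs : ∀ N : Submodule k K, N.FG → Absorbed (W₁ * W₂) M₀ N)
    (φ : K →ₐ[k] K) [Module.Finite φ.fieldRange K] {q₁ q₂ : ℕ}
    (h₁ : IsScaling φ W₁ q₁) (h₂ : IsScaling φ W₂ q₂) :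
    ∃ g : ℕ, ∀ m n : ℕ, finrank k ↥(W₁ ^ (q₁ * m) * W₂ ^ (q₂ * n)) ≤
      finrank φ.fieldRange K * (finrank k M₀ * finrank k ↥(W₁ ^ (m + g) * W₂ ^ (n + g))) := by
  obtain ⟨u₁, hu₁, -, M₁, hM₁, hM₁0, hle₁⟩ := h₁
  obtain ⟨u₂, hu₂, -, M₂, hM₂, hM₂0, hle₂⟩ := h₂
  obtain ⟨E, hE, hEcard, -, hup⟩ := exists_fg_mul_map φ
  -- Here the witnesses of domination are written over `φ(K)`, as part of `E φ(H)`. This lets `H` be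
  -- absorbed before `φ` is applied, with denominator `φ D` afterwards.
  obtain ⟨H, hH, hHle⟩ := hup (M₁ * M₂) (hM₁.mul hM₂)
  obtain ⟨D, hD, g, -, hDle⟩ := habs H hH
  refine ⟨g, fun m n => ?_⟩
  have e₁ := pow_mul_le_pow_mul hle₁ m
  have e₂ := pow_mul_le_pow_mul hle₂ n
  rw [mul_pow, ← pow_mul] at e₁ e₂
  have hφD : (Submodule.span k {D}).map φ.toLinearMap = Submodule.span k {φ D} := by
    rw [Submodule.map_span, Set.image_singleton]; rfl
  have hu : ∀ (u : K) (j : ℕ), Submodule.span k {u} ^ j = Submodule.span k {u ^ j} :=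
    fun u j => by rw [Submodule.span_pow, Set.singleton_pow]
  have key : (W₁ ^ (q₁ * m) * W₂ ^ (q₂ * n)) * (Submodule.span k {φ D} * (M₁ * M₂)) ≤
      Submodule.span k {u₁ ^ m * u₂ ^ n} *
        (E * (W₁ ^ (m + g) * W₂ ^ (n + g) * M₀).map φ.toLinearMap) := by
    calc _ = Submodule.span k {φ D} * ((W₁ ^ (q₁ * m) * M₁) * (W₂ ^ (q₂ * n) * M₂)) := by ring
      _ ≤ Submodule.span k {φ D} *
          ((Submodule.span k {u₁} ^ m * W₁.map φ.toLinearMap ^ m * M₁) *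
          (Submodule.span k {u₂} ^ n * W₂.map φ.toLinearMap ^ n * M₂)) :=
        mul_le_mul' le_rfl (mul_le_mul' e₁ e₂)
      _ = (Submodule.span k {u₁} ^ m * Submodule.span k {u₂} ^ n) * (Submodule.span k {φ D} *
          (W₁.map φ.toLinearMap ^ m * W₂.map φ.toLinearMap ^ n)) * (M₁ * M₂) := by ring
      _ ≤ (Submodule.span k {u₁} ^ m * Submodule.span k {u₂} ^ n) * (Submodule.span k {φ D} *
          (W₁.map φ.toLinearMap ^ m * W₂.map φ.toLinearMap ^ n)) * (E * H.map φ.toLinearMap) :=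
        mul_le_mul' le_rfl hHle
      _ = Submodule.span k {u₁ ^ m * u₂ ^ n} *
          (E * ((Submodule.span k {D} * H) * (W₁ ^ m * W₂ ^ n)).map φ.toLinearMap) := by
        rw [Submodule.map_mul, Submodule.map_mul, Submodule.map_mul, Submodule.map_pow,
          Submodule.map_pow, hφD, hu, hu, Submodule.span_mul_span, Set.singleton_mul_singleton]
        ring
      _ ≤ Submodule.span k {u₁ ^ m * u₂ ^ n} *
          (E * (((W₁ * W₂) ^ g * M₀) * (W₁ ^ m * W₂ ^ n)).map φ.toLinearMap) :=
        mul_le_mul' le_rfl (mul_le_mul' le_rfl (Submodule.map_mono (mul_le_mul' hDle le_rfl)))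
      _ = _ := by
        rw [show ((W₁ * W₂) ^ g * M₀) * (W₁ ^ m * W₂ ^ n) = W₁ ^ (m + g) * W₂ ^ (n + g) * M₀ by
          ring]
  have hφD0 : φ D ≠ 0 := (map_ne_zero φ).2 hD
  have hfg := (hW₁.pow (m + g)).mul (hW₂.pow (n + g))
  have hmap : (W₁ ^ (m + g) * W₂ ^ (n + g) * M₀).map φ.toLinearMap |>.FG := (hfg.mul hM₀).map _
  refine (finrank_le_of_mul_le ((Submodule.fg_span_singleton _).mul (hE.mul hmap))
    (mul_ne_zero (span_singleton_ne_bot hφD0) (mul_ne_zero hM₁0 hM₂0)) key).trans ?_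
  refine (finrank_mul_le (Submodule.fg_span_singleton _) (hE.mul hmap)).trans ?_
  rw [finrank_span_singleton (mul_ne_zero (pow_ne_zero _ hu₁) (pow_ne_zero _ hu₂)), one_mul]
  have : Module.Finite k ↥(W₁ ^ (m + g) * W₂ ^ (n + g) * M₀) :=
    Module.Finite.iff_fg.2 (hfg.mul hM₀)
  refine (finrank_mul_le hE hmap).trans (Nat.mul_le_mul hEcard ?_)
  rw [mul_comm (finrank k M₀)]
  exact (Submodule.finrank_map_le _ _).trans (finrank_mul_le hfg hM₀)

end Scaling

/-! ### Bounds for `[K : φ(K)]` in terms of the two scaling factors. -/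

section Degrees

open Module

variable {k K : Type*} [Field k] [Field K] [Algebra k K]

lemma isAlgebraic_of_adjoin_le {A B : Subalgebra k K} (h : A ≤ B)
    (hA : Algebra.IsAlgebraic A K) : Algebra.IsAlgebraic B K :=
  ⟨fun a => (hA.isAlgebraic a).tower_top_of_subalgebra_le h⟩

/-- An embedding carries a transcendence basis to an independent family of the same finite size,
hence to a transcendence basis again. So `K` is algebraic over `φ(K)`, and finite because it is
finitely generated. -/
lemma finite_fieldRange [Algebra.EssFiniteType k K] (φ : K →ₐ[k] K) :
    Module.Finite φ.fieldRange K := by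
  obtain ⟨s, hs⟩ := exists_isTranscendenceBasis k K
  have hfin : Algebra.trdeg k K < Cardinal.aleph0 := trdeg_lt_aleph0 k K
  have hind : AlgebraicIndependent k (φ ∘ ((↑) : s → K)) := hs.1.map' φ.toRingHom.injective
  have hb := hind.isTranscendenceBasis_of_trdeg_le hfin hs.cardinalMk_eq_trdeg.ge
  have hle : Algebra.adjoin k (Set.range (φ ∘ ((↑) : s → K))) ≤ φ.fieldRange.toSubalgebra := by
    refine Algebra.adjoin_le ?_
    rintro _ ⟨i, rfl⟩
    exact ⟨_, rfl⟩
  have : Algebra.IsAlgebraic φ.fieldRange K := isAlgebraic_of_adjoin_le hle hb.isAlgebraic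
  have : Algebra.EssFiniteType φ.fieldRange K := .of_comp k φ.fieldRange K
  exact Algebra.finite_of_essFiniteType_of_isAlgebraic

variable {W₁ W₂ : Submodule k K}

/-- The degree `[K : φ(K)]` of an endomorphism that scales `W₁` by `q₁` and `W₂` by `q₂`, bounded
from above. -/
lemma exists_finrank_fieldRange_le {ι κ : Type*} [Fintype ι] [Fintype κ]
    (hW₁ : W₁.FG) (hW₂ : W₂.FG) (h1W₁ : 1 ≤ W₁) (h1W₂ : 1 ≤ W₂)
    {M₀ : Submodule k K} (hM₀ : M₀.FG)
    (habs : ∀ N : Submodule k K, N.FG → Absorbed (W₁ * W₂) M₀ N)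
    {x : ι → K} {y : κ → K} (hx : ∀ i, x i ∈ W₁) (hy : ∀ j, y j ∈ W₂)
    (hxy : AlgebraicIndependent k (Sum.elim x y))
    (h₁ : ∀ w ∈ W₁, IsAlgebraic (Algebra.adjoin k (Set.range x)) w)
    (h₂ : ∀ w ∈ W₂, IsAlgebraic (Algebra.adjoin k (Set.range x ∪ Set.range y)) w) :
    ∃ C : ℕ, ∀ (φ : K →ₐ[k] K) [Module.Finite φ.fieldRange K] (q₁ q₂ : ℕ), 1 ≤ q₁ → 1 ≤ q₂ →
      IsScaling φ W₁ q₁ → IsScaling φ W₂ q₂ →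
      finrank φ.fieldRange K ≤ C * (q₁ ^ Fintype.card ι * q₂ ^ Fintype.card κ) := by
  obtain ⟨C, hC⟩ := exists_finrank_pow_mul_pow_le hW₁ hW₂ x y h₁ h₂
  set r := Fintype.card ι
  set s := Fintype.card κ
  set A := (r + 1) * (s + 1) with hA
  have hA1 : 1 ≤ A := Nat.mul_pos (Nat.succ_pos _) (Nat.succ_pos _)
  have hrA : r + 1 ≤ A := Nat.le_mul_of_pos_right _ (Nat.succ_pos _)
  have hsA : s + 1 ≤ A := Nat.le_mul_of_pos_left _ (Nat.succ_pos _)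
  refine ⟨finrank k M₀ * C * (2 * A) ^ (r + s), fun φ _ q₁ q₂ hq₁ hq₂ hφ₁ hφ₂ => ?_⟩
  obtain ⟨g, hg⟩ := exists_finrank_mul_le hW₁ hW₂ hM₀ habs φ hφ₁ hφ₂
  set δ := finrank φ.fieldRange K
  -- The shift `g` depends on `φ`. Testing in bidegrees proportional to `t > g` makes it harmless:
  -- the powers of `t` cancel at the end and the constant stays independent of `φ`.
  set t := g + 1 with ht
  have ht1 : 1 ≤ t := Nat.succ_pos _
  -- The factor `q₂` in the first degree ensures that the first degree is still the larger one after
  -- scaling by `(q₁, q₂)`, as the upper bound `hC` requires.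
  have hlow : (q₂ * t) ^ r * t ^ s ≤
      finrank k ↥(W₁ ^ (A * (q₂ * t)) * W₂ ^ ((s + 1) * t)) := by
    refine le_trans ?_ ((le_finrank_pow_mul_pow hW₁ hW₂ h1W₁ h1W₂ hx hy hxy (q₂ * t) t).trans
      (finrank_le_finrank_of_le ((hW₁.pow _).mul (hW₂.pow _)) (mul_le_mul'
        (pow_le_pow_right₀ h1W₁ (Nat.mul_le_mul_right _ (by omega)))
        (pow_le_pow_right₀ h1W₂ (Nat.mul_le_mul_right _ (Nat.le_succ s))))))
    exact Nat.mul_le_mul (Nat.pow_le_pow_left (Nat.le_succ _) _)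
      (Nat.pow_le_pow_left (Nat.le_succ _) _)
  have e₁ : q₁ * (A * (q₂ * t)) + g ≤ 2 * A * (q₁ * q₂ * t) := by
    have : g ≤ A * (q₁ * q₂ * t) :=
      calc g ≤ t := Nat.le_succ _
        _ ≤ A * (q₁ * q₂ * t) := by
          rw [← mul_assoc]
          exact Nat.le_mul_of_pos_left _ (Nat.mul_pos hA1 (Nat.mul_pos hq₁ hq₂))
    calc _ ≤ q₁ * (A * (q₂ * t)) + A * (q₁ * q₂ * t) := Nat.add_le_add_left this _
      _ = _ := by ring
  have e₂ : q₂ * ((s + 1) * t) + g ≤ 2 * A * (q₂ * t) := by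
    have h1 : g ≤ A * (q₂ * t) :=
      calc g ≤ t := Nat.le_succ _
        _ ≤ A * (q₂ * t) := by
          rw [← mul_assoc]
          exact Nat.le_mul_of_pos_left _ (Nat.mul_pos hA1 hq₂)
    have h2 : q₂ * ((s + 1) * t) ≤ A * (q₂ * t) := by
      rw [mul_left_comm]
      exact Nat.mul_le_mul_right _ hsA
    linarith
  have e₃ : q₂ * ((s + 1) * t) + g ≤ q₁ * (A * (q₂ * t)) + g := by
    refine Nat.add_le_add_right ?_ g
    calc q₂ * ((s + 1) * t) = (s + 1) * (q₂ * t) := by ring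
      _ ≤ A * (q₂ * t) := Nat.mul_le_mul_right _ hsA
      _ ≤ q₁ * (A * (q₂ * t)) := Nat.le_mul_of_pos_left _ hq₁
  have e₄ : 1 ≤ q₂ * ((s + 1) * t) + g :=
    (Nat.mul_pos hq₂ (Nat.mul_pos (Nat.succ_pos _) ht1)).trans_le (Nat.le_add_right _ _)
  have hpos : 0 < q₂ ^ r * t ^ (r + s) := by positivity
  refine Nat.le_of_mul_le_mul_right ?_ hpos
  calc δ * (q₂ ^ r * t ^ (r + s)) = δ * ((q₂ * t) ^ r * t ^ s) := by rw [mul_pow, pow_add]; ring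
    _ ≤ δ * finrank k ↥(W₁ ^ (A * (q₂ * t)) * W₂ ^ ((s + 1) * t)) := Nat.mul_le_mul_left _ hlow
    _ ≤ finrank k M₀ * (C * ((q₁ * (A * (q₂ * t)) + g) ^ r * (q₂ * ((s + 1) * t) + g) ^ s)) :=
      (hg _ _).trans (Nat.mul_le_mul_left _ (hC _ _ e₄ e₃))
    _ ≤ finrank k M₀ * (C * ((2 * A * (q₁ * q₂ * t)) ^ r * (2 * A * (q₂ * t)) ^ s)) :=
      Nat.mul_le_mul_left _ (Nat.mul_le_mul_left _ (Nat.mul_le_mul (Nat.pow_le_pow_left e₁ _)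
        (Nat.pow_le_pow_left e₂ _)))
    _ = _ := by simp only [mul_pow, pow_add]; ring

/-- The degree `[K : φ(K)]` of an endomorphism that scales `W₁` by `q₁` and `W₂` by `q₂`, bounded
from below. -/
lemma exists_le_finrank_fieldRange {ι κ ι' κ' : Type*} [Fintype ι] [Fintype κ]
    [Fintype ι'] [Fintype κ']
    (hW₁ : W₁.FG) (hW₂ : W₂.FG) (h1W₁ : 1 ≤ W₁) (h1W₂ : 1 ≤ W₂)
    {M₀ : Submodule k K} (hM₀ : M₀.FG)
    (habs : ∀ N : Submodule k K, N.FG → Absorbed (W₁ * W₂) M₀ N)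
    {x : ι → K} {y : κ → K}
    (h₁ : ∀ w ∈ W₁, IsAlgebraic (Algebra.adjoin k (Set.range x)) w)
    (h₂ : ∀ w ∈ W₂, IsAlgebraic (Algebra.adjoin k (Set.range x ∪ Set.range y)) w)
    {x' : ι' → K} {y' : κ' → K} (hx : ∀ i, x' i ∈ W₁) (hy : ∀ j, y' j ∈ W₂)
    (hxy : AlgebraicIndependent k (Sum.elim x' y'))
    (hcard : Fintype.card ι + Fintype.card κ = Fintype.card ι' + Fintype.card κ') :
    ∃ C : ℕ, ∀ (φ : K →ₐ[k] K) [Module.Finite φ.fieldRange K] (q₁ q₂ : ℕ),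
      IsScaling φ W₁ q₁ → IsScaling φ W₂ q₂ →
      q₁ ^ Fintype.card ι' * q₂ ^ Fintype.card κ' ≤ C * finrank φ.fieldRange K := by
  obtain ⟨C, hC⟩ := exists_finrank_pow_mul_pow_le hW₁ hW₂ x y h₁ h₂
  set r := Fintype.card ι
  set s := Fintype.card κ
  set r' := Fintype.card ι'
  set s' := Fintype.card κ'
  set A := r' + s' + 1 with hA
  refine ⟨finrank k M₀ * C * (2 * A) ^ (r + s), fun φ _ q₁ q₂ hφ₁ hφ₂ => ?_⟩
  obtain ⟨g, hg⟩ := exists_finrank_le_mul hW₁ hW₂ hM₀ habs φ hφ₁ hφ₂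
  set δ := finrank φ.fieldRange K
  -- Again `t` exceeds the shift, which depends on `φ`. The two degrees `A t` can be equal here,
  -- since the upper bound is applied before scaling.
  set t := g + 1 with ht
  have ht1 : 1 ≤ t := Nat.succ_pos _
  have hlow : (q₁ * t) ^ r' * (q₂ * t) ^ s' ≤
      finrank k ↥(W₁ ^ (q₁ * (A * t)) * W₂ ^ (q₂ * (A * t))) := by
    refine le_trans ?_ ((le_finrank_pow_mul_pow hW₁ hW₂ h1W₁ h1W₂ hx hy hxy (q₁ * t)
      (q₂ * t)).trans (finrank_le_finrank_of_le ((hW₁.pow _).mul (hW₂.pow _)) (mul_le_mul'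
        (pow_le_pow_right₀ h1W₁ ?_) (pow_le_pow_right₀ h1W₂ ?_))))
    · exact Nat.mul_le_mul (Nat.pow_le_pow_left (Nat.le_succ _) _)
        (Nat.pow_le_pow_left (Nat.le_succ _) _)
    · rw [mul_left_comm q₁]; exact Nat.mul_le_mul_right _ (by omega)
    · rw [mul_left_comm q₂]; exact Nat.mul_le_mul_right _ (by omega)
  have e₁ : A * t + g ≤ 2 * A * t := by
    have : t ≤ A * t := Nat.le_mul_of_pos_left _ (Nat.succ_pos _)
    have : g ≤ t := Nat.le_succ _
    linarith
  have e₂ : 1 ≤ A * t + g :=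
    (Nat.mul_pos (Nat.succ_pos _) ht1).trans_le (Nat.le_add_right _ _)
  have hpos : 0 < t ^ (r + s) := by positivity
  refine Nat.le_of_mul_le_mul_right ?_ hpos
  -- By `hcard` both sides have the same degree in `t`, so `t` drops out.
  calc q₁ ^ r' * q₂ ^ s' * t ^ (r + s) = (q₁ * t) ^ r' * (q₂ * t) ^ s' := by
        rw [hcard, mul_pow, mul_pow, pow_add]; ring
    _ ≤ finrank k ↥(W₁ ^ (q₁ * (A * t)) * W₂ ^ (q₂ * (A * t))) := hlow
    _ ≤ δ * (finrank k M₀ * (C * ((A * t + g) ^ r * (A * t + g) ^ s))) :=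
      (hg _ _).trans (Nat.mul_le_mul_left _ (Nat.mul_le_mul_left _ (hC _ _ e₂ le_rfl)))
    _ ≤ δ * (finrank k M₀ * (C * ((2 * A * t) ^ r * (2 * A * t) ^ s))) :=
      Nat.mul_le_mul_left _ (Nat.mul_le_mul_left _ (Nat.mul_le_mul_left _
        (Nat.mul_le_mul (Nat.pow_le_pow_left e₁ _) (Nat.pow_le_pow_left e₁ _))))
    _ = _ := by simp only [mul_pow, pow_add]; ring

/-- Exponential growth beats the constant. Applied to the degrees of the iterates, this removes the
uniform constants. -/
lemma le_of_forall_pow_le_mul_pow {a b C : ℕ} (hb : 1 ≤ b) (h : ∀ n : ℕ, a ^ n ≤ C * b ^ n) :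
    a ≤ b := by
  by_contra! hab
  have hb' : (0 : ℝ) < b := by exact_mod_cast hb
  have h1 : (1 : ℝ) < a / b := by rw [one_lt_div hb']; exact_mod_cast hab
  obtain ⟨n, hn⟩ := pow_unbounded_of_one_lt (C : ℝ) h1
  rw [div_pow, lt_div_iff₀ (pow_pos hb' n)] at hn
  exact absurd (h n) (not_le.2 (by exact_mod_cast hn))

lemma algebraicIndependent_sumElim_of_subset {s B : Set K} (hs : s ⊆ B)
    (hB : AlgebraicIndepOn k id B) :
    AlgebraicIndependent k (Sum.elim ((↑) : s → K) ((↑) : ↥(B \ s) → K)) := by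
  classical
  have := (algebraicIndependent_equiv' (Equiv.Set.sumDiffSubset hs)
    (f := fun b : B => (b : K)) (g := Sum.elim ((↑) : s → K) ((↑) : ↥(B \ s) → K)) ?_).2 hB
  · exact this
  · ext (i | i) <;> rfl

lemma algebraicIndependent_sumElim_swap {ι κ : Type*} {x : ι → K} {y : κ → K}
    (h : AlgebraicIndependent k (Sum.elim x y)) : AlgebraicIndependent k (Sum.elim y x) :=
  (algebraicIndependent_equiv' (Equiv.sumComm κ ι) (f := Sum.elim x y) (by ext (i | i) <;> rfl)).2 h

end Degrees

/-! ### Different scaling factors force algebraic independence. -/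

section Independence

open Module AlgebraicIndependent

variable {k K : Type*} [Field k] [Field K] [Algebra k K]

/-- Replacing `b' - b` factors `q₁` by the larger `q₂` strictly increases the product unless there
is nothing to replace. -/
lemma eq_of_pow_mul_pow_le {q₁ q₂ a b a' b' : ℕ} (hq₁ : 1 ≤ q₁) (hq : q₁ < q₂)
    (hsum : a + b = a' + b') (hb : b ≤ b') (h : q₁ ^ a' * q₂ ^ b' ≤ q₁ ^ a * q₂ ^ b) : b = b' := by
  by_contra hne
  obtain ⟨e, rfl⟩ := Nat.exists_eq_add_of_le hb
  obtain rfl : a = a' + e := by omega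
  have hpos : 0 < q₁ ^ a' * q₂ ^ b :=
    Nat.mul_pos (pow_pos hq₁ _) (pow_pos (hq₁.trans hq.le) _)
  have h' : q₁ ^ a' * q₂ ^ b * q₂ ^ e ≤ q₁ ^ a' * q₂ ^ b * q₁ ^ e := by
    rw [pow_add, pow_add] at h
    linarith
  exact absurd (Nat.le_of_mul_le_mul_left h' hpos) (not_le.2 (Nat.pow_lt_pow_left hq (by omega)))

lemma spanning_union_of_isBasis {s A B : Set K} (hs : (matroid k K).IsBasis s A)
    (halg : (matroid k K).Spanning (A ∪ B)) : (matroid k K).Spanning (s ∪ B) := by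
  rw [Matroid.spanning_iff_closure_eq] at halg ⊢
  rw [Matroid.closure_union_congr_left hs.closure_eq_closure, halg]

lemma isAlgebraic_of_spanning {s A : Set K} (h : (matroid k K).Spanning s) (hA : A = s) :
    Algebra.IsAlgebraic (Algebra.adjoin k A) K := by
  subst hA
  rwa [matroid_spanning_iff] at h

/-- Independence of two subspaces of a finitely generated field that are scaled by different
factors. -/
theorem exists_algebraicIndependent_sumElim_of_lt [Algebra.EssFiniteType k K]
    {W₁ W₂ : Submodule k K} (hW₁ : W₁.FG) (hW₂ : W₂.FG) (h1W₁ : 1 ≤ W₁) (h1W₂ : 1 ≤ W₂)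
    (halg : Algebra.IsAlgebraic (Algebra.adjoin k (W₁ ∪ W₂ : Set K)) K)
    {q₁ q₂ : ℕ} (hq₁ : 1 ≤ q₁) (hq : q₁ < q₂)
    (h : ∀ n : ℕ, ∃ φ : K →ₐ[k] K, IsScaling φ W₁ (q₁ ^ n) ∧ IsScaling φ W₂ (q₂ ^ n)) :
    ∃ s t : Set K, s.Finite ∧ t.Finite ∧
      (∀ w ∈ W₁, IsAlgebraic (Algebra.adjoin k s) w) ∧
      (∀ w ∈ W₂, IsAlgebraic (Algebra.adjoin k t) w) ∧
      AlgebraicIndependent k (Sum.elim ((↑) : s → K) ((↑) : t → K)) := by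
  have hspan : (matroid k K).Spanning (W₁ ∪ W₂ : Set K) := matroid_spanning_iff.2 halg
  obtain ⟨s, hs⟩ := (matroid k K).exists_isBasis (W₁ : Set K)
  obtain ⟨t, ht⟩ := (matroid k K).exists_isBasis (W₂ : Set K)
  have hsW₂ := spanning_union_of_isBasis hs hspan
  have htW₁ := spanning_union_of_isBasis ht (Set.union_comm (W₁ : Set K) W₂ ▸ hspan)
  -- Two transcendence bases of `K` are compared: `B` extends a basis `s` of `W₁` by elements of
  -- `W₂`, and `B'` extends a basis `t` of `W₂` by elements of `W₁`.
  obtain ⟨B, hB, hsB, hBs⟩ := hs.indep.exists_isBase_subset_spanning hsW₂ Set.subset_union_left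
  obtain ⟨B', hB', htB', hBt'⟩ := ht.indep.exists_isBase_subset_spanning htW₁ Set.subset_union_left
  have hfin : Algebra.trdeg k K < Cardinal.aleph0 := trdeg_lt_aleph0 k K
  have hBtr := (matroid_isBase_iff.1 hB).cardinalMk_eq_trdeg
  have hBfin : B.Finite := Cardinal.lt_aleph0_iff_set_finite.1 (hBtr ▸ hfin)
  have hBtr' := (matroid_isBase_iff.1 hB').cardinalMk_eq_trdeg
  have hBfin' : B'.Finite := Cardinal.lt_aleph0_iff_set_finite.1 (hBtr' ▸ hfin)
  have hsfin := hBfin.subset hsB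
  have htfin := hBfin'.subset htB'
  have := hsfin.fintype
  have := htfin.fintype
  have := (hBfin.subset (Set.sdiff_subset (t := s))).fintype
  have := (hBfin'.subset (Set.sdiff_subset (t := t))).fintype
  obtain ⟨hsi, hsW, hsalg⟩ := matroid_isBasis_iff.1 hs
  obtain ⟨hti, htW, htalg⟩ := matroid_isBasis_iff.1 ht
  refine ⟨s, t, hsfin, htfin, hsalg, htalg, ?_⟩
  have hy : ∀ j : ↥(B \ s), (j : K) ∈ W₂ := fun j => (hBs j.2.1).resolve_left j.2.2
  have hx' : ∀ j : ↥(B' \ t), (j : K) ∈ W₁ := fun j => (hBt' j.2.1).resolve_left j.2.2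
  have hBB' : B.encard = B'.encard := by
    rw [hB.encard_eq_eRank, hB'.encard_eq_eRank]
  have hcard : Fintype.card s + Fintype.card ↥(B \ s) =
      Fintype.card ↥(B' \ t) + Fintype.card t := by
    have h1 := Set.ncard_sdiff_add_ncard_of_subset hsB hBfin
    have h2 := Set.ncard_sdiff_add_ncard_of_subset htB' hBfin'
    have h3 : B.ncard = B'.ncard := by rw [Set.ncard, Set.ncard, hBB']
    simp only [← Nat.card_eq_fintype_card, Nat.card_coe_set_eq]
    omega
  -- `B \ s` is independent and lies in `W₂`, whose rank is the size of `t`.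
  have hle : Fintype.card ↥(B \ s) ≤ Fintype.card t := by
    have h1 : (B \ s).encard ≤ t.encard := by
      rw [ht.encard_eq_eRk]
      exact (hB.indep.subset Set.sdiff_subset).encard_le_eRk_of_subset fun j hj => hy ⟨j, hj⟩
    rw [← Set.coe_fintypeCard, ← Set.coe_fintypeCard] at h1
    exact_mod_cast h1
  obtain ⟨M₀, hM₀, habs⟩ := exists_forall_absorbed (k := k) (K := K) (U := W₁ * W₂)
    (one_le_mul h1W₁ h1W₂) <| isAlgebraic_of_adjoin_le (Algebra.adjoin_mono (Set.union_subset
      (fun w hw => by simpa using Submodule.mul_mem_mul hw (Submodule.one_le.1 h1W₂))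
      (fun w hw => by simpa using Submodule.mul_mem_mul (Submodule.one_le.1 h1W₁) hw))) halg
  have h₁ : ∀ w ∈ W₁, IsAlgebraic (Algebra.adjoin k (Set.range ((↑) : s → K))) w := by
    rw [Subtype.range_coe]; exact hsalg
  have h₂ : ∀ w ∈ W₂, IsAlgebraic (Algebra.adjoin k
      (Set.range ((↑) : s → K) ∪ Set.range ((↑) : ↥(B \ s) → K))) w := by
    intro w _
    rw [Subtype.range_coe, Subtype.range_coe, Set.union_sdiff_cancel hsB]
    exact (isAlgebraic_of_spanning hB.spanning rfl).isAlgebraic w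
  -- The upper bound is taken along `B` and the lower bound along `B'`. Their exponents differ
  -- exactly by the defect of independence.
  obtain ⟨C, hC⟩ := exists_finrank_fieldRange_le hW₁ hW₂ h1W₁ h1W₂ hM₀ habs
    (fun i : s => hsW i.2) hy (algebraicIndependent_sumElim_of_subset hsB hB.indep) h₁ h₂
  obtain ⟨C', hC'⟩ := exists_le_finrank_fieldRange hW₁ hW₂ h1W₁ h1W₂ hM₀ habs h₁ h₂ hx'
    (fun i : t => htW i.2) (algebraicIndependent_sumElim_swap
      (algebraicIndependent_sumElim_of_subset htB' hB'.indep)) hcard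
  have hq₂ : 1 ≤ q₂ := hq₁.trans hq.le
  have hpow : q₁ ^ Fintype.card ↥(B' \ t) * q₂ ^ Fintype.card t ≤
      q₁ ^ Fintype.card s * q₂ ^ Fintype.card ↥(B \ s) := by
    refine le_of_forall_pow_le_mul_pow (C := C' * C)
      (Nat.mul_pos (pow_pos hq₁ _) (pow_pos hq₂ _)) fun n => ?_
    obtain ⟨φ, hφ₁, hφ₂⟩ := h n
    have := finite_fieldRange φ
    have e₁ := hC φ _ _ (Nat.one_le_pow _ _ hq₁) (Nat.one_le_pow _ _ hq₂) hφ₁ hφ₂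
    have e₂ := hC' φ _ _ hφ₁ hφ₂
    rw [mul_pow, mul_pow, pow_right_comm q₁, pow_right_comm q₂, pow_right_comm q₁ _ n,
      pow_right_comm q₂ _ n, mul_assoc]
    exact e₂.trans (Nat.mul_le_mul_left _ e₁)
  have hcardeq := eq_of_pow_mul_pow_le hq₁ hq hcard hle hpow
  have hspan' : (matroid k K).Spanning (s ∪ t) := by
    rw [Set.union_comm]
    refine spanning_union_of_isBasis ht ?_
    rw [Set.union_comm]
    exact hsW₂
  have := isAlgebraic_of_spanning hspan'
    (A := Set.range (Sum.elim ((↑) : s → K) ((↑) : t → K))) (by simp)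
  -- The family indexed by `s ⊕ t` generates `K` up to algebraic extension and has no more than
  -- `trdeg` members, so it is a transcendence basis. In particular `s` and `t` are disjoint.
  refine (Algebra.IsAlgebraic.isTranscendenceBasis_of_le_trdeg_of_finite k _ ?_).1
  classical
  rw [← hBtr, ← Cardinal.mk_congr (Equiv.Set.sumDiffSubset hsB), Cardinal.mk_fintype,
    Cardinal.mk_fintype, Fintype.card_sum, Fintype.card_sum, hcardeq]

theorem exists_algebraicIndependent_sumElim [Algebra.EssFiniteType k K]
    {W₁ W₂ : Submodule k K} (hW₁ : W₁.FG) (hW₂ : W₂.FG) (h1W₁ : 1 ≤ W₁) (h1W₂ : 1 ≤ W₂)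
    (halg : Algebra.IsAlgebraic (Algebra.adjoin k (W₁ ∪ W₂ : Set K)) K)
    {q₁ q₂ : ℕ} (hq₁ : 1 ≤ q₁) (hq₂ : 1 ≤ q₂) (hq : q₁ ≠ q₂)
    (h : ∀ n : ℕ, ∃ φ : K →ₐ[k] K, IsScaling φ W₁ (q₁ ^ n) ∧ IsScaling φ W₂ (q₂ ^ n)) :
    ∃ s t : Set K, s.Finite ∧ t.Finite ∧
      (∀ w ∈ W₁, IsAlgebraic (Algebra.adjoin k s) w) ∧
      (∀ w ∈ W₂, IsAlgebraic (Algebra.adjoin k t) w) ∧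
      AlgebraicIndependent k (Sum.elim ((↑) : s → K) ((↑) : t → K)) := by
  rcases lt_or_gt_of_ne hq with hlt | hlt
  · exact exists_algebraicIndependent_sumElim_of_lt hW₁ hW₂ h1W₁ h1W₂ halg hq₁ hlt h
  · rw [Set.union_comm] at halg
    obtain ⟨t, s, ht, hs, hta, hsa, hind⟩ :=
      exists_algebraicIndependent_sumElim_of_lt hW₂ hW₁ h1W₂ h1W₁ halg hq₂ hlt fun n =>
        (h n).imp fun φ hφ => hφ.symm
    exact ⟨s, t, hs, ht, hsa, hta, algebraicIndependent_sumElim_swap hind⟩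

end Independence

/-! ### Specialization at `k`-points and tensor products of domains. -/

section Specialization

open scoped TensorProduct

variable {k : Type*} [Field k]

/-- A homomorphism from a domain `D` that preserves the algebraic independence of a transcendence
generating family is injective. -/
lemma injective_of_algebraicIndependent_comp {D E ι : Type*} [CommRing D] [IsDomain D] [CommRing E]
    [Algebra k D] [Algebra k E] (ψ : D →ₐ[k] E) (z : ι → D)
    (halg : Algebra.IsAlgebraic (Algebra.adjoin k (Set.range z)) D)
    (hz : AlgebraicIndependent k (ψ ∘ z)) : Function.Injective ψ := by
  rw [injective_iff_map_eq_zero]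
  intro a ha
  by_contra ha0
  -- A nonzero element of the kernel divides a nonzero polynomial in the `z i`; applying `ψ` would
  -- give a relation between the `ψ (z i)`.
  obtain ⟨r, hr0, c, hc⟩ :=
    (halg.isAlgebraic a).exists_nonzero_dvd (mem_nonZeroDivisors_of_ne_zero ha0)
  obtain ⟨P, hP⟩ : (r : D) ∈ (MvPolynomial.aeval (R := k) z).range := by
    rw [← Algebra.adjoin_range_eq_range_aeval]; exact r.2
  have h0 : MvPolynomial.aeval (ψ ∘ z) P = 0 := by
    have h1 : ψ (MvPolynomial.aeval z P) = MvPolynomial.aeval (ψ ∘ z) P := by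
      rw [MvPolynomial.comp_aeval_apply]; rfl
    rw [← h1]
    change ψ (MvPolynomial.aeval z P) = 0
    rw [show MvPolynomial.aeval z P = (r : D) from hP]
    change (r : D) = _ at hc
    rw [hc, map_mul, ha, zero_mul]
  have hP0 : P = 0 := hz (by rw [h0, map_zero])
  apply hr0
  ext
  rw [← hP, hP0]
  simp

/-- Nullstellensatz: in a Jacobson domain some maximal ideal misses `a`, and its residue field is
finite over the algebraically closed field `k`, hence equal to it. -/
lemma exists_algHom_ne_zero [IsAlgClosed k] {A : Type*} [CommRing A] [IsDomain A] [Algebra k A]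
    [Algebra.FiniteType k A] {a : A} (ha : a ≠ 0) : ∃ ε : A →ₐ[k] k, ε a ≠ 0 := by
  have : IsJacobsonRing A := isJacobsonRing_of_finiteType (A := k)
  have hjac : (⊥ : Ideal A).jacobson = ⊥ :=
    IsJacobsonRing.out ‹_› (Ideal.isPrime_bot.isRadical)
  have : a ∉ (⊥ : Ideal A).jacobson := by rw [hjac]; simpa using ha
  simp only [Ideal.jacobson, Ideal.mem_sInf, not_forall] at this
  obtain ⟨m, ⟨-, hm⟩, ham⟩ := this
  let : Field (A ⧸ m) := Ideal.Quotient.field m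
  have : Algebra.FiniteType k (A ⧸ m) := .of_surjective (Ideal.Quotient.mkₐ k m)
    (Ideal.Quotient.mkₐ_surjective k m)
  have : Module.Finite k (A ⧸ m) := finite_of_finite_type_of_isJacobsonRing k (A ⧸ m)
  let e : k ≃ₐ[k] A ⧸ m := AlgEquiv.ofBijective (Algebra.ofId k _)
    IsAlgClosed.algebraMap_bijective_of_isIntegral
  refine ⟨e.symm.toAlgHom.comp (Ideal.Quotient.mkₐ k m), fun h => ham ?_⟩
  have h' : e.symm (Ideal.Quotient.mkₐ k m a) = 0 := h
  rw [map_eq_zero_iff _ e.symm.injective] at h'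
  exact Ideal.Quotient.eq_zero_iff_mem.1 h'

/-- The tensor product of two domains over an algebraically closed field is a domain. -/
lemma isDomain_tensorProduct [IsAlgClosed k] (A B : Type*) [CommRing A] [IsDomain A] [CommRing B]
    [IsDomain B] [Algebra k A] [Algebra k B] [Algebra.FiniteType k A] : IsDomain (A ⊗[k] B) := by
  let b := Module.Basis.ofVectorSpace k B
  let β := Algebra.TensorProduct.basis A b
  let ev : (A →ₐ[k] k) → (A ⊗[k] B →ₐ[k] B) := fun ε =>
    Algebra.TensorProduct.lift ((Algebra.ofId k B).comp ε) (AlgHom.id k B) fun _ _ => .all _ _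
  have hev : ∀ ε x i, b.repr (ev ε x) i = ε (β.repr x i) := by
    intro ε x i
    induction x using TensorProduct.induction_on with
    | zero => simp
    | tmul a c =>
      have h : ev ε (a ⊗ₜ[k] c) = ε a • c := by
        simp [ev, Algebra.ofId_apply, Algebra.smul_def]
      rw [h]
      simp [β]
    | add x y hx hy => simp [hx, hy]
  have : NoZeroDivisors (A ⊗[k] B) := by
    refine ⟨fun {x y} hxy => ?_⟩
    by_contra! hne
    obtain ⟨i, hi⟩ : ∃ i, β.repr x i ≠ 0 := by
      by_contra! h
      exact hne.1 (β.repr.injective (by ext i; simp [h]))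
    obtain ⟨j, hj⟩ : ∃ j, β.repr y j ≠ 0 := by
      by_contra! h
      exact hne.2 (β.repr.injective (by ext i; simp [h]))
    -- A `k`-point of `A` where one coefficient of `x` and one of `y` stay nonzero sends `x` and `y`
    -- to nonzero elements of the domain `B` with product zero.
    obtain ⟨ε, hε⟩ := exists_algHom_ne_zero (k := k) (mul_ne_zero hi hj)
    rw [map_mul, ← hev, ← hev] at hε
    have h0 : ev ε x * ev ε y = 0 := by rw [← map_mul, hxy, map_zero]
    rcases mul_eq_zero.1 h0 with h | h <;> simp [h] at hε
  have : Nontrivial (A ⊗[k] B) := by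
    have hne : Nonempty (Module.Basis.ofVectorSpaceIndex k B) := b.index_nonempty
    exact (β.repr.toEquiv).nontrivial
  exact NoZeroDivisors.to_isDomain _

end Specialization

/-! ### Values of functions at points with coefficients in a ring. -/

section Evaluation

variable {X Y : Scheme.{u}} {R S : Type u} [CommRing R] [CommRing S]

/-- The value in `R` of a function on the open `U` at an `R`-point of `U`. -/
def ev (p : Spec (.of R) ⟶ X) (U : X.Opens) (hU : ⊤ ≤ p ⁻¹ᵁ U) : Γ(X, U) →+* R :=
  (p.appLE U ⊤ hU ≫ (Scheme.ΓSpecIso (.of R)).hom).hom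

lemma ev_res (p : Spec (.of R) ⟶ X) {U V : X.Opens} (h : U ≤ V) (hU : ⊤ ≤ p ⁻¹ᵁ U)
    (hV : ⊤ ≤ p ⁻¹ᵁ V) (a : Γ(X, V)) : ev p U hU (res h a) = ev p V hV a := by
  have : X.presheaf.map (homOfLE h).op ≫ p.appLE U ⊤ hU = p.appLE V ⊤ hV := by
    rw [Scheme.Hom.map_appLE]
  exact congrArg (fun φ => (Scheme.ΓSpecIso (.of R)).hom.hom (φ.hom a)) this

lemma ev_comp (p : Spec (.of R) ⟶ X) (f : X ⟶ Y) {p' : Spec (.of R) ⟶ Y} (hp : p ≫ f = p')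
    (U : Y.Opens) (hU : ⊤ ≤ p' ⁻¹ᵁ U) (hU' : ⊤ ≤ p ⁻¹ᵁ f ⁻¹ᵁ U) (a : Γ(Y, U)) :
    ev p (f ⁻¹ᵁ U) hU' ((f.app U).hom a) = ev p' U hU a := by
  subst hp
  have : f.app U ≫ p.appLE (f ⁻¹ᵁ U) ⊤ hU' = (p ≫ f).appLE U ⊤ hU := by
    rw [Scheme.Hom.app_eq_appLE, Scheme.Hom.appLE_comp_appLE]
  exact congrArg (fun φ => (Scheme.ΓSpecIso (.of R)).hom.hom (φ.hom a)) this

lemma ev_specMap (φ : R →+* S) (p : Spec (.of R) ⟶ X) {p' : Spec (.of S) ⟶ X}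
    (hp : Spec.map (CommRingCat.ofHom φ) ≫ p = p') (U : X.Opens) (hU : ⊤ ≤ p ⁻¹ᵁ U)
    (hU' : ⊤ ≤ p' ⁻¹ᵁ U) (a : Γ(X, U)) : ev p' U hU' a = φ (ev p U hU a) := by
  subst hp
  have : (Spec.map (CommRingCat.ofHom φ) ≫ p).appLE U ⊤ hU' ≫ (Scheme.ΓSpecIso (.of S)).hom =
      (p.appLE U ⊤ hU ≫ (Scheme.ΓSpecIso (.of R)).hom) ≫ CommRingCat.ofHom φ := by
    have h1 : p.appLE U ⊤ hU ≫ (Spec.map (CommRingCat.ofHom φ)).appLE ⊤ ⊤ le_rfl =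
        (Spec.map (CommRingCat.ofHom φ) ≫ p).appLE U ⊤ hU' := Scheme.Hom.appLE_comp_appLE ..
    have h2 : (Spec.map (CommRingCat.ofHom φ)).appTop =
        (Spec.map (CommRingCat.ofHom φ)).appLE ⊤ ⊤ le_rfl := Scheme.Hom.app_eq_appLE _
    rw [Category.assoc, ← Scheme.ΓSpecIso_naturality, ← h1, ← h2, Category.assoc]
  exact congrArg (fun φ => φ.hom a) this

lemma top_le_preimage_basicOpen_iff (p : Spec (.of R) ⟶ X) (U : X.Opens) (hU : ⊤ ≤ p ⁻¹ᵁ U)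
    (a : Γ(X, U)) : ⊤ ≤ p ⁻¹ᵁ X.basicOpen a ↔ IsUnit (ev p U hU a) := by
  constructor
  · intro h
    rw [← ev_res p (X.basicOpen_le a) h hU]
    exact (RingedSpace.isUnit_res_basicOpen X.toRingedSpace a).map (ev p (X.basicOpen a) h)
  · intro h
    have h1 : IsUnit (p.appLE U ⊤ hU a) := by
      have h2 := h.map (Scheme.ΓSpecIso (.of R)).inv.hom
      change IsUnit (((Scheme.ΓSpecIso (.of R)).hom ≫ (Scheme.ΓSpecIso (.of R)).inv).hom
        (p.appLE U ⊤ hU a)) at h2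
      rwa [Iso.hom_inv_id] at h2
    have h3 := Scheme.basicOpen_of_isUnit _ h1
    rw [Scheme.basicOpen_appLE] at h3
    exact h3.ge.trans inf_le_right

/-- In the spectrum of a local ring every point specializes to the closed point, so an open set that
contains the closed point is everything. -/
lemma top_le_preimage_iff [IsLocalRing R] (p : Spec (.of R) ⟶ X) (U : X.Opens) :
    ⊤ ≤ p ⁻¹ᵁ U ↔ p (IsLocalRing.closedPoint R) ∈ U := by
  rw [top_le_iff]
  exact (IsLocalRing.closedPoint_mem_iff (p ⁻¹ᵁ U)).symm

lemma exists_top_le_preimage [IsLocalRing R] (p : Spec (.of R) ⟶ X) {ι : Type*} (U : ι → X.Opens)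
    (h : ⊤ ≤ p ⁻¹ᵁ ⨆ i, U i) : ∃ i, ⊤ ≤ p ⁻¹ᵁ U i := by
  rw [top_le_preimage_iff, TopologicalSpace.Opens.mem_iSup] at h
  exact h.imp fun i hi => (top_le_preimage_iff p _).2 hi

lemma top_le_preimage_comp (p : Spec (.of R) ⟶ X) (f : X ⟶ Y) {p' : Spec (.of R) ⟶ Y}
    (hp : p ≫ f = p') (U : Y.Opens) : ⊤ ≤ p ⁻¹ᵁ f ⁻¹ᵁ U ↔ ⊤ ≤ p' ⁻¹ᵁ U := by
  subst hp; rfl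

lemma top_le_preimage_specMap (φ : R →+* S) (p : Spec (.of R) ⟶ X) {p' : Spec (.of S) ⟶ X}
    (hp : Spec.map (CommRingCat.ofHom φ) ≫ p = p') {U : X.Opens} (hU : ⊤ ≤ p ⁻¹ᵁ U) :
    ⊤ ≤ p' ⁻¹ᵁ U := by
  subst hp
  exact fun x _ => hU (Set.mem_univ _)

lemma top_le_preimage_inf {p : Spec (.of R) ⟶ X} {U V : X.Opens} (hU : ⊤ ≤ p ⁻¹ᵁ U)
    (hV : ⊤ ≤ p ⁻¹ᵁ V) : ⊤ ≤ p ⁻¹ᵁ (U ⊓ V) := fun _ hx => ⟨hU hx, hV hx⟩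

lemma top_le_preimage_mono {p : Spec (.of R) ⟶ X} {U V : X.Opens} (h : U ≤ V)
    (hU : ⊤ ≤ p ⁻¹ᵁ U) : ⊤ ≤ p ⁻¹ᵁ V := fun _ hx => h (hU hx)

/-- A point of an affine open is recovered from the values of functions. -/
lemma specMap_ev_fromSpec (p : Spec (.of R) ⟶ X) {U : X.Opens} (hU : IsAffineOpen U)
    (h : ⊤ ≤ p ⁻¹ᵁ U) : Spec.map (CommRingCat.ofHom (ev p U h)) ≫ hU.fromSpec = p := by
  have h1 := IsAffineOpen.SpecMap_appLE_fromSpec p hU (isAffineOpen_top (Spec (.of R))) h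
  rw [IsAffineOpen.fromSpec_top] at h1
  change Spec.map (p.appLE U ⊤ h ≫ (Scheme.ΓSpecIso (.of R)).hom) ≫ hU.fromSpec = p
  rw [Spec.map_comp, Category.assoc, h1, ← Category.assoc, Scheme.isoSpec_Spec_inv,
    ← Spec.map_comp, Iso.inv_hom_id, Spec.map_id, Category.id_comp]

/-- If the values of functions on an affine open lie in a subring, then the point is defined over
the subring. -/
lemma exists_specMap_comp_eq (p : Spec (.of S) ⟶ X) {U : X.Opens} (hU : IsAffineOpen U)
    (h : ⊤ ≤ p ⁻¹ᵁ U) (φ : R →+* S) (hφ : Function.Injective φ) (hev : ∀ a, ev p U h a ∈ φ.range) :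
    ∃ p₀ : Spec (.of R) ⟶ X, Spec.map (CommRingCat.ofHom φ) ≫ p₀ = p := by
  let e : R ≃+* φ.range := RingEquiv.ofBijective φ.rangeRestrict
    ⟨fun a b hab => hφ (congrArg Subtype.val hab), φ.rangeRestrict_surjective⟩
  let ψ : Γ(X, U) →+* R := e.symm.toRingHom.comp ((ev p U h).codRestrict φ.range hev)
  have hψ : φ.comp ψ = ev p U h := by
    ext a
    exact congrArg Subtype.val (e.apply_symm_apply ⟨ev p U h a, hev a⟩)
  refine ⟨Spec.map (CommRingCat.ofHom ψ) ≫ hU.fromSpec, ?_⟩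
  rw [← Category.assoc, ← Spec.map_comp, ← CommRingCat.ofHom_comp, hψ, specMap_ev_fromSpec]

end Evaluation

/-! ### Line bundles at the level of values of transition functions, and finite families of
sections. -/

section Transition

variable {X : Scheme.{u}} {R S : Type u} [CommRing R] [CommRing S]

lemma map_ev_resUnits (p : Spec (.of R) ⟶ X) {U V : X.Opens} (h : U ≤ V) (hU : ⊤ ≤ p ⁻¹ᵁ U)
    (hV : ⊤ ≤ p ⁻¹ᵁ V) (a : Γ(X, V)ˣ) :
    ev p U hU (resUnits h a : Γ(X, U)) = ev p V hV a :=
  ev_res p h hU hV a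

/-- The value of the transition function `g a b` at an `R`-point. -/
def LineBundle.tr (L : LineBundle X) (p : Spec (.of R) ⟶ X) {a b : L.ι} (ha : ⊤ ≤ p ⁻¹ᵁ L.U a)
    (hb : ⊤ ≤ p ⁻¹ᵁ L.U b) : R :=
  ev p (L.U a ⊓ L.U b) (top_le_preimage_inf ha hb) (L.g a b)

namespace LineBundle

variable (L : LineBundle X) (p : Spec (.of R) ⟶ X)

lemma isUnit_tr {a b : L.ι} (ha : ⊤ ≤ p ⁻¹ᵁ L.U a) (hb : ⊤ ≤ p ⁻¹ᵁ L.U b) :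
    IsUnit (L.tr p ha hb) :=
  (L.g a b).isUnit.map (ev p _ (top_le_preimage_inf ha hb))

lemma tr_mul_tr {a b c : L.ι} (ha : ⊤ ≤ p ⁻¹ᵁ L.U a) (hb : ⊤ ≤ p ⁻¹ᵁ L.U b)
    (hc : ⊤ ≤ p ⁻¹ᵁ L.U c) : L.tr p ha hb * L.tr p hb hc = L.tr p ha hc := by
  have h := congrArg (fun u : Γ(X, L.U a ⊓ L.U b ⊓ L.U c)ˣ =>
    ev p _ (top_le_preimage_inf (top_le_preimage_inf ha hb) hc)
      (u : Γ(X, L.U a ⊓ L.U b ⊓ L.U c))) (L.cocycle a b c)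
  simp only [Units.val_mul, map_mul] at h
  rwa [map_ev_resUnits _ _ _ (top_le_preimage_inf ha hb),
    map_ev_resUnits _ _ _ (top_le_preimage_inf hb hc),
    map_ev_resUnits _ _ _ (top_le_preimage_inf ha hc)] at h

lemma tr_specMap (φ : R →+* S) {p' : Spec (.of S) ⟶ X}
    (hp : Spec.map (CommRingCat.ofHom φ) ≫ p = p') {a b : L.ι} (ha : ⊤ ≤ p ⁻¹ᵁ L.U a)
    (hb : ⊤ ≤ p ⁻¹ᵁ L.U b) (ha' : ⊤ ≤ p' ⁻¹ᵁ L.U a) (hb' : ⊤ ≤ p' ⁻¹ᵁ L.U b) :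
    L.tr p' ha' hb' = φ (L.tr p ha hb) :=
  ev_specMap φ p hp _ _ _ _

lemma exists_top_le_preimage_U [IsLocalRing R] : ∃ i, ⊤ ≤ p ⁻¹ᵁ L.U i :=
  exists_top_le_preimage p L.U (by rw [L.cover]; exact le_rfl)

variable {L} in
/-- The isomorphism `f^* L ≅ L^q` in local trivializations. -/
def Iso.unit {f : X ⟶ X} {q : ℕ} (h : (L.pullback f).Iso (L.pow q)) (a i : L.ι) :
    Γ(X, L.U a ⊓ f ⁻¹ᵁ L.U i)ˣ :=
  h.h a i

variable {L} in
lemma Iso.unit_comm {f : X ⟶ X} {q : ℕ} (h : (L.pullback f).Iso (L.pow q)) (a b i j : L.ι) :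
    resUnits (le_inf (inf_le_left.trans inf_le_left) (inf_le_right.trans (f.preimage_mono inf_le_left)) :
        (L.U a ⊓ L.U b) ⊓ (f ⁻¹ᵁ (L.U i ⊓ L.U j)) ≤ L.U a ⊓ f ⁻¹ᵁ L.U i) (h.unit a i) *
      resUnits (inf_le_right : _ ≤ f ⁻¹ᵁ (L.U i ⊓ L.U j))
        (Units.map (f.app (L.U i ⊓ L.U j)).hom.toMonoidHom (L.g i j)) =
    resUnits inf_le_left (L.g a b ^ q) *
      resUnits (le_inf (inf_le_left.trans inf_le_right) (inf_le_right.trans (f.preimage_mono inf_le_right)) :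
        (L.U a ⊓ L.U b) ⊓ (f ⁻¹ᵁ (L.U i ⊓ L.U j)) ≤ L.U b ⊓ f ⁻¹ᵁ L.U j) (h.unit b j) :=
  h.comm a b i j

/-- The value of the isomorphism `f^* L ≅ L^q` at an `R`-point compares the transition functions at
the point and at its image. -/
lemma isoValue {f : X ⟶ X} {q : ℕ} (h : (L.pullback f).Iso (L.pow q))
    {p' : Spec (.of R) ⟶ X} (hp : p ≫ f = p') {a b i j : L.ι}
    (ha : ⊤ ≤ p ⁻¹ᵁ L.U a) (hb : ⊤ ≤ p ⁻¹ᵁ L.U b)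
    (hi : ⊤ ≤ p' ⁻¹ᵁ L.U i) (hj : ⊤ ≤ p' ⁻¹ᵁ L.U j) :
    ev p (L.U a ⊓ f ⁻¹ᵁ L.U i) (top_le_preimage_inf ha ((top_le_preimage_comp p f hp _).2 hi))
      (h.unit a i) * L.tr p' hi hj = L.tr p ha hb ^ q *
    ev p (L.U b ⊓ f ⁻¹ᵁ L.U j) (top_le_preimage_inf hb ((top_le_preimage_comp p f hp _).2 hj))
      (h.unit b j) := by
  have hi' := (top_le_preimage_comp p f hp _).2 hi
  have hj' := (top_le_preimage_comp p f hp _).2 hj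
  have hab := top_le_preimage_inf ha hb
  have hij := (top_le_preimage_comp p f hp _).2 (top_le_preimage_inf hi hj)
  have hall := top_le_preimage_inf hab hij
  have h1 := congrArg (fun u : Γ(X, (L.U a ⊓ L.U b) ⊓ (f ⁻¹ᵁ (L.U i ⊓ L.U j)))ˣ =>
    ev p _ hall (u : Γ(X, (L.U a ⊓ L.U b) ⊓ (f ⁻¹ᵁ (L.U i ⊓ L.U j))))) (h.unit_comm a b i j)
  simp only [Units.val_mul] at h1
  rw [map_mul, map_mul] at h1
  have e₁ := map_ev_resUnits p (le_inf (inf_le_left.trans inf_le_left)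
    (inf_le_right.trans (f.preimage_mono inf_le_left)) :
      (L.U a ⊓ L.U b) ⊓ (f ⁻¹ᵁ (L.U i ⊓ L.U j)) ≤ L.U a ⊓ f ⁻¹ᵁ L.U i)
    hall (top_le_preimage_inf ha hi') (h.unit a i)
  have e₂ := map_ev_resUnits p (le_inf (inf_le_left.trans inf_le_right)
    (inf_le_right.trans (f.preimage_mono inf_le_right)) :
      (L.U a ⊓ L.U b) ⊓ (f ⁻¹ᵁ (L.U i ⊓ L.U j)) ≤ L.U b ⊓ f ⁻¹ᵁ L.U j)
    hall (top_le_preimage_inf hb hj') (h.unit b j)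
  have e₃ := map_ev_resUnits p (inf_le_right :
      (L.U a ⊓ L.U b) ⊓ (f ⁻¹ᵁ (L.U i ⊓ L.U j)) ≤ f ⁻¹ᵁ (L.U i ⊓ L.U j))
    hall hij (Units.map (f.app (L.U i ⊓ L.U j)).hom.toMonoidHom (L.g i j))
  have e₄ := map_ev_resUnits p (inf_le_left :
      (L.U a ⊓ L.U b) ⊓ (f ⁻¹ᵁ (L.U i ⊓ L.U j)) ≤ L.U a ⊓ L.U b)
    hall hab (L.g a b ^ q)
  have e₅ : ev p (L.U a ⊓ L.U b) hab ((L.g a b ^ q : Γ(X, L.U a ⊓ L.U b)ˣ) :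
      Γ(X, L.U a ⊓ L.U b)) = L.tr p ha hb ^ q := by
    rw [tr, ← map_pow, Units.val_pow_eq_pow_val]
  have e₆ : ev p (f ⁻¹ᵁ (L.U i ⊓ L.U j)) hij
      (Units.map (f.app (L.U i ⊓ L.U j)).hom.toMonoidHom (L.g i j) :
        Γ(X, f ⁻¹ᵁ (L.U i ⊓ L.U j))ˣ) = L.tr p' hi hj :=
    ev_comp p f hp (L.U i ⊓ L.U j) (top_le_preimage_inf hi hj) _ _
  rw [← e₅, ← e₆, ← e₁, ← e₂, ← e₃, ← e₄]
  exact h1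

/-- At the level of values of transition functions, `f^* L` is isomorphic to `L^q`: for a `K`-point
of `X` there is a constant `η` such that the transition functions at `f(p)` and `p` correspond to
each other up to `η` and to units of every valuation ring over which `p` extends. -/
def Scales (L : LineBundle X) (f : X ⟶ X) (q : ℕ) : Prop :=
  ∀ (K : Type u) [Field K] (p p' : Spec (.of K) ⟶ X) (_ : p ≫ f = p') (a₀ i₀ : L.ι)
    (ha₀ : ⊤ ≤ p ⁻¹ᵁ L.U a₀) (hi₀ : ⊤ ≤ p' ⁻¹ᵁ L.U i₀), ∃ η : K, η ≠ 0 ∧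
    ∀ (V : ValuationSubring K) (c c' : Spec (.of V) ⟶ X) (_ : c ≫ f = c')
      (_ : Spec.map (CommRingCat.ofHom V.subtype) ≫ c = p) (a i : L.ι)
      (_ : ⊤ ≤ c ⁻¹ᵁ L.U a) (_ : ⊤ ≤ c' ⁻¹ᵁ L.U i)
      (ha : ⊤ ≤ p ⁻¹ᵁ L.U a) (hi : ⊤ ≤ p' ⁻¹ᵁ L.U i),
      ∃ v : Vˣ, L.tr p' hi₀ hi = η * v * L.tr p ha₀ ha ^ q

/-- The isomorphism has invertible components. Its value in the base trivializations at `p` gives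
`η⁻¹`; its value in trivializations around the extended point lies in the units of `V` and gives
`v`. The compatibility `isoValue` relates the two. -/
lemma scales_of_iso {f : X ⟶ X} {q : ℕ} (h : (L.pullback f).Iso (L.pow q)) : L.Scales f q := by
  intro K _ p p' hp a₀ i₀ ha₀ hi₀
  have hi₀' := (top_le_preimage_comp p f hp _).2 hi₀
  set η := ev p (L.U a₀ ⊓ f ⁻¹ᵁ L.U i₀) (top_le_preimage_inf ha₀ hi₀') (h.unit a₀ i₀) with hη
  have hη0 : η ≠ 0 := ((h.unit a₀ i₀).isUnit.map (ev p _ _)).ne_zero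
  refine ⟨η⁻¹, inv_ne_zero hη0, ?_⟩
  intro V c c' hc hcp a i hca hci ha hi
  have hci' := (top_le_preimage_comp c f hc _).2 hci
  let v : Vˣ := Units.map (ev c (L.U a ⊓ f ⁻¹ᵁ L.U i)
    (top_le_preimage_inf hca hci')).toMonoidHom (h.unit a i)
  have hv : ev p (L.U a ⊓ f ⁻¹ᵁ L.U i)
      (top_le_preimage_inf ha ((top_le_preimage_comp p f hp _).2 hi)) (h.unit a i) = (v : V) :=
    ev_specMap V.subtype c hcp _ _ _ _
  have key := L.isoValue p h hp ha₀ ha hi₀ hi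
  rw [hv, ← hη] at key
  refine ⟨v, ?_⟩
  rw [mul_assoc, eq_inv_mul_iff_mul_eq₀ hη0, key, mul_comm]

lemma scales_id : L.Scales (𝟙 X) 1 := by
  intro K _ p p' hp a₀ i₀ ha₀ hi₀
  rw [Category.comp_id] at hp
  subst hp
  refine ⟨L.tr p hi₀ ha₀, (L.isUnit_tr p _ _).ne_zero, ?_⟩
  intro V c c' hc hcp a i hca hci ha hi
  rw [Category.comp_id] at hc
  subst hc
  refine ⟨(L.isUnit_tr c hca hci).unit, ?_⟩
  rw [pow_one, IsUnit.unit_spec, ← L.tr_mul_tr p hi₀ ha₀ hi, ← L.tr_mul_tr p ha₀ ha hi,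
    L.tr_specMap c V.subtype hcp hca hci ha hi, mul_assoc, mul_comm (L.tr p ha₀ ha)]
  rfl

/-- Trivializations are inserted at the intermediate point, once over `K` and once over `V`; the
constants multiply to `η' η^r` and the units to `v' v^r`. Thus iterates are treated without
composing isomorphisms of pulled-back bundles. -/
lemma Scales.comp {L : LineBundle X} {f g : X ⟶ X} {q r : ℕ} (hf : L.Scales f q)
    (hg : L.Scales g r) : L.Scales (f ≫ g) (q * r) := by
  intro K _ p p'' hp a₀ i₀ ha₀ hi₀
  rw [← Category.assoc] at hp
  obtain ⟨j₀, hj₀⟩ := L.exists_top_le_preimage_U (p ≫ f)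
  obtain ⟨η, hη, H⟩ := hf K p (p ≫ f) rfl a₀ j₀ ha₀ hj₀
  obtain ⟨η', hη', H'⟩ := hg K (p ≫ f) p'' hp j₀ i₀ hj₀ hi₀
  refine ⟨η' * η ^ r, mul_ne_zero hη' (pow_ne_zero _ hη), ?_⟩
  intro V c c'' hc hcp a i hca hci ha hi
  rw [← Category.assoc] at hc
  obtain ⟨j, hj⟩ := L.exists_top_le_preimage_U (c ≫ f)
  have hcp' : Spec.map (CommRingCat.ofHom V.subtype) ≫ (c ≫ f) = p ≫ f := by
    rw [← Category.assoc, hcp]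
  have hj' := top_le_preimage_specMap V.subtype (c ≫ f) hcp' hj
  obtain ⟨v, hv⟩ := H V c (c ≫ f) rfl hcp a j hca hj ha hj'
  obtain ⟨v', hv'⟩ := H' V (c ≫ f) c'' hc hcp' j i hj hci hj' hi
  refine ⟨v' * v ^ r, ?_⟩
  rw [hv', hv]
  push_cast
  ring

end LineBundle

/-- The iterates of an endomorphism of a scheme. -/
def iter (f : X ⟶ X) : ℕ → (X ⟶ X)
  | 0 => 𝟙 X
  | n + 1 => iter f n ≫ f

lemma iter_apply (f : X ⟶ X) (n : ℕ) (x : X) : iter f n x = (f : X → X)^[n] x := by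
  induction n with
  | zero => simp [iter]
  | succ n ih => rw [Function.iterate_succ_apply', ← ih]; simp [iter]

lemma LineBundle.Scales.iter {L : LineBundle X} {f : X ⟶ X} {q : ℕ} (hf : L.Scales f q) (n : ℕ) :
    L.Scales (iter f n) (q ^ n) := by
  induction n with
  | zero => exact L.scales_id
  | succ n ih => exact ih.comp hf

lemma LineBundle.GlobalSection.res_pow {L : LineBundle X} {n : ℕ} (t : (L.pow n).GlobalSection)
    (m : ℕ) (i i' : L.ι) (s : ∀ i, Γ(X, L.U i)) (hs : s = t.s) :
    res (inf_le_left : L.U i ⊓ L.U i' ≤ L.U i) (s i ^ m) =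
      (L.g i i' : Γ(X, L.U i ⊓ L.U i')) ^ (n * m) *
        res (inf_le_right : L.U i ⊓ L.U i' ≤ L.U i') (s i' ^ m) := by
  have h1 : res (inf_le_left : L.U i ⊓ L.U i' ≤ L.U i) (s i) =
      ((L.g i i' ^ n : Γ(X, L.U i ⊓ L.U i')ˣ) : Γ(X, L.U i ⊓ L.U i')) *
        res (inf_le_right : L.U i ⊓ L.U i' ≤ L.U i') (s i') := by
    subst hs
    exact t.compat i i'
  rw [map_pow, map_pow, h1, mul_pow, Units.val_pow_eq_pow_val, pow_mul]

/-- Finitely many sections of a power of `L` whose nonvanishing loci are affine and cover `X`. -/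
structure AffineSections (L : LineBundle X) where
  /-- the index set of the sections -/
  J : Type u
  finite : Finite J
  /-- the power of `L` -/
  N : ℕ
  /-- the sections in the local trivializations -/
  s : ∀ i, J → Γ(X, L.U i)
  compat : ∀ i i' j, res (inf_le_left : L.U i ⊓ L.U i' ≤ L.U i) (s i j) =
    (L.g i i' : Γ(X, L.U i ⊓ L.U i')) ^ N *
      res (inf_le_right : L.U i ⊓ L.U i' ≤ L.U i') (s i' j)
  isAffineOpen : ∀ j, IsAffineOpen (⨆ i, X.basicOpen (s i j))
  cover : ⨆ j, ⨆ i, X.basicOpen (s i j) = ⊤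

/-- Quasi-compactness leaves finitely many sections, of various powers `n x`. Raising each to the
power `N / n x`, with `N` the product of the `n x`, puts them all in `L^N` and does not change their
nonvanishing loci. -/
lemma LineBundle.IsAmple.nonempty_affineSections {L : LineBundle X} (hL : L.IsAmple) :
    Nonempty (AffineSections L) := by
  obtain ⟨hX, h⟩ := hL
  choose n hn t hxt ht using h
  obtain ⟨F, hF⟩ := isCompact_univ.elim_finite_subcover (fun x : X => ((t x).nonvanishing : Set X))
    (fun x => (t x).nonvanishing.isOpen) (fun x _ => Set.mem_iUnion.2 ⟨x, hxt x⟩)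
  set N := ∏ x ∈ F, n x with hN
  have hdvd : ∀ x ∈ F, n x ∣ N := fun x hx => Finset.dvd_prod_of_mem n hx
  have hNpos : 0 < N := Finset.prod_pos fun x _ => hn x
  have hpos : ∀ x ∈ F, 0 < N / n x := fun x hx =>
    Nat.div_pos (Nat.le_of_dvd hNpos (hdvd x hx)) (hn x)
  have hopen : ∀ x : F, ⨆ i, X.basicOpen ((t x.1).s i ^ (N / n x.1)) = (t x.1).nonvanishing :=
    fun x => iSup_congr fun i => X.basicOpen_pow _ (hpos x.1 x.2)
  refine ⟨⟨F, inferInstance, N, fun i x => (t x.1).s i ^ (N / n x.1), ?_, ?_, ?_⟩⟩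
  · intro i i' x
    have h1 := (t x.1).res_pow (N / n x.1) i i' _ rfl
    rwa [Nat.mul_div_cancel' (hdvd x.1 x.2)] at h1
  · intro x
    have := ht x.1
    rwa [← hopen x] at this
  · rw [eq_top_iff]
    intro x _
    obtain ⟨y, hy, hxy⟩ := Set.mem_iUnion₂.1 (hF (Set.mem_univ x))
    rw [TopologicalSpace.Opens.mem_iSup]
    refine ⟨⟨y, hy⟩, ?_⟩
    have h1 : x ∈ (t y).nonvanishing := hxy
    rw [← hopen ⟨y, hy⟩] at h1
    exact h1

end Transition

/-! ### Properness of projective varieties and extension of points to valuation rings. -/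

section Proper

variable {k : Type u} [Field k]

section

attribute [local instance] MvPolynomial.gradedAlgebra

lemma bijective_algebraMap_homogeneousSubmodule_zero (σ : Type*) :
    Function.Bijective (algebraMap k (MvPolynomial.homogeneousSubmodule σ k 0)) := by
  refine ⟨fun a b hab => MvPolynomial.C_injective σ k (congrArg Subtype.val hab),
    fun ⟨x, hx⟩ => ⟨MvPolynomial.coeff 0 x, ?_⟩⟩
  have h1 : x.totalDegree = 0 := (MvPolynomial.totalDegree_zero_iff_isHomogeneous σ).2 hx
  exact Subtype.ext (MvPolynomial.totalDegree_eq_zero_iff_eq_C.1 h1).symm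

instance finiteType_homogeneousSubmodule_zero (σ : Type*) [Finite σ] :
    Algebra.FiniteType (MvPolynomial.homogeneousSubmodule σ k 0) (MvPolynomial σ k) :=
  have : IsScalarTower k (MvPolynomial.homogeneousSubmodule σ k 0) (MvPolynomial σ k) :=
    ⟨fun a b c => smul_mul_assoc a (b : MvPolynomial σ k) c⟩
  Algebra.FiniteType.of_restrictScalars_finiteType k _ _

/-- `Proj` is proper over the spectrum of the degree-zero part of the graded ring, and here that
part consists of the constants `k`. -/
instance isProper_projectiveSpace (N : ℕ) : IsProper (projectiveSpace k N).hom := by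
  have : IsIso (CommRingCat.ofHom
      (algebraMap k (MvPolynomial.homogeneousSubmodule (Fin (N + 1)) k 0))) :=
    (ConcreteCategory.isIso_iff_bijective _).2 (bijective_algebraMap_homogeneousSubmodule_zero _)
  change IsProper (Proj.toSpecZero (MvPolynomial.homogeneousSubmodule (Fin (N + 1)) k) ≫
    Spec.map (CommRingCat.ofHom
      (algebraMap k (MvPolynomial.homogeneousSubmodule (Fin (N + 1)) k 0))))
  infer_instance

end

lemma IsProjectiveVariety.isProper {X : Over (Spec (.of k))} (hX : IsProjectiveVariety X) :
    IsProper X.hom := by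
  obtain ⟨N, i, hi⟩ := hX.projective
  rw [← Over.w i]
  infer_instance

/-- Over a proper `k`-scheme, a point with values in a field extends to every valuation ring of the
field that contains `k`. -/
lemma exists_center {X : Scheme.{u}} (s : X ⟶ Spec (.of k)) [IsProper s] {K : Type u} [Field K]
    [Algebra k K] (p : Spec (.of K) ⟶ X)
    (hp : p ≫ s = Spec.map (CommRingCat.ofHom (algebraMap k K))) (V : ValuationSubring K)
    (hV : ∀ c : k, algebraMap k K c ∈ V) :
    ∃ c : Spec (.of V) ⟶ X, Spec.map (CommRingCat.ofHom V.subtype) ≫ c = p := by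
  have h1 : ValuativeCriterion.Existence s := by
    have h2 : UniversallyClosed s := inferInstance
    rw [UniversallyClosed.eq_valuativeCriterion] at h2
    exact h2.1
  have hsq : CommSq p (Spec.map (CommRingCat.ofHom (algebraMap V K))) s
      (Spec.map (CommRingCat.ofHom ((algebraMap k K).codRestrict V.toSubring hV))) := by
    refine ⟨?_⟩
    rw [hp, ← Spec.map_comp]
    rfl
  obtain ⟨l, hl, -⟩ := (h1 { R := V, K := K, commSq := hsq, .. }).exists_lift
  exact ⟨l, hl⟩

end Proper

/-! ### Fractional ideals over valuation rings, and how they yield domination and integrality. -/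

section Generates

variable {k K J : Type*} [Field k] [Field K] [Algebra k K]

/-- The fractional ideal of `V` generated by a family `x` is generated by `β`. -/
def Generates (V : ValuationSubring K) (x : J → K) (β : K) : Prop :=
  β ≠ 0 ∧ (∀ j, x j / β ∈ V) ∧ ∃ j, x j ≠ 0 ∧ β / x j ∈ V

lemma Generates.const_mul {V : ValuationSubring K} {x : J → K} {β c : K} (h : Generates V x β)
    (hc : c ≠ 0) : Generates V (fun j => c * x j) (c * β) := by
  obtain ⟨hβ, h1, j, hj, h2⟩ := h
  refine ⟨mul_ne_zero hc hβ, fun i => ?_, j, mul_ne_zero hc hj, ?_⟩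
  · rw [mul_div_mul_left _ _ hc]; exact h1 i
  · rw [mul_div_mul_left _ _ hc]; exact h2

lemma Generates.div_mem {V : ValuationSubring K} {x : J → K} {β : K} (h : Generates V x β)
    (hV : ∀ c : k, algebraMap k K c ∈ V) {n : ℕ} {z : K}
    (hz : z ∈ Submodule.span k (Set.range x) ^ n) : z / β ^ n ∈ V := by
  obtain ⟨hβ, h1, -⟩ := h
  have hspan : ∀ y ∈ Submodule.span k (Set.range x), y / β ∈ V := fun y hy => by
    induction hy using Submodule.span_induction with
    | mem y hy => obtain ⟨j, rfl⟩ := hy; exact h1 j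
    | zero => rw [zero_div]; exact V.zero_mem
    | add a b _ _ ha hb => rw [add_div]; exact V.add_mem _ _ ha hb
    | smul c a _ ha =>
      rw [Algebra.smul_def, mul_div_assoc]; exact V.mul_mem _ _ (hV c) ha
  induction hz using Submodule.pow_induction_on_left' with
  | algebraMap r => simpa using hV r
  | add x y i _ _ ihx ihy => rw [add_div]; exact V.add_mem _ _ ihx ihy
  | mem_mul m hm i x _ ih =>
    rw [pow_succ', mul_div_mul_comm]; exact V.mul_mem _ _ (hspan m hm) ih

/-- At each valuation ring some `y j` generates the same ideal as `γ`, so every degree-`m` form in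
the `x i` is divisible there by `y j ^ n`. This is the hypothesis of the valuative criterion for
domination. -/
lemma dominated_of_generates [Finite J] {x y : J → K} {m n : ℕ}
    (h : ∀ V : ValuationSubring K, (∀ c : k, algebraMap k K c ∈ V) →
      ∃ β γ, Generates V x β ∧ Generates V y γ ∧ β ^ m = γ ^ n) :
    Dominated (Submodule.span k (Set.range x) ^ m) (Submodule.span k (Set.range y) ^ n) := by
  have hfg : ∀ z : J → K, (Submodule.span k (Set.range z)).FG := fun z =>
    Submodule.fg_span (Set.finite_range z)
  refine Dominated.of_forall_mem ((hfg x).pow m) fun z hz =>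
    dominated_span_singleton_of_forall_valuationSubring ((hfg y).pow n) fun V hV => ?_
  obtain ⟨β, γ, hβ, hγ, hβγ⟩ := h V hV
  obtain ⟨hγ0, -, j, hj, hjV⟩ := hγ
  refine ⟨y j ^ n, Submodule.pow_mem_pow _ (Submodule.subset_span (Set.mem_range_self j)) n,
    pow_ne_zero _ hj, ?_⟩
  have h1 := V.mul_mem _ _ (hβ.div_mem hV hz) (pow_mem hjV n)
  rwa [hβγ, div_pow, div_mul_div_cancel₀ (pow_ne_zero _ hγ0)] at h1

/-- The subspace spanned by the quotients of the elements of a family by one of them. -/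
def ratios (k : Type*) [Field k] [Algebra k K] (x : J → K) (j₀ : J) : Submodule k K :=
  Submodule.span k (Set.range fun j => (x j₀)⁻¹ * x j)

lemma ratios_fg [Finite J] (x : J → K) (j₀ : J) : (ratios k x j₀).FG :=
  Submodule.fg_span (Set.finite_range _)

lemma one_le_ratios {x : J → K} {j₀ : J} (h : x j₀ ≠ 0) : 1 ≤ ratios k x j₀ := by
  rw [Submodule.one_eq_span, Submodule.span_singleton_le_iff_mem]
  exact Submodule.subset_span ⟨j₀, inv_mul_cancel₀ h⟩

lemma isScaling_ratios [Finite J] {x : J → K} {j₀ : J} (hx : x j₀ ≠ 0) (φ : K →ₐ[k] K) {q : ℕ}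
    {η : K} (hη : η ≠ 0) (h : ∀ V : ValuationSubring K, (∀ c : k, algebraMap k K c ∈ V) →
      ∃ β, Generates V x β ∧ Generates V (fun j => φ (x j)) (η * β ^ q)) :
    IsScaling φ (ratios k x j₀) q := by
  have hφ : φ (x j₀) ≠ 0 := (map_ne_zero φ).2 hx
  -- With this `u`, the product of `u` and `φ (x j / x j₀)` is `η⁻¹ (x j₀)⁻¹ ^ q φ (x j)`; the ideal
  -- generated by these is exactly the `q`-th power of the one generated by the `x j / x j₀`.
  set u := φ (x j₀) * (η⁻¹ * (x j₀)⁻¹ ^ q) with hu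
  have hu0 : u ≠ 0 := mul_ne_zero hφ (mul_ne_zero (inv_ne_zero hη)
    (pow_ne_zero _ (inv_ne_zero hx)))
  have hmap : Submodule.span k {u} * (ratios k x j₀).map φ.toLinearMap =
      Submodule.span k (Set.range fun j => η⁻¹ * (x j₀)⁻¹ ^ q * φ (x j)) := by
    rw [ratios, Submodule.map_span, Submodule.span_mul_span, ← Set.range_comp,
      Set.singleton_mul, ← Set.range_comp]
    congr 2
    ext j
    simp only [Function.comp, AlgHom.toLinearMap_apply, map_mul, map_inv₀, hu]
    field_simp
  have key : ∀ V : ValuationSubring K, (∀ c : k, algebraMap k K c ∈ V) →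
      ∃ β, Generates V (fun j => (x j₀)⁻¹ * x j) β ∧
        Generates V (fun j => η⁻¹ * (x j₀)⁻¹ ^ q * φ (x j)) (β ^ q) := fun V hV => by
    obtain ⟨β, h1, h2⟩ := h V hV
    refine ⟨_, h1.const_mul (inv_ne_zero hx), ?_⟩
    convert h2.const_mul (mul_ne_zero (inv_ne_zero hη) (pow_ne_zero q (inv_ne_zero hx))) using 1
    rw [mul_pow]
    field_simp
  refine ⟨u, hu0, ?_, ?_⟩
  · rw [hmap, ← pow_one (Submodule.span k (Set.range _))]
    refine dominated_of_generates fun V hV => ?_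
    obtain ⟨β, h1, h2⟩ := key V hV
    exact ⟨_, _, h2, h1, pow_one _⟩
  · rw [hmap, ← pow_one (Submodule.span k (Set.range fun j => η⁻¹ * _ * _))]
    refine dominated_of_generates fun V hV => ?_
    obtain ⟨β, h1, h2⟩ := key V hV
    exact ⟨_, _, h1, h2, (pow_one _).symm⟩

/-- The integral closure of a subring in a field is the intersection of the valuation rings that
contain it. -/
lemma isIntegral_of_forall_valuationSubring (B : Subalgebra k K) {z : K}
    (h : ∀ V : ValuationSubring K, (∀ b ∈ B, b ∈ V) → z ∈ V) : IsIntegral B z := by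
  have h1 : z ∈ (integralClosure (Subring.closure (B : Set K)) K).toSubring := by
    rw [← iInf_valuationSubring_superset, Subring.mem_iInf]
    exact fun V => h V.1 V.2
  have h2 : Subring.closure (B : Set K) = B.toSubring := Subring.closure_eq B.toSubring
  rw [h2] at h1
  exact h1

/-- If the fractional ideals generated by `y` are, up to scaling, the `q`-th powers of those
generated by `x`, then the quotients of the `x j` are algebraic over the field generated by
quotients of the `y j`. -/
lemma isAlgebraic_ratio {x : J → K} {y : J → K} {j₀ l : J} (hx : x j₀ ≠ 0) (hy : y l ≠ 0) {q : ℕ}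
    (hq : q ≠ 0) {η : K} (hη : η ≠ 0)
    (h : ∀ V : ValuationSubring K, (∀ c : k, algebraMap k K c ∈ V) →
      ∃ β, Generates V x β ∧ Generates V y (η * β ^ q))
    (E : IntermediateField k K) (hE : ∀ j, y j / y l ∈ E) (j : J) :
    IsAlgebraic E ((x j₀)⁻¹ * x j) := by
  -- At a valuation ring containing `E`, this element is the product of `(x j / β)^q`, of `η β^q / y
  -- i` for a generating `y i`, and of `y i / y l ∈ E`. Quotients of two such elements are the
  -- `q`-th powers of the ratios in question.
  have h1 : ∀ j, IsIntegral E (η * x j ^ q / y l) := fun j => by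
    refine isIntegral_of_forall_valuationSubring E.toSubalgebra fun V hV => ?_
    obtain ⟨β, ⟨hβ, hβ1, -⟩, hγ, -, i, hi, hi1⟩ := h V fun c => hV _ (E.algebraMap_mem c)
    have h2 := V.mul_mem _ _ (V.mul_mem _ _ (pow_mem (hβ1 j) q) hi1) (hV _ (hE i))
    convert h2 using 1
    rw [div_pow]
    field_simp
  have h3 : IsAlgebraic E (((x j₀)⁻¹ * x j) ^ q) := by
    have h4 : ((x j₀)⁻¹ * x j) ^ q = η * x j ^ q / y l * (η * x j₀ ^ q / y l)⁻¹ := by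
      rw [mul_pow, inv_pow]
      field_simp
    rw [h4]
    exact (h1 j).isAlgebraic.mul (h1 j₀).isAlgebraic.inv
  exact h3.of_pow (Nat.pos_of_ne_zero hq)

end Generates

/-! ### Sections of an ample bundle evaluated at field-valued points. -/

namespace AffineSections

section Values

variable {X : Scheme.{u}} {L : LineBundle X} (A : AffineSections L) {R S : Type u} [CommRing R]
  [CommRing S] (p : Spec (.of R) ⟶ X)

/-- The value of the `j`-th section at an `R`-point, in a local trivialization. -/
def val {a : L.ι} (ha : ⊤ ≤ p ⁻¹ᵁ L.U a) (j : A.J) : R :=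
  ev p (L.U a) ha (A.s a j)

/-- The nonvanishing locus of the `j`-th section. -/
def locus (j : A.J) : X.Opens := ⨆ i, X.basicOpen (A.s i j)

lemma val_eq_tr_pow_mul {a b : L.ι} (ha : ⊤ ≤ p ⁻¹ᵁ L.U a) (hb : ⊤ ≤ p ⁻¹ᵁ L.U b) (j : A.J) :
    A.val p ha j = L.tr p ha hb ^ A.N * A.val p hb j := by
  have h := congrArg (ev p (L.U a ⊓ L.U b) (top_le_preimage_inf ha hb)) (A.compat a b j)
  rwa [map_mul, map_pow, ev_res p _ _ ha, ev_res p _ _ hb] at h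

lemma val_specMap (φ : R →+* S) {p' : Spec (.of S) ⟶ X}
    (hp : Spec.map (CommRingCat.ofHom φ) ≫ p = p') {a : L.ι} (ha : ⊤ ≤ p ⁻¹ᵁ L.U a)
    (ha' : ⊤ ≤ p' ⁻¹ᵁ L.U a) (j : A.J) : A.val p' ha' j = φ (A.val p ha j) :=
  ev_specMap φ p hp _ _ _ _

lemma exists_isUnit_val [IsLocalRing R] {a : L.ι} (ha : ⊤ ≤ p ⁻¹ᵁ L.U a) :
    ∃ j, IsUnit (A.val p ha j) := by
  obtain ⟨j, hj⟩ := exists_top_le_preimage p (fun j => ⨆ i, X.basicOpen (A.s i j))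
    (by rw [A.cover]; exact le_rfl)
  obtain ⟨b, hb⟩ := exists_top_le_preimage p _ hj
  have hb' := top_le_preimage_mono (X.basicOpen_le _) hb
  refine ⟨j, ?_⟩
  rw [A.val_eq_tr_pow_mul p ha hb']
  exact ((L.isUnit_tr p ha hb').pow _).mul ((top_le_preimage_basicOpen_iff p _ hb' _).1 hb)

lemma top_le_preimage_locus {a : L.ι} (ha : ⊤ ≤ p ⁻¹ᵁ L.U a) {j : A.J}
    (hj : IsUnit (A.val p ha j)) : ⊤ ≤ p ⁻¹ᵁ A.locus j :=
  top_le_preimage_mono (le_iSup (fun i => X.basicOpen (A.s i j)) a)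
    ((top_le_preimage_basicOpen_iff p _ ha _).2 hj)

end Values

section Fields

variable {k : Type u} [Field k] {X : Scheme.{u}} {L : LineBundle X} (A : AffineSections L)
  (s : X ⟶ Spec (.of k)) [IsProper s] {K : Type u} [Field K] [Algebra k K]
  (p : Spec (.of K) ⟶ X)

lemma exists_val_ne_zero {a : L.ι} (ha : ⊤ ≤ p ⁻¹ᵁ L.U a) : ∃ j, A.val p ha j ≠ 0 :=
  (A.exists_isUnit_val p ha).imp fun _ h => h.ne_zero

/-- In a trivialization around the extended point `c` the sections take values in `V`, and one of
these is a unit because the loci cover. The change of trivialization multiplies them all by the same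
`N`-th power. -/
lemma generates_center {V : ValuationSubring K} {c : Spec (.of V) ⟶ X}
    (hc : Spec.map (CommRingCat.ofHom V.subtype) ≫ c = p) {a₀ a : L.ι} (ha₀ : ⊤ ≤ p ⁻¹ᵁ L.U a₀)
    (ha : ⊤ ≤ p ⁻¹ᵁ L.U a) (hca : ⊤ ≤ c ⁻¹ᵁ L.U a) :
    Generates V (A.val p ha₀) (L.tr p ha₀ ha ^ A.N) := by
  have ht : L.tr p ha₀ ha ^ A.N ≠ 0 := pow_ne_zero _ (L.isUnit_tr p ha₀ ha).ne_zero
  have hval : ∀ j, A.val p ha₀ j = L.tr p ha₀ ha ^ A.N * (A.val c hca j : V) := fun j => by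
    rw [A.val_eq_tr_pow_mul p ha₀ ha, A.val_specMap c V.subtype hc hca ha]
    rfl
  obtain ⟨j, hj⟩ := A.exists_isUnit_val c hca
  obtain ⟨v, hv⟩ := hj
  have hv0 : ((v : V) : K) ≠ 0 := fun h => v.ne_zero (Subtype.ext h)
  refine ⟨ht, fun j => ?_, j, ?_, ?_⟩
  · rw [hval, mul_div_cancel_left₀ _ ht]
    exact Subtype.property _
  · rw [hval, ← hv]
    exact mul_ne_zero ht hv0
  · rw [hval, ← hv, div_mul_cancel_left₀ ht]
    have h1 : ((v⁻¹ : Vˣ) : V).1 = ((v : V) : K)⁻¹ :=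
      eq_inv_of_mul_eq_one_left (congrArg Subtype.val (Units.inv_mul v))
    rw [← h1]
    exact Subtype.property _

/-- `generates_center` applies at `c` and at `c ≫ f`. `Scales` compares the two generators up to `η
^ N` and the `N`-th power of a unit of `V`, and such a unit does not change the ideal. -/
lemma exists_generates (hp : p ≫ s = Spec.map (CommRingCat.ofHom (algebraMap k K)))
    {f : X ⟶ X} {q : ℕ} (hf : L.Scales f q) {p' : Spec (.of K) ⟶ X} (hp' : p ≫ f = p')
    {a₀ i₀ : L.ι} (ha₀ : ⊤ ≤ p ⁻¹ᵁ L.U a₀) (hi₀ : ⊤ ≤ p' ⁻¹ᵁ L.U i₀) :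
    ∃ η : K, η ≠ 0 ∧ ∀ V : ValuationSubring K, (∀ c : k, algebraMap k K c ∈ V) →
      ∃ β, Generates V (A.val p ha₀) β ∧ Generates V (A.val p' hi₀) (η * β ^ q) := by
  obtain ⟨η, hη, H⟩ := hf K p p' hp' a₀ i₀ ha₀ hi₀
  refine ⟨η ^ A.N, pow_ne_zero _ hη, fun V hV => ?_⟩
  obtain ⟨c, hc⟩ := exists_center s p hp V hV
  obtain ⟨a, hca⟩ := L.exists_top_le_preimage_U c
  obtain ⟨i, hci⟩ := L.exists_top_le_preimage_U (c ≫ f)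
  have hc' : Spec.map (CommRingCat.ofHom V.subtype) ≫ c ≫ f = p' := by
    rw [← Category.assoc, hc, hp']
  have ha := top_le_preimage_specMap V.subtype c hc hca
  have hi := top_le_preimage_specMap V.subtype (c ≫ f) hc' hci
  obtain ⟨v, hv⟩ := H V c (c ≫ f) rfl hc a i hca hci ha hi
  obtain ⟨hβ, h1, j, hj, h2⟩ := A.generates_center p' hc' hi₀ hi hci
  have hv0 : ((v : V) : K) ≠ 0 := fun h => v.ne_zero (Subtype.ext h)
  have hvi : ((v⁻¹ : Vˣ) : V).1 = ((v : V) : K)⁻¹ :=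
    eq_inv_of_mul_eq_one_left (congrArg Subtype.val (Units.inv_mul v))
  have ht : L.tr p ha₀ ha ≠ 0 := (L.isUnit_tr p ha₀ ha).ne_zero
  have e : η ^ A.N * (L.tr p ha₀ ha ^ A.N) ^ q =
      L.tr p' hi₀ hi ^ A.N * (((v⁻¹ : Vˣ) : V) : K) ^ A.N := by
    have e₀ : η * ((v : V) : K) * L.tr p ha₀ ha ^ q * ((v : V) : K)⁻¹ =
        η * L.tr p ha₀ ha ^ q := by field_simp
    rw [hv, hvi, ← mul_pow (η * _ * _), e₀]
    ring
  have e' : L.tr p' hi₀ hi ^ A.N =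
      η ^ A.N * (L.tr p ha₀ ha ^ A.N) ^ q * (v : V) ^ A.N := by
    rw [hv]; ring
  refine ⟨_, A.generates_center p hc ha₀ ha hca,
    mul_ne_zero (pow_ne_zero _ hη) (pow_ne_zero _ (pow_ne_zero _ ht)), fun j => ?_, j, hj, ?_⟩
  · have h3 := V.mul_mem _ _ (h1 j) (pow_mem (v : V).2 A.N)
    rw [e'] at h3
    convert h3 using 1
    field_simp
  · have h3 := V.mul_mem _ _ h2 (pow_mem ((v⁻¹ : Vˣ) : V).2 A.N)
    rw [e]
    convert h3 using 1
    field_simp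

/-- The values at `p` of functions on an affine nonvanishing locus are integral over the ring
generated by the quotients of the values of the sections. -/
lemma isIntegral_ev (hp : p ≫ s = Spec.map (CommRingCat.ofHom (algebraMap k K)))
    {a₀ : L.ι} (ha₀ : ⊤ ≤ p ⁻¹ᵁ L.U a₀) {j₀ : A.J} (hj₀ : A.val p ha₀ j₀ ≠ 0)
    (B : Subalgebra k K) (hB : ∀ j, (A.val p ha₀ j₀)⁻¹ * A.val p ha₀ j ∈ B)
    (hT : ⊤ ≤ p ⁻¹ᵁ A.locus j₀) (z : Γ(X, A.locus j₀)) : IsIntegral B (ev p _ hT z) := by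
  refine isIntegral_of_forall_valuationSubring B fun V hV => ?_
  obtain ⟨c, hc⟩ := exists_center s p hp V fun c => hV _ (B.algebraMap_mem c)
  obtain ⟨a, hca⟩ := L.exists_top_le_preimage_U c
  have ha := top_le_preimage_specMap V.subtype c hc hca
  obtain ⟨hβ, -, j, hj, h2⟩ := A.generates_center p hc ha₀ ha hca
  have ht : L.tr p ha₀ ha ^ A.N ≠ 0 := hβ
  have hval : A.val p ha₀ j₀ = L.tr p ha₀ ha ^ A.N * (A.val c hca j₀ : V) := by
    rw [A.val_eq_tr_pow_mul p ha₀ ha, A.val_specMap c V.subtype hc hca ha]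
    rfl
  have hv0 : ((A.val c hca j₀ : V) : K) ≠ 0 := fun h => hj₀ (by rw [hval, h, mul_zero])
  have h3 : ((A.val c hca j₀ : V) : K)⁻¹ ∈ V := by
    have h4 := V.mul_mem _ _ h2 (hV _ (hB j))
    convert h4 using 1
    rw [hval]
    field_simp
  -- The `j₀`-th section generates at `V`, so it does not vanish at the center. The center then lies
  -- in the affine locus, and functions there have values in `V`.
  have hunit : IsUnit (A.val c hca j₀) :=
    IsUnit.of_mul_eq_one ⟨_, h3⟩ (Subtype.ext (mul_inv_cancel₀ hv0))
  rw [ev_specMap V.subtype c hc _ (A.top_le_preimage_locus c hca hunit) hT]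
  exact Subtype.property _

/-- By `isIntegral_ev` the coordinates on the affine locus are integral over `K₀`, hence lie in
`K₀`, which is algebraically closed in `K`. A point of an affine open set is determined by its
coordinates, so it descends. -/
lemma exists_specMap_comp_eq (hp : p ≫ s = Spec.map (CommRingCat.ofHom (algebraMap k K)))
    {a₀ : L.ι} (ha₀ : ⊤ ≤ p ⁻¹ᵁ L.U a₀) {j₀ : A.J} (hj₀ : A.val p ha₀ j₀ ≠ 0)
    (K₀ : IntermediateField k K) (hK₀ : ∀ z : K, IsAlgebraic K₀ z → z ∈ K₀)
    (h : ∀ j, (A.val p ha₀ j₀)⁻¹ * A.val p ha₀ j ∈ K₀) :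
    ∃ p₀ : Spec (.of K₀) ⟶ X, Spec.map (CommRingCat.ofHom (algebraMap K₀ K)) ≫ p₀ = p := by
  have hT := A.top_le_preimage_locus p ha₀ hj₀.isUnit
  refine PolarizedDynamics.exists_specMap_comp_eq p (A.isAffineOpen j₀) hT _
    (algebraMap K₀ K).injective fun z => ?_
  have h1 : IsIntegral K₀ (ev p (A.locus j₀) hT z) :=
    A.isIntegral_ev s p hp ha₀ hj₀ K₀.toSubalgebra h hT z
  exact ⟨⟨_, hK₀ _ h1.isAlgebraic⟩, rfl⟩

end Fields

end AffineSections

/-! ### From algebraic independence to linear disjointness over an algebraically closed field. -/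

section LinearDisjointness

open TensorProduct

variable {k : Type*} [Field k]

lemma isAlgebraic_adjoin_image_iff {A B : Type*} [CommRing A] [CommRing B] [Algebra k A]
    [Algebra k B] (g : A →ₐ[k] B) (hg : Function.Injective g) {s : Set A} {a : A} :
    IsAlgebraic (Algebra.adjoin k (g '' s)) (g a) ↔ IsAlgebraic (Algebra.adjoin k s) a := by
  rw [← AlgHom.map_adjoin]
  exact isAlgebraic_ringHom_iff_of_comp_eq
    (Subalgebra.equivMapOfInjective (Algebra.adjoin k s) g hg) g hg rfl

/-- `C₁ ⊗ C₂` is a domain, algebraic over the elements coming from `s` and `t`. These stay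
independent under multiplication into `K`, which is therefore injective. -/
lemma linearDisjoint_of_algebraicIndependent [IsAlgClosed k] {K : Type*} [Field K] [Algebra k K]
    (C₁ C₂ : Subalgebra k K) [Algebra.FiniteType k C₁] {s t : Set K} (hs : s ⊆ C₁) (ht : t ⊆ C₂)
    (h₁ : ∀ w ∈ C₁, IsAlgebraic (Algebra.adjoin k s) w)
    (h₂ : ∀ w ∈ C₂, IsAlgebraic (Algebra.adjoin k t) w)
    (hst : AlgebraicIndependent k (Sum.elim ((↑) : s → K) ((↑) : t → K))) :
    C₁.LinearDisjoint C₂ := by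
  rw [Subalgebra.linearDisjoint_iff_injective]
  have : IsDomain (C₁ ⊗[k] C₂) := isDomain_tensorProduct C₁ C₂
  let l : C₁ →ₐ[k] C₁ ⊗[k] C₂ := Algebra.TensorProduct.includeLeft
  let r : C₂ →ₐ[k] C₁ ⊗[k] C₂ := Algebra.TensorProduct.includeRight
  have hl : Function.Injective l :=
    Algebra.TensorProduct.includeLeft_injective (algebraMap k C₂).injective
  have hr : Function.Injective r :=
    Algebra.TensorProduct.includeRight_injective (algebraMap k C₁).injective
  let z : s ⊕ t → C₁ ⊗[k] C₂ := Sum.elim (fun i => l ⟨i, hs i.2⟩) (fun j => r ⟨j, ht j.2⟩)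
  have hsi : ((↑) : C₁ → K) '' (Set.range fun i : s => (⟨i, hs i.2⟩ : C₁)) = s := by
    rw [← Set.range_comp]
    exact Subtype.range_coe
  have hti : ((↑) : C₂ → K) '' (Set.range fun i : t => (⟨i, ht i.2⟩ : C₂)) = t := by
    rw [← Set.range_comp]
    exact Subtype.range_coe
  refine injective_of_algebraicIndependent_comp _ z ⟨fun x => ?_⟩ ?_
  · have hla : ∀ a, IsAlgebraic (Algebra.adjoin k (Set.range z)) (l a) := fun a => by
      have h := h₁ a a.2
      rw [← hsi] at h
      have h' := (isAlgebraic_adjoin_image_iff l hl).2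
        ((isAlgebraic_adjoin_image_iff C₁.val Subtype.val_injective).1 h)
      refine h'.tower_top_of_subalgebra_le (Algebra.adjoin_mono ?_)
      rintro _ ⟨_, ⟨i, rfl⟩, rfl⟩
      exact ⟨Sum.inl i, rfl⟩
    have hra : ∀ a, IsAlgebraic (Algebra.adjoin k (Set.range z)) (r a) := fun a => by
      have h := h₂ a a.2
      rw [← hti] at h
      have h' := (isAlgebraic_adjoin_image_iff r hr).2
        ((isAlgebraic_adjoin_image_iff C₂.val Subtype.val_injective).1 h)
      refine h'.tower_top_of_subalgebra_le (Algebra.adjoin_mono ?_)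
      rintro _ ⟨_, ⟨i, rfl⟩, rfl⟩
      exact ⟨Sum.inr i, rfl⟩
    induction x using TensorProduct.induction_on with
    | zero => exact isAlgebraic_zero
    | tmul a b =>
      have : a ⊗ₜ[k] b = l a * r b := by simp [l, r]
      rw [this]
      exact (hla a).mul (hra b)
    | add x y hx hy => exact hx.add hy
  · convert hst using 1
    ext (i | j) <;> simp [z, l, r]

lemma exists_comp_rangeRestrict_eq {A K E : Type*} [CommRing A] [CommRing K] [CommRing E]
    [Algebra k A] [Algebra k K] [Algebra k E] (e : A →ₐ[k] K) (ε : A →ₐ[k] E)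
    (h : ∀ a, e a = 0 → ε a = 0) : ∃ δ : e.range →ₐ[k] E, δ.comp e.rangeRestrict = ε :=
  ⟨AlgHom.liftOfSurjective e.rangeRestrict e.rangeRestrict_surjective ε
    fun a ha => h a (congrArg Subtype.val ha), AlgHom.liftOfSurjective_comp _ _ _ _⟩

/-- Linear disjointness leaves only the relations coming from each factor: `x` already vanishes in
the tensor product of the two images, and `ε₁`, `ε₂` factor through these images. -/
lemma productMap_eq_zero_of_linearDisjoint {A₁ A₂ K E : Type*} [CommRing A₁] [CommRing A₂]
    [Field K] [CommRing E] [Algebra k A₁] [Algebra k A₂] [Algebra k K] [Algebra k E]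
    (e₁ : A₁ →ₐ[k] K) (e₂ : A₂ →ₐ[k] K) (ε₁ : A₁ →ₐ[k] E) (ε₂ : A₂ →ₐ[k] E)
    (h₁ : ∀ a, e₁ a = 0 → ε₁ a = 0) (h₂ : ∀ a, e₂ a = 0 → ε₂ a = 0)
    (hd : e₁.range.LinearDisjoint e₂.range) {x : A₁ ⊗[k] A₂}
    (hx : Algebra.TensorProduct.productMap e₁ e₂ x = 0) :
    Algebra.TensorProduct.productMap ε₁ ε₂ x = 0 := by
  obtain ⟨δ₁, hδ₁⟩ := exists_comp_rangeRestrict_eq e₁ ε₁ h₁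
  obtain ⟨δ₂, hδ₂⟩ := exists_comp_rangeRestrict_eq e₂ ε₂ h₂
  set y := Algebra.TensorProduct.map e₁.rangeRestrict e₂.rangeRestrict x with hy
  have hy0 : y = 0 := by
    refine (Subalgebra.linearDisjoint_iff_injective.1 hd) ?_
    rw [map_zero, ← hx]
    have : (e₁.range.mulMap e₂.range).comp
        (Algebra.TensorProduct.map e₁.rangeRestrict e₂.rangeRestrict) =
        Algebra.TensorProduct.productMap e₁ e₂ := by
      ext <;> simp
    exact congrArg (fun f => f x) this
  have : (Algebra.TensorProduct.productMap δ₁ δ₂).comp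
      (Algebra.TensorProduct.map e₁.rangeRestrict e₂.rangeRestrict) =
      Algebra.TensorProduct.productMap ε₁ ε₂ := by
    subst hδ₁ hδ₂
    ext <;> simp
  rw [← this, AlgHom.comp_apply, ← hy, hy0, map_zero]

/-- A `k`-algebra homomorphism from a subalgebra `D` of a finitely generated field `K` to `K` is
injective if `K` is algebraic over its range. -/
lemma injective_of_isAlgebraic_range {K : Type*} [Field K] [Algebra k K]
    [Algebra.EssFiniteType k K] {D : Subalgebra k K} (θ : D →ₐ[k] K)
    (h : Algebra.IsAlgebraic θ.range K) : Function.Injective θ := by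
  have halg : Algebra.IsAlgebraic (Algebra.adjoin k (θ.range : Set K)) K := by
    rwa [Algebra.adjoin_eq]
  -- A transcendence basis of `K` inside the range lifts to `D`. The lifts are independent and as
  -- many as the transcendence degree of `K`, so `D` is algebraic over them.
  obtain ⟨u, hu, hb⟩ := exists_isTranscendenceBasis_subset (R := k) (θ.range : Set K)
  choose z hz using fun i : u => hu i.2
  have hzu : θ ∘ z = ((↑) : u → K) := funext hz
  have hind : AlgebraicIndependent k (θ ∘ z) := hzu ▸ hb.1
  have hzK : AlgebraicIndependent k (D.val ∘ z) :=
    (hind.of_comp θ).map' Subtype.val_injective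
  have hbz := hzK.isTranscendenceBasis_of_trdeg_le (trdeg_lt_aleph0 k K) hb.cardinalMk_eq_trdeg.ge
  refine injective_of_algebraicIndependent_comp θ z ⟨fun a => ?_⟩ hind
  have h1 := hbz.isAlgebraic.isAlgebraic (D.val a)
  rw [Set.range_comp] at h1
  exact (isAlgebraic_adjoin_image_iff D.val Subtype.val_injective).1 h1

end LinearDisjointness

/-! ### Residue fields of points and algebras of functions over `k`. -/

section Points

/-- `p` identifies `Spec K` with the spectrum of the residue field of `ζ`. -/
structure IsPoint {P : Scheme.{u}} {K : Type u} [Field K] (p : Spec (.of K) ⟶ P) (ζ : P) :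
    Prop where
  mono : Mono p
  apply_closedPoint : p (IsLocalRing.closedPoint K) = ζ
  exists_factor : ∀ (E : Type u) [Field E] (r : Spec (.of E) ⟶ P),
    r (IsLocalRing.closedPoint E) = ζ → ∃ φ : K →+* E, Spec.map (CommRingCat.ofHom φ) ≫ p = r

lemma exists_isPoint {P : Scheme.{u}} (ζ : P) :
    ∃ (K : Type u) (_ : Field K) (p : Spec (.of K) ⟶ P), IsPoint p ζ := by
  refine ⟨P.residueField ζ, inferInstance, P.fromSpecResidueField ζ, ?_, ?_, ?_⟩
  · change Mono (P.fromSpecResidueField ζ)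
    infer_instance
  · exact P.fromSpecResidueField_apply ζ _
  · intro E _ r hr
    subst hr
    exact ⟨(Scheme.descResidueField (Scheme.stalkClosedPointTo r)).hom,
      Scheme.descResidueField_stalkClosedPointTo_fromSpecResidueField E P r⟩

lemma ev_eq_zero_iff {X : Scheme.{u}} {K : Type u} [Field K] (p : Spec (.of K) ⟶ X) {U : X.Opens}
    (hU : ⊤ ≤ p ⁻¹ᵁ U) (a : Γ(X, U)) :
    ev p U hU a = 0 ↔ p (IsLocalRing.closedPoint K) ∉ X.basicOpen a := by
  rw [← top_le_preimage_iff, top_le_preimage_basicOpen_iff p U hU, isUnit_iff_ne_zero, not_not]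

variable {k : Type u} [Field k]

lemma specMap_ofHom_injective {R S : Type u} [CommRing R] [CommRing S] {φ ψ : R →+* S}
    (h : Spec.map (CommRingCat.ofHom φ) = Spec.map (CommRingCat.ofHom ψ)) : φ = ψ :=
  congrArg CommRingCat.Hom.hom (Spec.map_injective h)

lemma exists_isPoint_over {P : Scheme.{u}} (s : P ⟶ Spec (.of k)) (ζ : P) :
    ∃ (K : Type u) (_ : Field K) (_ : Algebra k K) (p : Spec (.of K) ⟶ P), IsPoint p ζ ∧
      p ≫ s = Spec.map (CommRingCat.ofHom (algebraMap k K)) := by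
  obtain ⟨K, _, p, hp⟩ := exists_isPoint ζ
  let _ : Algebra k K := (Spec.preimage (p ≫ s)).hom.toAlgebra
  exact ⟨K, inferInstance, inferInstance, p, hp, (Spec.map_preimage (p ≫ s)).symm⟩

section Structure

variable {X : Scheme.{u}} (s : X ⟶ Spec (.of k)) (U : X.Opens)

/-- The structure map `k → Γ(X, U)` of a `k`-scheme. -/
def structMap : k →+* Γ(X, U) :=
  (s.appLE ⊤ U le_top).hom.comp (Scheme.ΓSpecIso (.of k)).inv.hom

/-- The functions on an open subset of a `k`-scheme, as a `k`-algebra. -/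
def Sections (_ : X ⟶ Spec (.of k)) (U : X.Opens) : Type u := Γ(X, U)

instance : CommRing (Sections s U) := inferInstanceAs (CommRing Γ(X, U))

instance : Algebra k (Sections s U) := (structMap s U).toAlgebra

lemma finiteType_sections [LocallyOfFiniteType s] (hU : IsAffineOpen U) :
    Algebra.FiniteType k (Sections s U) := by
  have h1 : (s.appLE ⊤ U le_top).hom.FiniteType :=
    s.finiteType_appLE (isAffineOpen_top _) hU _
  exact h1.comp (RingHom.FiniteType.of_surjective _
    (Scheme.ΓSpecIso (.of k)).symm.commRingCatIsoToRingEquiv.surjective)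

variable {R : Type u} [CommRing R] [Algebra k R] (p : Spec (.of R) ⟶ X)

/-- Evaluation at an `R`-point over `k`, as a homomorphism of `k`-algebras. -/
def evAlgHom (hp : p ≫ s = Spec.map (CommRingCat.ofHom (algebraMap k R)))
    (hU : ⊤ ≤ p ⁻¹ᵁ U) : Sections s U →ₐ[k] R where
  __ := ev p U hU
  commutes' c := by
    have h1 : s.appLE ⊤ U le_top ≫ p.appLE U ⊤ hU = (p ≫ s).appLE ⊤ ⊤ le_top :=
      Scheme.Hom.appLE_comp_appLE ..
    have h2 : (Scheme.ΓSpecIso (.of k)).inv ≫ (p ≫ s).appLE ⊤ ⊤ le_top ≫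
        (Scheme.ΓSpecIso (.of R)).hom = CommRingCat.ofHom (algebraMap k R) := by
      have h3 : (p ≫ s).appLE ⊤ ⊤ le_top =
          (Spec.map (CommRingCat.ofHom (algebraMap k R))).appTop := by
        rw [hp]
        exact (Scheme.Hom.app_eq_appLE _).symm
      rw [h3, Scheme.ΓSpecIso_naturality, Iso.inv_hom_id_assoc]
    rw [← h1] at h2
    exact congrArg (fun f => f.hom c) h2

/-- A function that vanishes at a point vanishes at its specializations. -/
lemma ker_evAlgHom_le {K E : Type u} [Field K] [Field E] [Algebra k K] [Algebra k E]
    {p : Spec (.of K) ⟶ X} {r : Spec (.of E) ⟶ X} {U}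
    (hp : p ≫ s = Spec.map (CommRingCat.ofHom (algebraMap k K)))
    (hr : r ≫ s = Spec.map (CommRingCat.ofHom (algebraMap k E)))
    (hpU : ⊤ ≤ p ⁻¹ᵁ U) (hrU : ⊤ ≤ r ⁻¹ᵁ U)
    (h : p (IsLocalRing.closedPoint K) ⤳ r (IsLocalRing.closedPoint E)) (a : Sections s U)
    (ha : evAlgHom s U p hp hpU a = 0) : evAlgHom s U r hr hrU a = 0 := by
  by_contra h1
  refine (ev_eq_zero_iff p hpU a).1 ha (h.mem_open (X.basicOpen _).isOpen ?_)
  by_contra h2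
  exact h1 ((ev_eq_zero_iff r hrU a).2 h2)

variable {U} in
/-- The inclusion of an affine open subset. -/
def sectionsSpec (hU : IsAffineOpen U) : Spec (.of (Sections s U)) ⟶ X := hU.fromSpec

variable {U} in
lemma specMap_evAlgHom_sectionsSpec (hp : p ≫ s = Spec.map (CommRingCat.ofHom (algebraMap k R)))
    (hpU : ⊤ ≤ p ⁻¹ᵁ U) (hU : IsAffineOpen U) :
    Spec.map (CommRingCat.ofHom (evAlgHom s U p hp hpU : Sections s U →+* R)) ≫
      sectionsSpec s hU = p :=
  specMap_ev_fromSpec p hU hpU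

variable {U} in
lemma sectionsSpec_comp (hU : IsAffineOpen U) :
    sectionsSpec s hU ≫ s = Spec.map (CommRingCat.ofHom (algebraMap k (Sections s U))) := by
  have h1 := IsAffineOpen.SpecMap_appLE_fromSpec s (isAffineOpen_top (Spec (.of k))) hU le_top
  rw [IsAffineOpen.fromSpec_top, Scheme.isoSpec_Spec_inv] at h1
  refine h1.symm.trans ?_
  rw [← Spec.map_comp]
  rfl

end Structure

namespace IsPoint

variable {X : Scheme.{u}} {s : X ⟶ Spec (.of k)} {K : Type u} [Field K] [Algebra k K]
  {p : Spec (.of K) ⟶ X} {ζ : X}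

lemma exists_algHom (h : IsPoint p ζ)
    (hp : p ≫ s = Spec.map (CommRingCat.ofHom (algebraMap k K))) {E : Type u} [Field E]
    [Algebra k E] (r : Spec (.of E) ⟶ X)
    (hr : r ≫ s = Spec.map (CommRingCat.ofHom (algebraMap k E)))
    (hζ : r (IsLocalRing.closedPoint E) = ζ) :
    ∃ φ : K →ₐ[k] E, Spec.map (CommRingCat.ofHom (φ : K →+* E)) ≫ p = r := by
  obtain ⟨φ, hφ⟩ := h.exists_factor E r hζ
  refine ⟨{ φ with commutes' := fun c => ?_ }, hφ⟩
  have h1 : φ.comp (algebraMap k K) = algebraMap k E := by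
    apply specMap_ofHom_injective
    rw [← hr, ← hφ, Category.assoc, hp, ← Spec.map_comp]
    rfl
  exact congrArg (fun f => f c) h1

/-- The residue field is the smallest field of definition of its point: a descent of `p` to `K₀` has
the same image point, so `p` factors back through it, and `p` being a monomorphism makes the
composite `K → K₀ → K` the identity. -/
lemma eq_top (h : IsPoint p ζ) (K₀ : IntermediateField k K) (p₀ : Spec (.of K₀) ⟶ X)
    (hp₀ : Spec.map (CommRingCat.ofHom (algebraMap K₀ K)) ≫ p₀ = p) : K₀ = ⊤ := by
  have h1 : p₀ (IsLocalRing.closedPoint K₀) = ζ := by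
    rw [← h.apply_closedPoint, ← hp₀]
    exact congrArg p₀ (Subsingleton.elim (α := PrimeSpectrum K₀) _ _)
  obtain ⟨φ, hφ⟩ := h.exists_factor K₀ p₀ h1
  have := h.mono
  have h2 : (algebraMap K₀ K).comp φ = RingHom.id K := by
    apply specMap_ofHom_injective
    rw [← cancel_mono p, CommRingCat.ofHom_comp, Spec.map_comp, Category.assoc, hφ, hp₀]
    exact (Category.id_comp p).symm.trans (congrArg (· ≫ p) (Spec.map_id _).symm)
  rw [eq_top_iff]
  intro z _
  have h3 : algebraMap K₀ K (φ z) = z := congrArg (fun f => f z) h2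
  rw [← h3]
  exact (φ z).2

lemma adjoin_range_ev_eq_top (h : IsPoint p ζ) {U : X.Opens} (hU : IsAffineOpen U)
    (hpU : ⊤ ≤ p ⁻¹ᵁ U) : IntermediateField.adjoin k (Set.range (ev p U hpU)) = ⊤ := by
  obtain ⟨p₀, hp₀⟩ := exists_specMap_comp_eq p hU hpU
    (algebraMap (IntermediateField.adjoin k (Set.range (ev p U hpU))) K)
    (RingHom.injective _) fun a =>
      ⟨⟨_, IntermediateField.subset_adjoin k _ ⟨a, rfl⟩⟩, rfl⟩
  exact h.eq_top _ p₀ hp₀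

lemma top_le_preimage (h : IsPoint p ζ) {U : X.Opens} : ⊤ ≤ p ⁻¹ᵁ U ↔ ζ ∈ U := by
  rw [top_le_preimage_iff, h.apply_closedPoint]

/-- The coordinates on an affine neighbourhood generate the residue field, and finitely many of them
suffice. -/
lemma essFiniteType [LocallyOfFiniteType s] (h : IsPoint p ζ)
    (hp : p ≫ s = Spec.map (CommRingCat.ofHom (algebraMap k K))) : Algebra.EssFiniteType k K := by
  obtain ⟨U, hU, hζU, -⟩ := exists_isAffineOpen_mem_and_subset (x := ζ) (U := ⊤) trivial
  have hpU := h.top_le_preimage.2 hζU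
  have h1 := h.adjoin_range_ev_eq_top (k := k) hU hpU
  have := finiteType_sections s U hU
  obtain ⟨F, hF⟩ := Algebra.FiniteType.out (R := k) (A := Sections s U)
  have h2 : Algebra.adjoin k (evAlgHom s U p hp hpU '' F) = (evAlgHom s U p hp hpU).range := by
    rw [← AlgHom.map_adjoin, hF, Algebra.map_top]
  have h3 : IntermediateField.adjoin k (evAlgHom s U p hp hpU '' F) = ⊤ := by
    rw [eq_top_iff, ← h1, IntermediateField.adjoin_le_iff]
    rintro _ ⟨a, rfl⟩
    have h4 : ev p U hpU a ∈ (evAlgHom s U p hp hpU).range := ⟨a, rfl⟩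
    rw [← h2] at h4
    exact IntermediateField.algebra_adjoin_le_adjoin k _ h4
  have h5 : (⊤ : IntermediateField k K).FG := by
    rw [← h3]
    exact IntermediateField.fg_adjoin_of_finite (F.finite_toSet.image _)
  exact IntermediateField.fg_top_iff.1 h5

end IsPoint

end Points

/-! ### Points of the product and their specializations. -/

section Product

open TensorProduct

variable {k : Type u} [Field k] {X₁ X₂ : Over (Spec (.of k))}

/-- The structure morphism of the product. -/
abbrev prodHom (X₁ X₂ : Over (Spec (.of k))) : prod X₁ X₂ ⟶ Spec (.of k) :=
  pullback.fst X₁.hom X₂.hom ≫ X₁.hom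

variable {K : Type u} [Field K] [Algebra k K] {p : Spec (.of K) ⟶ prod X₁ X₂}

lemma comp_fst_comp_hom (hp : p ≫ prodHom X₁ X₂ = Spec.map (CommRingCat.ofHom (algebraMap k K))) :
    (p ≫ pullback.fst X₁.hom X₂.hom) ≫ X₁.hom = Spec.map (CommRingCat.ofHom (algebraMap k K)) := by
  rw [← hp, Category.assoc]

lemma comp_snd_comp_hom (hp : p ≫ prodHom X₁ X₂ = Spec.map (CommRingCat.ofHom (algebraMap k K))) :
    (p ≫ pullback.snd X₁.hom X₂.hom) ≫ X₂.hom = Spec.map (CommRingCat.ofHom (algebraMap k K)) := by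
  rw [← hp, Category.assoc, ← pullback.condition]

/-- The descended projections agree over `Spec k`, since `K₀ → K` is injective and so a map `k → K₀`
is determined by its composite into `K`. -/
lemma exists_specMap_comp_eq_prod
    (hp : p ≫ prodHom X₁ X₂ = Spec.map (CommRingCat.ofHom (algebraMap k K)))
    {K₀ : IntermediateField k K} {r₁ : Spec (.of K₀) ⟶ X₁.left} {r₂ : Spec (.of K₀) ⟶ X₂.left}
    (h₁ : Spec.map (CommRingCat.ofHom (algebraMap K₀ K)) ≫ r₁ = p ≫ pullback.fst X₁.hom X₂.hom)
    (h₂ : Spec.map (CommRingCat.ofHom (algebraMap K₀ K)) ≫ r₂ = p ≫ pullback.snd X₁.hom X₂.hom) :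
    ∃ p₀ : Spec (.of K₀) ⟶ prod X₁ X₂, Spec.map (CommRingCat.ofHom (algebraMap K₀ K)) ≫ p₀ = p := by
  have key : ∀ r : Spec (.of K₀) ⟶ Spec (.of k),
      Spec.map (CommRingCat.ofHom (algebraMap K₀ K)) ≫ r =
        Spec.map (CommRingCat.ofHom (algebraMap k K)) →
      r = Spec.map (CommRingCat.ofHom (algebraMap k K₀)) := by
    intro r hr
    obtain ⟨φ, rfl⟩ := Spec.map_surjective r
    rw [← Spec.map_comp] at hr
    have h := Spec.map_injective hr
    congr 1
    ext c
    exact congrArg (fun f => f.hom c) h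
  have hw : r₁ ≫ X₁.hom = r₂ ≫ X₂.hom := by
    rw [key (r₁ ≫ X₁.hom), key (r₂ ≫ X₂.hom)]
    · rw [← Category.assoc, h₂, comp_snd_comp_hom hp]
    · rw [← Category.assoc, h₁, comp_fst_comp_hom hp]
  refine ⟨pullback.lift r₁ r₂ hw, ?_⟩
  apply pullback.hom_ext
  · rw [Category.assoc, pullback.lift_fst, h₁]
  · rw [Category.assoc, pullback.lift_snd, h₂]

/-- If the two projections of a point of a product are defined over fields which are algebraic over
independent sets, then every point whose projections are specializations of those projections is a
specialization of the point. -/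
lemma specializes_of_algebraicIndependent [IsAlgClosed k] [LocallyOfFiniteType X₁.hom]
    (hp : p ≫ prodHom X₁ X₂ = Spec.map (CommRingCat.ofHom (algebraMap k K)))
    {s t : Set K} (hsfin : s.Finite)
    (hst : AlgebraicIndependent k (Sum.elim ((↑) : s → K) ((↑) : t → K)))
    {K₁ K₂ : IntermediateField k K} (hs : s ⊆ K₁) (ht : t ⊆ K₂)
    (hK₁ : ∀ w ∈ K₁, IsAlgebraic (Algebra.adjoin k s) w)
    (hK₂ : ∀ w ∈ K₂, IsAlgebraic (Algebra.adjoin k t) w)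
    {r₁ : Spec (.of K₁) ⟶ X₁.left} {r₂ : Spec (.of K₂) ⟶ X₂.left}
    (h₁ : Spec.map (CommRingCat.ofHom (algebraMap K₁ K)) ≫ r₁ = p ≫ pullback.fst X₁.hom X₂.hom)
    (h₂ : Spec.map (CommRingCat.ofHom (algebraMap K₂ K)) ≫ r₂ = p ≫ pullback.snd X₁.hom X₂.hom)
    {z : prod X₁ X₂}
    (hz₁ : pullback.fst X₁.hom X₂.hom (p (IsLocalRing.closedPoint K)) ⤳
      pullback.fst X₁.hom X₂.hom z)
    (hz₂ : pullback.snd X₁.hom X₂.hom (p (IsLocalRing.closedPoint K)) ⤳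
      pullback.snd X₁.hom X₂.hom z) :
    p (IsLocalRing.closedPoint K) ⤳ z := by
  obtain ⟨E, _, _, r, hrz, hr⟩ := exists_isPoint_over (prodHom X₁ X₂) z
  have hrE := hrz.apply_closedPoint
  obtain ⟨T₁, hT₁, hzT₁, -⟩ := exists_isAffineOpen_mem_and_subset
    (x := pullback.fst X₁.hom X₂.hom z) (U := ⊤) trivial
  obtain ⟨T₂, hT₂, hzT₂, -⟩ := exists_isAffineOpen_mem_and_subset
    (x := pullback.snd X₁.hom X₂.hom z) (U := ⊤) trivial
  have hpT₁ : ⊤ ≤ (p ≫ pullback.fst X₁.hom X₂.hom) ⁻¹ᵁ T₁ :=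
    (top_le_preimage_iff _ _).2 (hz₁.mem_open T₁.isOpen hzT₁)
  have hpT₂ : ⊤ ≤ (p ≫ pullback.snd X₁.hom X₂.hom) ⁻¹ᵁ T₂ :=
    (top_le_preimage_iff _ _).2 (hz₂.mem_open T₂.isOpen hzT₂)
  have hrT₁ : ⊤ ≤ (r ≫ pullback.fst X₁.hom X₂.hom) ⁻¹ᵁ T₁ :=
    (top_le_preimage_iff _ _).2 (show pullback.fst X₁.hom X₂.hom (r _) ∈ T₁ by rwa [hrE])
  have hrT₂ : ⊤ ≤ (r ≫ pullback.snd X₁.hom X₂.hom) ⁻¹ᵁ T₂ :=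
    (top_le_preimage_iff _ _).2 (show pullback.snd X₁.hom X₂.hom (r _) ∈ T₂ by rwa [hrE])
  let e₁ := evAlgHom X₁.hom T₁ _ (comp_fst_comp_hom hp) hpT₁
  let e₂ := evAlgHom X₂.hom T₂ _ (comp_snd_comp_hom hp) hpT₂
  let ε₁ := evAlgHom X₁.hom T₁ _ (comp_fst_comp_hom hr) hrT₁
  let ε₂ := evAlgHom X₂.hom T₂ _ (comp_snd_comp_hom hr) hrT₂
  have hker₁ : ∀ a, e₁ a = 0 → ε₁ a = 0 := by
    refine ker_evAlgHom_le _ _ _ _ _ ?_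
    change pullback.fst X₁.hom X₂.hom (p _) ⤳ pullback.fst X₁.hom X₂.hom (r _)
    rwa [hrE]
  have hker₂ : ∀ a, e₂ a = 0 → ε₂ a = 0 := by
    refine ker_evAlgHom_le _ _ _ _ _ ?_
    change pullback.snd X₁.hom X₂.hom (p _) ⤳ pullback.snd X₁.hom X₂.hom (r _)
    rwa [hrE]
  have he₁ : e₁.range ≤ K₁.toSubalgebra := by
    rintro _ ⟨a, rfl⟩
    have h3 := ev_specMap (algebraMap K₁ K) r₁ h₁ T₁
      ((top_le_preimage_iff _ _).2 <| by
        have h4 := (top_le_preimage_iff _ _).1 hpT₁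
        rw [← h₁] at h4
        exact (congrArg r₁ (Subsingleton.elim (α := PrimeSpectrum K₁) _ _)).symm ▸ h4) hpT₁ a
    exact h3 ▸ Subtype.property _
  have he₂ : e₂.range ≤ K₂.toSubalgebra := by
    rintro _ ⟨a, rfl⟩
    have h3 := ev_specMap (algebraMap K₂ K) r₂ h₂ T₂
      ((top_le_preimage_iff _ _).2 <| by
        have h4 := (top_le_preimage_iff _ _).1 hpT₂
        rw [← h₂] at h4
        exact (congrArg r₂ (Subsingleton.elim (α := PrimeSpectrum K₂) _ _)).symm ▸ h4) hpT₂ a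
    exact h3 ▸ Subtype.property _
  have hd : e₁.range.LinearDisjoint e₂.range := by
    have hft := finiteType_sections X₁.hom T₁ hT₁
    -- The first factor must be of finite type and contain `s`, so `s` is adjoined to the coordinate
    -- ring; disjointness is then restricted to the smaller rings.
    have hfg : (e₁.range ⊔ Algebra.adjoin k s).FG := by
      refine Subalgebra.FG.sup ?_ (Subalgebra.fg_def.2 ⟨s, hsfin, rfl⟩)
      rw [← Algebra.map_top]
      exact hft.out.map e₁
    have : Algebra.FiniteType k ↥(e₁.range ⊔ Algebra.adjoin k s) :=
      (Subalgebra.fg_iff_finiteType _).1 hfg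
    have h3 := linearDisjoint_of_algebraicIndependent (e₁.range ⊔ Algebra.adjoin k s)
      K₂.toSubalgebra (Algebra.subset_adjoin.trans (SetLike.coe_subset_coe.2 le_sup_right)) ht
      (fun w hw => hK₁ w (sup_le he₁ (Algebra.adjoin_le hs) hw)) hK₂ hst
    exact (h3.of_le_left_of_flat le_sup_left).of_le_right_of_flat he₂
  have hw : Spec.map (CommRingCat.ofHom (Algebra.TensorProduct.includeLeft :
        Sections X₁.hom T₁ →ₐ[k] Sections X₁.hom T₁ ⊗[k] Sections X₂.hom T₂).toRingHom) ≫
        sectionsSpec X₁.hom hT₁ ≫ X₁.hom =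
      Spec.map (CommRingCat.ofHom (Algebra.TensorProduct.includeRight :
        Sections X₂.hom T₂ →ₐ[k] Sections X₁.hom T₁ ⊗[k] Sections X₂.hom T₂).toRingHom) ≫
        sectionsSpec X₂.hom hT₂ ≫ X₂.hom := by
    rw [sectionsSpec_comp, sectionsSpec_comp, ← Spec.map_comp, ← Spec.map_comp,
      ← CommRingCat.ofHom_comp, ← CommRingCat.ofHom_comp]
    congr 2
    ext c
    exact ((Algebra.TensorProduct.includeLeft :
      Sections X₁.hom T₁ →ₐ[k] Sections X₁.hom T₁ ⊗[k] Sections X₂.hom T₂).commutes c).trans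
      ((Algebra.TensorProduct.includeRight :
      Sections X₂.hom T₂ →ₐ[k] Sections X₁.hom T₁ ⊗[k] Sections X₂.hom T₂).commutes c).symm
  rw [← Category.assoc, ← Category.assoc] at hw
  -- Both `p` and `r` factor through the affine chart `Spec (A₁ ⊗ A₂)`, so the specialization
  -- reduces to an inclusion of kernels of product maps.
  let g := pullback.lift _ _ hw
  have hg : ∀ {F : Type u} [Field F] [Algebra k F] (m : Spec (.of F) ⟶ prod X₁ X₂)
      (hm : m ≫ prodHom X₁ X₂ = Spec.map (CommRingCat.ofHom (algebraMap k F)))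
      (hm₁ : ⊤ ≤ (m ≫ pullback.fst X₁.hom X₂.hom) ⁻¹ᵁ T₁)
      (hm₂ : ⊤ ≤ (m ≫ pullback.snd X₁.hom X₂.hom) ⁻¹ᵁ T₂),
      Spec.map (CommRingCat.ofHom (Algebra.TensorProduct.productMap
        (evAlgHom X₁.hom T₁ _ (comp_fst_comp_hom hm) hm₁)
        (evAlgHom X₂.hom T₂ _ (comp_snd_comp_hom hm) hm₂)).toRingHom) ≫ g = m := by
    intro F _ _ m hm hm₁ hm₂
    apply pullback.hom_ext
    · rw [Category.assoc, pullback.lift_fst, ← Category.assoc, ← Spec.map_comp,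
        ← CommRingCat.ofHom_comp]
      refine Eq.trans ?_ (specMap_evAlgHom_sectionsSpec X₁.hom _ (comp_fst_comp_hom hm) hm₁ hT₁)
      congr 3
      exact congrArg AlgHom.toRingHom (Algebra.TensorProduct.productMap_left _ _)
    · rw [Category.assoc, pullback.lift_snd, ← Category.assoc, ← Spec.map_comp,
        ← CommRingCat.ofHom_comp]
      refine Eq.trans ?_ (specMap_evAlgHom_sectionsSpec X₂.hom _ (comp_snd_comp_hom hm) hm₂ hT₂)
      congr 3
      exact congrArg AlgHom.toRingHom (Algebra.TensorProduct.productMap_right _ _)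
  have hsp : PrimeSpectrum.comap (Algebra.TensorProduct.productMap e₁ e₂).toRingHom
      (IsLocalRing.closedPoint K) ⤳ PrimeSpectrum.comap
        (Algebra.TensorProduct.productMap ε₁ ε₂).toRingHom (IsLocalRing.closedPoint E) := by
    rw [← PrimeSpectrum.le_iff_specializes]
    intro x hx
    have hx' : Algebra.TensorProduct.productMap e₁ e₂ x = 0 := by
      have : Algebra.TensorProduct.productMap e₁ e₂ x ∈ IsLocalRing.maximalIdeal K := hx
      rwa [IsLocalRing.maximalIdeal_eq_bot, Ideal.mem_bot] at this
    have h3 : Algebra.TensorProduct.productMap ε₁ ε₂ x ∈ IsLocalRing.maximalIdeal E := by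
      rw [productMap_eq_zero_of_linearDisjoint e₁ e₂ ε₁ ε₂ hker₁ hker₂ hd hx']
      exact Ideal.zero_mem _
    exact h3
  have h3 := hsp.map g.continuous
  have h4 := congrArg (fun m : Spec (.of K) ⟶ prod X₁ X₂ => m (IsLocalRing.closedPoint K))
    (hg p hp hpT₁ hpT₂)
  have h5 := congrArg (fun m : Spec (.of E) ⟶ prod X₁ X₂ => m (IsLocalRing.closedPoint E))
    (hg r hr hrT₁ hrT₂)
  rw [← hrE, ← h4, ← h5]
  exact h3

end Product

/-! ### Relative algebraic closure. -/

section RelativeClosure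

variable {k K : Type*} [Field k] [Field K] [Algebra k K]

/-- The algebraic closure in `K` of an intermediate field. -/
def relClosure (E : IntermediateField k K) : IntermediateField k K :=
  (algebraicClosure E K).restrictScalars k

lemma mem_relClosure_iff {E : IntermediateField k K} {z : K} :
    z ∈ relClosure E ↔ IsAlgebraic E z :=
  mem_algebraicClosure_iff

lemma mem_relClosure_of_isAlgebraic {E : IntermediateField k K} {z : K}
    (h : IsAlgebraic (relClosure E) z) : z ∈ relClosure E := by
  have h' : IsAlgebraic (algebraicClosure E K) z := h
  exact mem_relClosure_iff.2 (h'.restrictScalars E)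

open scoped IntermediateField.algebraAdjoinAdjoin in
lemma isAlgebraic_adjoin_iff {S : Set K} {z : K} :
    IsAlgebraic (IntermediateField.adjoin k S) z ↔ IsAlgebraic (Algebra.adjoin k S) z :=
  (IsFractionRing.isAlgebraic_iff (Algebra.adjoin k S) (IntermediateField.adjoin k S) K).symm

end RelativeClosure

/-! ### The generic point of a periodic subvariety is fixed. -/

section GenericPoint

variable {k : Type u} [Field k]

/-- If a point and its image under a polarized endomorphism have values in `K` and in `K'`, then the
values at the point are algebraic over `K'`. -/
lemma AffineSections.isAlgebraic_fieldRange {X : Scheme.{u}} {L : LineBundle X}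
    (A : AffineSections L) (s : X ⟶ Spec (.of k)) [IsProper s] {K K' : Type u} [Field K] [Field K']
    [Algebra k K] [Algebra k K'] {p : Spec (.of K) ⟶ X} {p' : Spec (.of K') ⟶ X}
    (hp : p ≫ s = Spec.map (CommRingCat.ofHom (algebraMap k K))) {f : X ⟶ X} {q : ℕ}
    (hf : L.Scales f q) (hq : q ≠ 0) (ψ : K' →ₐ[k] K)
    (hψ : Spec.map (CommRingCat.ofHom (ψ : K' →+* K)) ≫ p' = p ≫ f) {a₀ : L.ι}
    (ha₀ : ⊤ ≤ p ⁻¹ᵁ L.U a₀) {j₀ : A.J} (hj₀ : A.val p ha₀ j₀ ≠ 0) (j : A.J) :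
    IsAlgebraic ψ.fieldRange ((A.val p ha₀ j₀)⁻¹ * A.val p ha₀ j) := by
  obtain ⟨i₀, hi₀⟩ := L.exists_top_le_preimage_U p'
  have hi₀' := top_le_preimage_specMap (ψ : K' →+* K) p' hψ hi₀
  obtain ⟨l, hl⟩ := A.exists_val_ne_zero (p ≫ f) hi₀'
  obtain ⟨η, hη, H⟩ := A.exists_generates s p hp hf rfl ha₀ hi₀'
  refine isAlgebraic_ratio hj₀ hl hq hη H ψ.fieldRange (fun i => ?_) j
  rw [A.val_specMap p' _ hψ hi₀ hi₀', A.val_specMap p' _ hψ hi₀ hi₀']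
  exact ⟨_, map_div₀ ψ _ _⟩

variable {X₁ X₂ : Over (Spec (.of k))} [IsProper X₁.hom] [IsProper X₂.hom]
  {L₁ : LineBundle X₁.left} {L₂ : LineBundle X₂.left} (A₁ : AffineSections L₁)
  (A₂ : AffineSections L₂) {K : Type u} [Field K] [Algebra k K] {p : Spec (.of K) ⟶ prod X₁ X₂}
  {ζ : prod X₁ X₂}

/-- Both projections descend to the algebraic closure of `E` in `K`, hence so does `p`. As `K` is
the residue field, that closure is all of `K`. -/
lemma IsPoint.isAlgebraic_of_ratios (h : IsPoint p ζ)
    (hp : p ≫ prodHom X₁ X₂ = Spec.map (CommRingCat.ofHom (algebraMap k K)))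
    {a₁ : L₁.ι} {a₂ : L₂.ι} (ha₁ : ⊤ ≤ (p ≫ pullback.fst X₁.hom X₂.hom) ⁻¹ᵁ L₁.U a₁)
    (ha₂ : ⊤ ≤ (p ≫ pullback.snd X₁.hom X₂.hom) ⁻¹ᵁ L₂.U a₂) {j₁ : A₁.J} {j₂ : A₂.J}
    (hj₁ : A₁.val _ ha₁ j₁ ≠ 0) (hj₂ : A₂.val _ ha₂ j₂ ≠ 0) (E : IntermediateField k K)
    (h₁ : ∀ j, IsAlgebraic E ((A₁.val _ ha₁ j₁)⁻¹ * A₁.val _ ha₁ j))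
    (h₂ : ∀ j, IsAlgebraic E ((A₂.val _ ha₂ j₂)⁻¹ * A₂.val _ ha₂ j)) :
    Algebra.IsAlgebraic E K := by
  obtain ⟨r₁, hr₁⟩ := A₁.exists_specMap_comp_eq X₁.hom _ (comp_fst_comp_hom hp) ha₁ hj₁
    (relClosure E) (fun _ => mem_relClosure_of_isAlgebraic) fun j => mem_relClosure_iff.2 (h₁ j)
  obtain ⟨r₂, hr₂⟩ := A₂.exists_specMap_comp_eq X₂.hom _ (comp_snd_comp_hom hp) ha₂ hj₂
    (relClosure E) (fun _ => mem_relClosure_of_isAlgebraic) fun j => mem_relClosure_iff.2 (h₂ j)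
  obtain ⟨p₀, hp₀⟩ := exists_specMap_comp_eq_prod hp hr₁ hr₂
  have htop := h.eq_top _ p₀ hp₀
  exact ⟨fun z => mem_relClosure_iff.1 (htop ▸ IntermediateField.mem_top)⟩

/-- A product of polarized endomorphisms does not map a point to a proper specialization. -/
lemma apply_eq_of_specializes (A₁ : AffineSections L₁) (A₂ : AffineSections L₂)
    (F : prod X₁ X₂ ⟶ prod X₁ X₂) {f₁ : X₁.left ⟶ X₁.left}
    {f₂ : X₂.left ⟶ X₂.left}
    (hF₁ : F ≫ pullback.fst X₁.hom X₂.hom = pullback.fst X₁.hom X₂.hom ≫ f₁)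
    (hF₂ : F ≫ pullback.snd X₁.hom X₂.hom = pullback.snd X₁.hom X₂.hom ≫ f₂)
    (hf₁ : f₁ ≫ X₁.hom = X₁.hom) {q₁ q₂ : ℕ} (hL₁ : L₁.Scales f₁ q₁) (hL₂ : L₂.Scales f₂ q₂)
    (hq₁ : q₁ ≠ 0) (hq₂ : q₂ ≠ 0) (hζ : ζ ⤳ F ζ) : F ζ = ζ := by
  obtain ⟨K, _, _, p, hpζ, hp⟩ := exists_isPoint_over (prodHom X₁ X₂) ζ
  obtain ⟨K', _, _, p', hpζ', hp'⟩ := exists_isPoint_over (prodHom X₁ X₂) (F ζ)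
  have hFp : (p ≫ F) ≫ prodHom X₁ X₂ = Spec.map (CommRingCat.ofHom (algebraMap k K)) := by
    rw [← hp, Category.assoc, prodHom, ← Category.assoc F, hF₁, Category.assoc, hf₁]
  obtain ⟨ψ, hψ⟩ := hpζ'.exists_algHom hp' (p ≫ F) hFp
    (congrArg F hpζ.apply_closedPoint)
  have hψ₁ : Spec.map (CommRingCat.ofHom (ψ : K' →+* K)) ≫ p' ≫ pullback.fst X₁.hom X₂.hom =
      (p ≫ pullback.fst X₁.hom X₂.hom) ≫ f₁ := by
    rw [← Category.assoc, hψ, Category.assoc, hF₁, Category.assoc]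
  have hψ₂ : Spec.map (CommRingCat.ofHom (ψ : K' →+* K)) ≫ p' ≫ pullback.snd X₁.hom X₂.hom =
      (p ≫ pullback.snd X₁.hom X₂.hom) ≫ f₂ := by
    rw [← Category.assoc, hψ, Category.assoc, hF₂, Category.assoc]
  obtain ⟨a₁, ha₁⟩ := L₁.exists_top_le_preimage_U (p ≫ pullback.fst X₁.hom X₂.hom)
  obtain ⟨a₂, ha₂⟩ := L₂.exists_top_le_preimage_U (p ≫ pullback.snd X₁.hom X₂.hom)
  obtain ⟨j₁, hj₁⟩ := A₁.exists_val_ne_zero _ ha₁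
  obtain ⟨j₂, hj₂⟩ := A₂.exists_val_ne_zero _ ha₂
  have halg : Algebra.IsAlgebraic ψ.fieldRange K :=
    hpζ.isAlgebraic_of_ratios A₁ A₂ hp ha₁ ha₂ hj₁ hj₂ _
      (A₁.isAlgebraic_fieldRange X₁.hom (comp_fst_comp_hom hp) hL₁ hq₁ ψ hψ₁ ha₁ hj₁)
      (A₂.isAlgebraic_fieldRange X₂.hom (comp_snd_comp_hom hp) hL₂ hq₂ ψ hψ₂ ha₂ hj₂)
  obtain ⟨U, hU, hζU', -⟩ := exists_isAffineOpen_mem_and_subset (x := F ζ) (U := ⊤) trivial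
  have hpU := hpζ.top_le_preimage.2 (hζ.mem_open U.isOpen hζU')
  have hpU' := hpζ'.top_le_preimage.2 hζU'
  let e := evAlgHom (prodHom X₁ X₂) U p hp hpU
  let e' := evAlgHom (prodHom X₁ X₂) U p' hp' hpU'
  obtain ⟨δ, hδ⟩ := exists_comp_rangeRestrict_eq e e' (ker_evAlgHom_le _ hp hp' hpU hpU'
    (by rwa [hpζ.apply_closedPoint, hpζ'.apply_closedPoint]))
  have := hpζ.essFiniteType hp
  have hrange : ((ψ.comp δ).range : Set K) = ψ '' Set.range (ev p' U hpU') := by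
    ext z
    constructor
    · rintro ⟨⟨_, a, rfl⟩, rfl⟩
      exact ⟨_, ⟨a, rfl⟩, congrArg ψ (congrArg (fun f => f a) hδ).symm⟩
    · rintro ⟨_, ⟨a, rfl⟩, rfl⟩
      exact ⟨e.rangeRestrict a, congrArg ψ (congrArg (fun f => f a) hδ)⟩
  -- `δ` sends the coordinate ring of the closure of `ζ` to that of the closure of `F ζ`, and `K` is
  -- algebraic over the image. A proper specialization would lower the transcendence degree.
  have hθ : Function.Injective (ψ.comp δ) := by
    apply injective_of_isAlgebraic_range
    refine ⟨fun z => ?_⟩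
    have h1 : IntermediateField.adjoin k ((ψ.comp δ).range : Set K) = ψ.fieldRange := by
      rw [hrange, ← IntermediateField.adjoin_map, hpζ'.adjoin_range_ev_eq_top hU hpU',
        AlgHom.fieldRange_eq_map]
    have h2 := halg.isAlgebraic z
    rw [← h1, isAlgebraic_adjoin_iff, Algebra.adjoin_eq] at h2
    exact h2
  -- Injectivity says that a function vanishing at `F ζ` vanishes at `ζ`, so `F ζ` specializes back
  -- to `ζ`.
  refine (Specializes.antisymm ?_ hζ).eq
  rw [specializes_iff_forall_open]
  intro O hO hζO
  obtain ⟨a, haO, hζa⟩ := hU.exists_basicOpen_le (V := ⟨O, hO⟩) ⟨ζ, hζO⟩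
    (hζ.mem_open U.isOpen hζU')
  apply haO
  by_contra h1
  rw [← hpζ'.apply_closedPoint, ← ev_eq_zero_iff p' hpU'] at h1
  refine (ev_eq_zero_iff p hpU a).1 ?_ (by rwa [hpζ.apply_closedPoint])
  have h2 : (ψ.comp δ) (e.rangeRestrict a) = 0 := by
    have h3 : δ (e.rangeRestrict a) = ev p' U hpU' a := congrArg (fun f => f a) hδ
    rw [AlgHom.comp_apply, h3, h1, map_zero]
  exact congrArg Subtype.val ((map_eq_zero_iff _ hθ).1 h2)

end GenericPoint

/-! ### Genericity of the fixed point and the main theorem. -/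

section Main

lemma iter_comp {X Y : Scheme.{u}} {F : X ⟶ X} {f : Y ⟶ Y} {g : X ⟶ Y} (h : F ≫ g = g ≫ f) (n : ℕ) :
    iter F n ≫ g = g ≫ iter f n := by
  induction n with
  | zero => exact (Category.id_comp g).trans (Category.comp_id g).symm
  | succ n ih =>
    change (iter F n ≫ F) ≫ g = g ≫ iter f n ≫ f
    rw [Category.assoc, h, ← Category.assoc, ih, Category.assoc]

lemma iter_comp_eq {X Y : Scheme.{u}} {f : X ⟶ X} {g : X ⟶ Y} (h : f ≫ g = g) (n : ℕ) :
    iter f n ≫ g = g := by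
  induction n with
  | zero => exact Category.id_comp g
  | succ n ih =>
    change (iter f n ≫ f) ≫ g = g
    rw [Category.assoc, h, ih]

variable {k : Type u} [Field k]

lemma AffineSections.isScaling {X : Scheme.{u}} {L : LineBundle X} (A : AffineSections L)
    (s : X ⟶ Spec (.of k)) [IsProper s] {K : Type u} [Field K] [Algebra k K]
    {p : Spec (.of K) ⟶ X} (hp : p ≫ s = Spec.map (CommRingCat.ofHom (algebraMap k K)))
    {f : X ⟶ X} {q : ℕ} (hf : L.Scales f q) (φ : K →ₐ[k] K)
    (hφ : Spec.map (CommRingCat.ofHom (φ : K →+* K)) ≫ p = p ≫ f) {a₀ : L.ι}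
    (ha₀ : ⊤ ≤ p ⁻¹ᵁ L.U a₀) {j₀ : A.J} (hj₀ : A.val p ha₀ j₀ ≠ 0) :
    IsScaling φ (ratios k (A.val p ha₀) j₀) q := by
  have := A.finite
  have ha₀' := top_le_preimage_specMap (φ : K →+* K) p hφ ha₀
  obtain ⟨η, hη, H⟩ := A.exists_generates s p hp hf rfl ha₀ ha₀'
  refine isScaling_ratios hj₀ φ hη fun V hV => ?_
  obtain ⟨β, h1, h2⟩ := H V hV
  refine ⟨β, h1, ?_⟩
  rwa [show (fun j => φ (A.val p ha₀ j)) = A.val (p ≫ f) ha₀' from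
    funext fun j => (A.val_specMap p _ hφ ha₀ ha₀' j).symm]

variable {X₁ X₂ : Over (Spec (.of k))} [IsProper X₁.hom] [IsProper X₂.hom]
  {L₁ : LineBundle X₁.left} {L₂ : LineBundle X₂.left} {ζ : prod X₁ X₂}

/-- A fixed point of a product of endomorphisms that are polarized with different factors is generic
in the product of the closures of its projections. -/
lemma specializes_of_apply_eq [IsAlgClosed k] (A₁ : AffineSections L₁) (A₂ : AffineSections L₂)
    (F : prod X₁ X₂ ⟶ prod X₁ X₂) {f₁ : X₁.left ⟶ X₁.left} {f₂ : X₂.left ⟶ X₂.left}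
    (hF₁ : F ≫ pullback.fst X₁.hom X₂.hom = pullback.fst X₁.hom X₂.hom ≫ f₁)
    (hF₂ : F ≫ pullback.snd X₁.hom X₂.hom = pullback.snd X₁.hom X₂.hom ≫ f₂)
    (hf₁ : f₁ ≫ X₁.hom = X₁.hom) {q₁ q₂ : ℕ} (hL₁ : L₁.Scales f₁ q₁) (hL₂ : L₂.Scales f₂ q₂)
    (hq₁ : 1 ≤ q₁) (hq₂ : 1 ≤ q₂) (hq : q₁ ≠ q₂) (hζ : F ζ = ζ) {z : prod X₁ X₂}
    (hz₁ : pullback.fst X₁.hom X₂.hom ζ ⤳ pullback.fst X₁.hom X₂.hom z)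
    (hz₂ : pullback.snd X₁.hom X₂.hom ζ ⤳ pullback.snd X₁.hom X₂.hom z) : ζ ⤳ z := by
  obtain ⟨K, _, _, p, hpζ, hp⟩ := exists_isPoint_over (prodHom X₁ X₂) ζ
  have hp₁ := comp_fst_comp_hom hp
  have hp₂ := comp_snd_comp_hom hp
  obtain ⟨a₁, ha₁⟩ := L₁.exists_top_le_preimage_U (p ≫ pullback.fst X₁.hom X₂.hom)
  obtain ⟨a₂, ha₂⟩ := L₂.exists_top_le_preimage_U (p ≫ pullback.snd X₁.hom X₂.hom)
  obtain ⟨j₁, hj₁⟩ := A₁.exists_val_ne_zero _ ha₁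
  obtain ⟨j₂, hj₂⟩ := A₂.exists_val_ne_zero _ ha₂
  set W₁ := ratios k (A₁.val _ ha₁) j₁ with hW₁
  set W₂ := ratios k (A₂.val _ ha₂) j₂ with hW₂
  have hmem₁ : ∀ j, (A₁.val _ ha₁ j₁)⁻¹ * A₁.val _ ha₁ j ∈ W₁ := fun j =>
    Submodule.subset_span ⟨j, rfl⟩
  have hmem₂ : ∀ j, (A₂.val _ ha₂ j₂)⁻¹ * A₂.val _ ha₂ j ∈ W₂ := fun j =>
    Submodule.subset_span ⟨j, rfl⟩
  have := hpζ.essFiniteType hp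
  have := A₁.finite
  have := A₂.finite
  have hmemE : ∀ {S : Set K} {w : K}, w ∈ S → IsAlgebraic (IntermediateField.adjoin k S) w :=
    fun {S w} hw => isAlgebraic_algebraMap
      (⟨w, IntermediateField.subset_adjoin k S hw⟩ : IntermediateField.adjoin k S)
  have halg : Algebra.IsAlgebraic (Algebra.adjoin k (W₁ ∪ W₂ : Set K)) K := by
    have h1 := hpζ.isAlgebraic_of_ratios A₁ A₂ hp ha₁ ha₂ hj₁ hj₂
      (IntermediateField.adjoin k (W₁ ∪ W₂ : Set K)) (fun j => hmemE (Or.inl (hmem₁ j)))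
      (fun j => hmemE (Or.inr (hmem₂ j)))
    exact ⟨fun w => isAlgebraic_adjoin_iff.1 (h1.isAlgebraic w)⟩
  -- Every iterate of `F` fixes `ζ` and so induces an embedding of its residue field that scales
  -- `W₁` and `W₂` by the powers of `q₁` and `q₂`.
  have hscal : ∀ n, ∃ φ : K →ₐ[k] K, IsScaling φ W₁ (q₁ ^ n) ∧ IsScaling φ W₂ (q₂ ^ n) := by
    intro n
    have hFn : (p ≫ iter F n) ≫ prodHom X₁ X₂ =
        Spec.map (CommRingCat.ofHom (algebraMap k K)) := by
      rw [← hp, Category.assoc, prodHom, ← Category.assoc (iter F n), iter_comp hF₁,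
        Category.assoc, iter_comp_eq hf₁]
    have hζn : iter F n ζ = ζ := by
      rw [iter_apply, Function.iterate_fixed hζ]
    obtain ⟨φ, hφ⟩ := hpζ.exists_algHom hp (p ≫ iter F n) hFn
      ((congrArg (iter F n) hpζ.apply_closedPoint).trans hζn)
    refine ⟨φ, A₁.isScaling X₁.hom hp₁ (hL₁.iter n) φ ?_ ha₁ hj₁,
      A₂.isScaling X₂.hom hp₂ (hL₂.iter n) φ ?_ ha₂ hj₂⟩
    · rw [← Category.assoc, hφ, Category.assoc, iter_comp hF₁, Category.assoc]
    · rw [← Category.assoc, hφ, Category.assoc, iter_comp hF₂, Category.assoc]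
  obtain ⟨s, t, hs, -, hsW, htW, hst⟩ := exists_algebraicIndependent_sumElim
    (ratios_fg _ _) (ratios_fg _ _) (one_le_ratios hj₁) (one_le_ratios hj₂) halg hq₁ hq₂ hq hscal
  -- The relative closures of `k(s)` and `k(t)` contain the ratios of section values, so they are
  -- fields of definition of the two projections.
  obtain ⟨r₁, hr₁⟩ := A₁.exists_specMap_comp_eq X₁.hom _ hp₁ ha₁ hj₁
    (relClosure (IntermediateField.adjoin k s)) (fun _ => mem_relClosure_of_isAlgebraic)
    fun j => mem_relClosure_iff.2 (isAlgebraic_adjoin_iff.2 (hsW _ (hmem₁ j)))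
  obtain ⟨r₂, hr₂⟩ := A₂.exists_specMap_comp_eq X₂.hom _ hp₂ ha₂ hj₂
    (relClosure (IntermediateField.adjoin k t)) (fun _ => mem_relClosure_of_isAlgebraic)
    fun j => mem_relClosure_iff.2 (isAlgebraic_adjoin_iff.2 (htW _ (hmem₂ j)))
  rw [← hpζ.apply_closedPoint] at hz₁ hz₂ ⊢
  exact specializes_of_algebraicIndependent hp hs hst
    (fun w hw => mem_relClosure_iff.2 (hmemE hw)) (fun w hw => mem_relClosure_iff.2 (hmemE hw))
    (fun w hw => isAlgebraic_adjoin_iff.1 (mem_relClosure_iff.1 hw))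
    (fun w hw => isAlgebraic_adjoin_iff.1 (mem_relClosure_iff.1 hw)) hr₁ hr₂ hz₁ hz₂

lemma isPeriodicSubvariety_closure {X : Scheme.{u}} {f : X ⟶ X} {x : X} {n : ℕ} (hn : 1 ≤ n)
    (hx : (f : X → X)^[n] x = x) : IsPeriodicSubvariety f (closure {x}) where
  isClosed := isClosed_closure
  isIrreducible := isIrreducible_singleton.closure
  periodic := by
    refine ⟨n, hn, ?_⟩
    have h1 : Set.MapsTo (f : X → X)^[n] {x} {x} := by
      rintro _ rfl
      exact hx
    exact h1.closure (f.continuous.iterate n)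

/-- Polarized endomorphisms of proper schemes over an algebraically closed field with different
factors are independent. -/
theorem independent_of_isPolarized [IsAlgClosed k] {f₁ : X₁ ⟶ X₁} {f₂ : X₂ ⟶ X₂} {q₁ q₂ : ℕ}
    (hf₁ : IsPolarized f₁ q₁) (hf₂ : IsPolarized f₂ q₂) (hq : q₁ ≠ q₂) : Independent f₁ f₂ := by
  obtain ⟨hq₁, L₁, hL₁, ⟨i₁⟩⟩ := hf₁
  obtain ⟨hq₂, L₂, hL₂, ⟨i₂⟩⟩ := hf₂
  obtain ⟨A₁⟩ := hL₁.nonempty_affineSections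
  obtain ⟨A₂⟩ := hL₂.nonempty_affineSections
  intro Z hZ
  obtain ⟨n, hn, hmaps⟩ := hZ.periodic
  -- `Z` consists of the specializations of `ζ`, which reduces the claim about subsets to one about
  -- a single point.
  set ζ := hZ.isIrreducible.genericPoint with hζ
  have hcl : closure {ζ} = Z := by
    rw [hζ, hZ.isIrreducible.genericPoint_closure_eq, hZ.isClosed.closure_eq]
  have hZspec : ∀ z, z ∈ Z ↔ ζ ⤳ z := fun z => by
    rw [specializes_iff_mem_closure, hcl]
  have h₁ : prodMap f₁ f₂ ≫ pullback.fst X₁.hom X₂.hom =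
      pullback.fst X₁.hom X₂.hom ≫ f₁.left := pullback.lift_fst ..
  have h₂ : prodMap f₁ f₂ ≫ pullback.snd X₁.hom X₂.hom =
      pullback.snd X₁.hom X₂.hom ≫ f₂.left := pullback.lift_snd ..
  have hF₁ := iter_comp h₁ n
  have hF₂ := iter_comp h₂ n
  have hover : iter f₁.left n ≫ X₁.hom = X₁.hom := iter_comp_eq (Over.w f₁) n
  have hS₁ := (L₁.scales_of_iso i₁).iter n
  have hS₂ := (L₂.scales_of_iso i₂).iter n
  have hpos₁ : 1 ≤ q₁ ^ n := Nat.one_le_pow _ _ (by omega)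
  have hpos₂ : 1 ≤ q₂ ^ n := Nat.one_le_pow _ _ (by omega)
  have hne : q₁ ^ n ≠ q₂ ^ n := fun h => hq (Nat.pow_left_injective (by omega) h)
  have hspec : ζ ⤳ iter (prodMap f₁ f₂) n ζ := by
    rw [← hZspec, iter_apply]
    exact hmaps ((hZspec ζ).2 specializes_rfl)
  have hfix := apply_eq_of_specializes A₁ A₂ _ hF₁ hF₂ hover hS₁ hS₂ (by omega) (by omega) hspec
  refine ⟨closure {pullback.fst X₁.hom X₂.hom ζ}, closure {pullback.snd X₁.hom X₂.hom ζ},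
    isPeriodicSubvariety_closure hn ?_, isPeriodicSubvariety_closure hn ?_, ?_⟩
  · have h3 := congrArg (fun g : prod X₁ X₂ ⟶ X₁.left => g ζ) hF₁
    change pullback.fst X₁.hom X₂.hom (iter (prodMap f₁ f₂) n ζ) =
      iter f₁.left n (pullback.fst X₁.hom X₂.hom ζ) at h3
    rw [← iter_apply, ← h3, hfix]
  · have h3 := congrArg (fun g : prod X₁ X₂ ⟶ X₂.left => g ζ) hF₂
    change pullback.snd X₁.hom X₂.hom (iter (prodMap f₁ f₂) n ζ) =
      iter f₂.left n (pullback.snd X₁.hom X₂.hom ζ) at h3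
    rw [← iter_apply, ← h3, hfix]
  · ext z
    rw [hZspec, Set.mem_inter_iff, Set.mem_preimage, Set.mem_preimage,
      ← specializes_iff_mem_closure, ← specializes_iff_mem_closure]
    refine ⟨fun h => ⟨h.map (pullback.fst X₁.hom X₂.hom).continuous,
      h.map (pullback.snd X₁.hom X₂.hom).continuous⟩, fun h => ?_⟩
    exact specializes_of_apply_eq A₁ A₂ _ hF₁ hF₂ hover hS₁ hS₂ hpos₁ hpos₂ hne hfix h.1 h.2

end Main

end PolarizedDynamics

end

theorem mainTheorem12 {k : Type u} [Field k] [IsAlgClosed k]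
    {X₁ X₂ : CategoryTheory.Over (AlgebraicGeometry.Spec (.of k))}
    (hX₁ : PolarizedDynamics.IsProjectiveVariety X₁)
    (hX₂ : PolarizedDynamics.IsProjectiveVariety X₂)
    (f₁ : X₁ ⟶ X₁) (f₂ : X₂ ⟶ X₂) (q₁ q₂ : ℕ)
    (hf₁ : PolarizedDynamics.IsPolarized f₁ q₁)
    (hf₂ : PolarizedDynamics.IsPolarized f₂ q₂)
    (hq : q₁ ≠ q₂) :
    PolarizedDynamics.Independent f₁ f₂ := by
  have := hX₁.isProper
  have := hX₂.isProper
  exact PolarizedDynamics.independent_of_isPolarized hf₁ hf₂ hq
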